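/- Let $(\mathcal A,\pi,\mathcal H,D,J)$ be a real spectral triple of dimension $3$: $\mathcal A$ is a unital complex $*$-algebra with a faithful $*$-representation $\pi$ on the Hilbert space $\mathcal H$; $D$ is a selfadjoint operator with compact resolvent; $J$ is antiunitary with $J^2=-1$ and $JD=DJ$; all $[D,\pi(a)]$ are bounded; $[J\pi(a)J^{-1},\pi(b)]=0$ and $[J\pi(a)J^{-1},[D,\pi(b)]]=0$ for all $a,b\in\mathcal A$; and $|D|^{-s}$ is trace class for all real $s>3$. If $D$ (or $D_\Phi$ below) has a kernel, its sign and the complex and negative powers of it and of its absolute value are understood as those of $D+P$, where $P$ is the projection onto the kernel. Let $\delta=[|D|,\cdot\,]$, let $OP^0$ be the set of operators in the domain of all powers of $\delta$, $OP^{r}=\{T: T|D|^{-r}\in OP^0\}$ and $OP^{-\infty}=\bigcap_r OP^r$. Assume that the triple is regular ($\pi(a),[D,\pi(a)]\in OP^0$ for all $a$), that $[F,\pi(a)]\in OP^{-\infty}$ for all $a$, where $F=\operatorname{sign}(D)$, and that the dimension spectrum is simple: for every pseudodifferential operator $P\in OP^0$, the function $s\mapsto\operatorname{Tr}(P|D|^{-s})$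 (defined for large $\operatorname{Re}s$) extends meromorphically to $\mathbb C$ with at most simple poles. Here $T$ is called pseudodifferential if there is $d\in\mathbb Z$ such that for every $N\in\mathbb N$ one can write $T=QD^{-2p}+R$ with $p\in\mathbb N$, $Q$ in the algebra generated by $\pi(\mathcal A)$, $J\pi(\mathcal A)J^{-1}$, $D$, $|D|$, with $QD^{-2p}\in OP^d$ and $R\in OP^{-N}$. Write $\mathcal I(T)=\operatorname{Res}_{s=0}\operatorname{Tr}(T|D|^{-s})$ for the noncommutative integral of $T$, and let $\zeta_D$ and $\zeta_{D_\Phi}$ be the meromorphic continuations of $\operatorname{Tr}|D|^{-s}$ and $\operatorname{Tr}|D_\Phi|^{-s}$. Let $\Phi=\pi(\phi)$ with $\phi=\phi^*\in\mathcal A$, and $D_\Phi=D+\Phi+J\Phi J^{-1}$. Then all the noncommutative integrals below exist, $\zeta_D$ and $\zeta_{D_\Phi}$ continue meromorphically to $\mathbb C$, $\mathcal I(|D_\Phi|^{-k})=\operatorname{Res}_{s=k}\zeta_{D_\Phi}(s)$ for $k=1,2,3$ (at most simple poles), and (a) $\mathcal I(|D_\Phi|^{-3})=\mathcal I(|D|^{-3})$;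 (b) $\mathcal I(|D_\Phi|^{-2})=\mathcal I(|D|^{-2})-4\mathcal I(\Phi F|D|^{-3})$; (c) $\mathcal I(|D_\Phi|^{-1})=\mathcal I(|D|^{-1})-2\mathcal I(\Phi F|D|^{-2})+2\mathcal I(\Phi^2|D|^{-3})+2\mathcal I(\Phi J\Phi J^{-1}|D|^{-3})$; (d) $\zeta_{D_\Phi}(0)-\zeta_D(0)=-\Big(2\mathcal I(\Phi D^{-1})-\mathcal I(\Phi(\Phi+J\Phi J^{-1})D^{-2})-\mathcal I([D,\Phi](\Phi+J\Phi J^{-1})D^{-3})+\tfrac23\mathcal I(\Phi^3D^{-3})+2\mathcal I(\Phi^2J\Phi J^{-1}D^{-3})\Big).$ In (d) the left side means $\lim_{s\to0}(\zeta_{D_\Phi}(s)-\zeta_D(s))$; if $\zeta_D$ is holomorphic at $0$, then so is $\zeta_{D_\Phi}$, and the limit is the difference of the values. -/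

import Mathlib

open Filter Topology
open scoped InnerProductSpace ComplexConjugate

noncomputable section

namespace SpectralGeometry

universe u v

/-! ### Trace class operators and their trace -/

section Trace

variable {H : Type u} [NormedAddCommGroup H] [InnerProductSpace ℂ H] [CompleteSpace H]

/-- `B` is trace class (nuclear): `B = ∑ₙ ⟨xₙ, ·⟩ yₙ` with `∑ₙ ‖xₙ‖ ‖yₙ‖ < ∞`. -/
def IsTraceClass (B : H →L[ℂ] H) : Prop :=
  ∃ x y : ℕ → H, Summable (fun n => ‖x n‖ * ‖y n‖) ∧
    ∀ v : H, HasSum (fun n => ⟪x n, v⟫_ℂ • y n) (B v)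

/-- The trace `∑ₑ ⟨e, B e⟩` over a Hilbert basis (for a trace class operator the sum converges and
does not depend on the basis). -/
def opTrace (B : H →L[ℂ] H) : ℂ :=
  ∑' e : (exists_hilbertBasis ℂ H).choose, ⟪(e : H), B (e : H)⟫_ℂ

end Trace

/-! ### Selfadjoint operators with compact resolvent: functional calculus, smooth vectors,
the classes `OP^r`, zeta functions and the noncommutative integral -/

section Unbounded

variable {H : Type u} [NormedAddCommGroup H] [InnerProductSpace ℂ H] [CompleteSpace H]

/-- `D` has compact resolvent: `D - i` has a compact everywhere defined inverse `R`. -/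
def HasCompactResolvent (D : H →ₗ.[ℂ] H) : Prop :=
  ∃ R : H →L[ℂ] H, IsCompactOperator R ∧
    (∀ y : H, ∃ h : R y ∈ D.domain, D ⟨R y, h⟩ - Complex.I • R y = y) ∧
    (∀ x : D.domain, R (D x - Complex.I • (x : H)) = x)

/-- The eigenspace `ker (D - l)`. -/
def eigenspace (D : H →ₗ.[ℂ] H) (l : ℝ) : Submodule ℂ H :=
  (LinearMap.ker (D.toFun - (l : ℂ) • D.domain.subtype)).map D.domain.subtype

/-- The orthogonal projection onto `ker (D - l)` (which is closed when `D` is a closed operator). -/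
def eigenProj (D : H →ₗ.[ℂ] H) (l : ℝ) : H →L[ℂ] H :=
  (eigenspace D l).topologicalClosure.starProjection

/-- The functional calculus `f(D) x = ∑_l f(l) P_l x` of a selfadjoint operator with compact
resolvent, for `x` in the domain of `f(D)`. -/
def funCalc (D : H →ₗ.[ℂ] H) (f : ℝ → ℂ) (x : H) : H :=
  ∑' l : ℝ, f l • eigenProj D l x

/-- Negative powers, complex powers and the sign of `D` are, if `D` has a kernel, those of the
invertible operator `D + P`, where `P` is the (finite rank) projection onto the kernel: the
eigenvalue `0` is replaced by `1`. -/
def invertedEigenvalue (l : ℝ) : ℝ := if l = 0 then 1 else l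

/-- The domain of `D ^ k`. -/
def domPow (D : H →ₗ.[ℂ] H) : ℕ → Submodule ℂ H
  | 0 => ⊤
  | k + 1 => ((domPow D k).comap D.toFun).map D.domain.subtype

/-- The smooth vectors `H^∞ = ⋂ₖ dom (D ^ k)`. -/
def smoothVectors (D : H →ₗ.[ℂ] H) : Submodule ℂ H := ⨅ k, domPow D k

theorem mem_domPow_succ {D : H →ₗ.[ℂ] H} {k : ℕ} {x : H} :
    x ∈ domPow D (k + 1) ↔ ∃ h : x ∈ D.domain, D ⟨x, h⟩ ∈ domPow D k := by
  constructor
  · rintro ⟨y, hy, rfl⟩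
    exact ⟨y.2, hy⟩
  · rintro ⟨h, hx⟩
    exact ⟨⟨x, h⟩, hx, rfl⟩

theorem smoothVectors_le_domain (D : H →ₗ.[ℂ] H) : smoothVectors D ≤ D.domain := by
  intro x hx
  have h1 : x ∈ domPow D (0 + 1) := (Submodule.mem_iInf _).1 hx 1
  exact (mem_domPow_succ.1 h1).1

theorem apply_mem_smoothVectors (D : H →ₗ.[ℂ] H) (x : smoothVectors D) :
    D ⟨x, smoothVectors_le_domain D x.2⟩ ∈ smoothVectors D := by
  refine (Submodule.mem_iInf _).2 fun k => ?_
  have h1 : (x : H) ∈ domPow D (k + 1) := (Submodule.mem_iInf _).1 x.2 (k + 1)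
  exact (mem_domPow_succ.1 h1).2

/-- The algebra of linear operators on `H^∞`, in which all products of unbounded operators are
formed. -/
abbrev SmoothOp (D : H →ₗ.[ℂ] H) : Type u := Module.End ℂ (smoothVectors D)

/-- `D` as an operator on `H^∞`. -/
def selfOp (D : H →ₗ.[ℂ] H) : SmoothOp D :=
  LinearMap.codRestrict (smoothVectors D)
    (D.toFun.comp (Submodule.inclusion (smoothVectors_le_domain D)))
    (apply_mem_smoothVectors D)

open Classical in
/-- The operator on `H^∞` induced by a map `T` which sends `H^∞` linearly to itself. -/
def restr (D : H →ₗ.[ℂ] H) (T : H → H) : SmoothOp D :=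
  if h : ∃ S : SmoothOp D, ∀ x : smoothVectors D, (S x : H) = T x then h.choose else 0

/-- The map `|D|^z` on vectors. -/
def absPowFun (D : H →ₗ.[ℂ] H) (z : ℂ) : H → H :=
  funCalc D fun l => ((|invertedEigenvalue l| : ℝ) : ℂ) ^ z

/-- `|D|^z` on `H^∞`. -/
def absPow (D : H →ₗ.[ℂ] H) (z : ℂ) : SmoothOp D := restr D (absPowFun D z)

/-- `D^n`, for an integer `n`, on `H^∞`. -/
def intPow (D : H →ₗ.[ℂ] H) (n : ℤ) : SmoothOp D :=
  restr D (funCalc D fun l => (invertedEigenvalue l : ℂ) ^ n)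

/-- `F = sign D` on `H^∞`. -/
def signOp (D : H →ₗ.[ℂ] H) : SmoothOp D :=
  restr D (funCalc D fun l => ((Real.sign (invertedEigenvalue l) : ℝ) : ℂ))

/-- The bounded operator `B` on `H` extends `T`. -/
def Extends {D : H →ₗ.[ℂ] H} (B : H →L[ℂ] H) (T : SmoothOp D) : Prop :=
  ∀ x : smoothVectors D, B x = T x

/-- The derivation `δ(T) = [|D|, T]`. -/
def delta (D : H →ₗ.[ℂ] H) (T : SmoothOp D) : SmoothOp D :=
  absPow D 1 * T - T * absPow D 1

/-- `T ∈ OP^r`: `T |D|^{-r}` is in the domain of all powers of `δ`, that is, all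
`δ^k (T |D|^{-r})` are bounded. -/
def IsOP (D : H →ₗ.[ℂ] H) (r : ℤ) (T : SmoothOp D) : Prop :=
  ∀ k : ℕ, ∃ B : H →L[ℂ] H, Extends B ((delta D)^[k] (T * absPow D (-(r : ℂ))))

/-- `OP^{-∞}`, the intersection of all `OP^r`. -/
def IsSmoothing (D : H →ₗ.[ℂ] H) (T : SmoothOp D) : Prop := ∀ r : ℤ, IsOP D r T

/-- `T` extends to a trace class operator of trace `z`. -/
def HasTrace {D : H →ₗ.[ℂ] H} (T : SmoothOp D) (z : ℂ) : Prop :=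
  ∃ B : H →L[ℂ] H, Extends B T ∧ IsTraceClass B ∧ opTrace B = z

/-- `Z` is the zeta function `ζ_D^P`: the meromorphic function on the whole plane (with the value
of its analytic extension at every point that is not a pole) which equals `Tr (P |D|^{-s})`
for all `s` of large real part. For `P = 1` this is `ζ_D`. -/
def IsZeta (D : H →ₗ.[ℂ] H) (P : SmoothOp D) (Z : ℂ → ℂ) : Prop :=
  MeromorphicNFOn Z Set.univ ∧
    ∃ r : ℝ, ∀ s : ℂ, r < s.re → HasTrace (P * absPow D (-s)) (Z s)

/-- `Z` has at most a simple pole at `s₀`, with residue `r`. -/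
def HasSimpleResidue (Z : ℂ → ℂ) (s₀ r : ℂ) : Prop :=
  Tendsto (fun s => (s - s₀) * Z s) (𝓝[≠] s₀) (𝓝 r)

/-- The noncommutative integral of `P` exists and is `r`: `r = Res_{s = 0} Tr (P |D|^{-s})`. -/
def HasNCInt (D : H →ₗ.[ℂ] H) (P : SmoothOp D) (r : ℂ) : Prop :=
  ∃ Z : ℂ → ℂ, IsZeta D P Z ∧ HasSimpleResidue Z 0 r

open Classical in
/-- The noncommutative integral of `P` (and `0` if it does not exist). -/
def ncInt (D : H →ₗ.[ℂ] H) (P : SmoothOp D) : ℂ :=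
  if h : ∃ r, HasNCInt D P r then h.choose else 0

/-- `B` is the bounded extension of the commutator `[D, T]`; in particular `T` preserves the domain
of `D`. -/
def IsCommutator (D : H →ₗ.[ℂ] H) (T B : H →L[ℂ] H) : Prop :=
  ∀ x : D.domain, ∃ h : T x ∈ D.domain, B x = D ⟨T x, h⟩ - T (D x)

end Unbounded

/-! ### Real spectral triples -/

/-- The bounded linear operator `J T J⁻¹` for an antiunitary `J`. -/
def conjBy {H : Type u} [NormedAddCommGroup H] [InnerProductSpace ℂ H]
    (J : H ≃ₗᵢ⋆[ℂ] H) (T : H →L[ℂ] H) : H →L[ℂ] H :=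
  (J.toContinuousLinearEquiv : H →SL[starRingEnd ℂ] H).comp
    (T.comp (J.symm.toContinuousLinearEquiv : H →SL[starRingEnd ℂ] H))

/-- A real spectral triple `(A, π, H, D, J)` of `KO`-dimension `3`, that is, with `J D = D J` and
`J² = -1`. -/
structure RealSpectralTriple (A : Type v) (H : Type u) [Ring A] [StarRing A] [Algebra ℂ A]
    [StarModule ℂ A] [NormedAddCommGroup H] [InnerProductSpace ℂ H] [CompleteSpace H] where
  /-- the representation of the algebra -/
  π : A →⋆ₐ[ℂ] (H →L[ℂ] H)
  π_injective : Function.Injective π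
  /-- the Dirac operator -/
  D : H →ₗ.[ℂ] H
  isSelfAdjoint_D : IsSelfAdjoint D
  compactResolvent : HasCompactResolvent D
  /-- the real structure -/
  J : H ≃ₗᵢ⋆[ℂ] H
  J_sq : ∀ x, J (J x) = -x
  J_comm_D : ∀ x : D.domain, ∃ h : J x ∈ D.domain, D ⟨J x, h⟩ = J (D x)
  bounded_commutator : ∀ a, ∃ B, IsCommutator D (π a) B
  order_zero : ∀ a b, Commute (conjBy J (π a)) (π b)
  order_one : ∀ a b B, IsCommutator D (π b) B → Commute (conjBy J (π a)) B

namespace RealSpectralTriple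

variable {A : Type v} {H : Type u} [Ring A] [StarRing A] [Algebra ℂ A] [StarModule ℂ A]
  [NormedAddCommGroup H] [InnerProductSpace ℂ H] [CompleteSpace H]

/-- `π(a)` as an operator on `H^∞`. -/
def left (S : RealSpectralTriple A H) (a : A) : SmoothOp S.D := restr S.D (S.π a)

/-- `J π(a) J⁻¹` as an operator on `H^∞`. -/
def right (S : RealSpectralTriple A H) (a : A) : SmoothOp S.D := restr S.D (conjBy S.J (S.π a))

/-- `[D, π(a)]` as an operator on `H^∞`. -/
def dirac (S : RealSpectralTriple A H) (a : A) : SmoothOp S.D :=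
  selfOp S.D * S.left a - S.left a * selfOp S.D

/-- Regularity: `π(a)` and `[D, π(a)]` are in the domain of all powers of `δ = [|D|, ·]`. -/
def Regular (S : RealSpectralTriple A H) : Prop :=
  ∀ a, (∀ x ∈ smoothVectors S.D, S.π a x ∈ smoothVectors S.D) ∧
    IsOP S.D 0 (S.left a) ∧ IsOP S.D 0 (S.dirac a)

/-- Metric dimension (at most) `n`: `|D|^{-s}` is trace class for all real `s > n`. -/
def HasMetricDimension (S : RealSpectralTriple A H) (n : ℕ) : Prop :=
  ∀ s : ℝ, (n : ℝ) < s → ∃ z, HasTrace (absPow S.D (-(s : ℂ))) z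

/-- The algebra generated by `A`, `J A J⁻¹`, `D` and `|D|`. -/
def diffOps (S : RealSpectralTriple A H) : Subalgebra ℂ (SmoothOp S.D) :=
  Algebra.adjoin ℂ (Set.range S.left ∪ Set.range S.right ∪ {selfOp S.D, absPow S.D 1})

/-- The pseudodifferential operators: `T` is one if, for some integer `d` and for every `N`, it is
of the form `P D^{-2p} + R` with `P` in the algebra generated by `A`, `J A J⁻¹`, `D` and `|D|`,
`P D^{-2p} ∈ OP^d` and `R ∈ OP^{-N}`. -/
def IsPseudodifferential (S : RealSpectralTriple A H) (T : SmoothOp S.D) : Prop :=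
  ∃ d : ℤ, ∀ N : ℕ, ∃ p : ℕ, ∃ P ∈ S.diffOps, ∃ R : SmoothOp S.D,
    IsOP S.D (-(N : ℤ)) R ∧ IsOP S.D d (P * intPow S.D (-2 * (p : ℤ))) ∧
      T = P * intPow S.D (-2 * (p : ℤ)) + R

/-- Simple dimension spectrum: for all pseudodifferential operators `P` of order `0` the zeta
function `Tr (P |D|^{-s})` continues meromorphically to the whole plane, and its poles (which, for
all these `P` together, make up the dimension spectrum) are simple. -/
def SimpleDimensionSpectrum (S : RealSpectralTriple A H) : Prop :=
  ∀ P : SmoothOp S.D, S.IsPseudodifferential P → IsOP S.D 0 P →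
    ∃ Z : ℂ → ℂ, IsZeta S.D P Z ∧ ∀ s : ℂ, ((-1 : ℤ) : WithTop ℤ) ≤ meromorphicOrderAt Z s

/-- `[F, π(a)] ∈ OP^{-∞}` for all `a`, where `F = sign D`. -/
def SignCommutesModSmoothing (S : RealSpectralTriple A H) : Prop :=
  ∀ a, IsSmoothing S.D (signOp S.D * S.left a - S.left a * signOp S.D)

/-- The perturbed Dirac operator `D_Φ = D + Φ + J Φ J⁻¹`, `Φ = π(φ)`, with the domain of `D`. -/
def perturbedD (S : RealSpectralTriple A H) (φ : A) : H →ₗ.[ℂ] H :=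
  ((S.π φ + conjBy S.J (S.π φ) : H →L[ℂ] H) : H →ₗ[ℂ] H) +ᵥ S.D

/-- `|D_Φ|^z` as an operator on the smooth vectors of `D`. -/
def perturbedAbsPow (S : RealSpectralTriple A H) (φ : A) (z : ℂ) : SmoothOp S.D :=
  restr S.D (absPowFun (S.perturbedD φ) z)

end RealSpectralTriple

end SpectralGeometry

end

/-!
Let `A = Φ + JΦJ⁻¹`, so that `D_Φ = D + A`. Both `D` and `D_Φ` are diagonal in Hilbert bases, `eₖ`
with eigenvalues `dₖ` and `fᵢ` with eigenvalues `lᵢ`; for `D_Φ` the resolvent stays compact by the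
Fredholm alternative (`exists_isResolvent_vadd`, `exists_diagonalization`). Expanding one basis in
the other gives, for large `Re s`,

  `Tr |D_Φ|^(-s) = ∑ᵢₖ |⟨fᵢ, eₖ⟩|² |lᵢ|^(-s)`  and
  `Tr (|D_Φ|^(-m) |D|^(-s)) = ∑ᵢₖ |⟨fᵢ, eₖ⟩|² |lᵢ|^(-m) |dₖ|^(-s)`.

In both double series, `l ↦ |l|^(-u)` is expanded in a Taylor series at `l = dₖ`. This avoids
asymptotic expansions of complex powers of operators: only numbers are expanded.

The expansion is legitimate because the weights `|⟨fᵢ, eₖ⟩|²` are concentrated near `lᵢ = dₖ`.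
Indeed `⟨fᵢ, T eₖ⟩ (dₖ - lᵢ)` is the matrix entry of `T D - (D + A) T`, the operator
`intertwine A T`. By regularity, and since `F` commutes with `Φ` modulo smoothing operators, the
iterates of this map at `T = 1` all have order zero, in particular are bounded. Bessel's inequality
then bounds all moments of `|lᵢ - dₖ|`, uniformly in `k` (`hasMoments_pairWeight`). The Taylor
remainder of order `N` is at most `|dₖ|^(-Re u - N)` times a constant and a power of
`1 + |lᵢ - dₖ|`, also if `lᵢ` and `dₖ` have different signs (`exists_taylorRem_bound`). So its
double series is holomorphic in a half plane that is larger by `N` than the original one.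
Hence (`remSeries_zero_eq`) the double series are, up to such a remainder,

  `∑ⱼ (u (u + 1) ⋯ (u + j - 1) / j!) Zⱼ(s + κ + j)`,

with `u = s`, `κ = 0` in the first case and `u = κ = m` in the second. Here `Zⱼ` is the Dirichlet
series of the `j`-th moments, which are the diagonal entries of `(intertwine A)^[j] 1` times `F^j`.
These operators are pseudodifferential of order zero, so each `Zⱼ` has a meromorphic continuation
with at most simple poles, by the simple dimension spectrum, and gluing continues the double series
(`exists_continuation_remSeries`).

Since the diagonal of a commutator with `D` vanishes, the moments of order `1`, `2`, `3` are those
of `-A F`, `A²` and `([D, A] A - A³) F` (`signedMoment_one`, `signedMoment_two`,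
`signedMoment_three`). The terms with `[D, A]` do not contribute: expanding the double series with
weights `⟨X eₖ, eᵢ⟩ ⟨eᵢ, Y eₖ⟩`, whose value is the same with `|dₖ|^(-s)` in place of `|dᵢ|^(-s)`
by the trace property, shows that `[D, X] Y F |D|^(-3)` has no residue for commuting symmetric `X`
and `Y` (`Diagonalizes.hasRes_commutator_mul`). Finally `J` maps the eigenbasis to an eigenbasis, so
a symmetric operator and its conjugate by `J` have equal residues (`dirichlet_conjOp`), which sums
the powers of `A` up to the stated combinations of `Φ` and `JΦJ⁻¹`.

The residues of the expansions at the points `3`, `2`, `1` and, with fixed `u`, at `0` give the two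
readings of the first three formulas (`exists_isZeta_perturbed`, `hasNCInt_perturbed`). At `s = 0`
the term `j = 0` is the zeta function of `D`, and for `j ≥ 1` the zero of the coefficient cancels
the pole of `Zⱼ(s + j)`; so the limit of the difference is `∑ⱼ Res Zⱼ(j) / j` over `j = 1, 2, 3`,
which is the last formula.
-/

open Filter Topology
open scoped InnerProductSpace ComplexConjugate

noncomputable section

namespace SpectralGeometry

universe u

set_option linter.unusedSectionVars false

/-! ### Taylor expansion of complex powers -/

/-- The binomial coefficient `u (u + 1) ⋯ (u + j - 1) / j!`, that is, the `j`-th Taylor coefficient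
of `(1 - x) ^ (-u)`. -/
def negBinom (j : ℕ) (u : ℂ) : ℂ := (∏ i ∈ Finset.range j, (u + i)) / (j.factorial : ℂ)

theorem negBinom_zero (u : ℂ) : negBinom 0 u = 1 := by simp [negBinom]

theorem negBinom_succ_mul (j : ℕ) (u : ℂ) :
    negBinom (j + 1) u * (j + 1) = u * negBinom j (u + 1) := by
  have h1 : (j.factorial : ℂ) ≠ 0 := by exact_mod_cast j.factorial_ne_zero
  have h2 : (j + 1 : ℂ) ≠ 0 := by exact_mod_cast j.succ_ne_zero
  have h3 : ∏ i ∈ Finset.range (j + 1), (u + i) =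
      u * ∏ i ∈ Finset.range j, (u + 1 + i) := by
    rw [Finset.prod_range_succ', mul_comm]
    simp only [Nat.cast_zero, add_zero]
    congr 1
    refine Finset.prod_congr rfl fun i _ => ?_
    push_cast; ring
  unfold negBinom
  rw [h3, Nat.factorial_succ]
  push_cast
  field_simp

theorem differentiable_negBinom (j : ℕ) : Differentiable ℂ (negBinom j) := by
  unfold negBinom
  fun_prop

/-- The remainder of order `N` in the expansion of `(1 - x) ^ (-u)` at `x = 0`. -/
def binomRem (N : ℕ) (u : ℂ) (x : ℝ) : ℂ :=
  ((1 - x : ℝ) : ℂ) ^ (-u) - ∑ j ∈ Finset.range N, negBinom j u * (x : ℂ) ^ j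

/-- Differentiation lowers the order of the remainder by one and raises `u` by one. -/
theorem hasDerivAt_binomRem (N : ℕ) (u : ℂ) {x : ℝ} (hx : x < 1) :
    HasDerivAt (binomRem (N + 1) u) (u * binomRem N (u + 1) x) x := by
  have h0 : ((1 - x : ℝ) : ℂ) ∈ Complex.slitPlane :=
    Complex.ofReal_mem_slitPlane.2 (by linarith)
  have h2 : HasDerivAt (fun y : ℝ => ((1 - y : ℝ) : ℂ) ^ (-u))
      (u * ((1 - x : ℝ) : ℂ) ^ (-(u + 1))) x := by
    have h1 : HasDerivAt (fun z : ℂ => 1 - z) (-1) (x : ℂ) := by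
      simpa using (hasDerivAt_id (x : ℂ)).const_sub 1
    have := (h1.cpow_const (c := -u) (by simpa using h0)).comp_ofReal
    push_cast
    convert this using 1
    rw [show -(u + 1) = -u - 1 by ring]; ring
  have h3 : HasDerivAt (fun y : ℝ => ∑ j ∈ Finset.range (N + 1), negBinom j u * (y : ℂ) ^ j)
      (∑ j ∈ Finset.range (N + 1), negBinom j u * (j * (x : ℂ) ^ (j - 1))) x := by
    refine HasDerivAt.fun_sum fun j _ => HasDerivAt.const_mul _ ?_
    simpa using ((hasDerivAt_id x).ofReal_comp).fun_pow j
  have h4 : ∑ j ∈ Finset.range (N + 1), negBinom j u * (j * (x : ℂ) ^ (j - 1)) =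
      u * ∑ j ∈ Finset.range N, negBinom j (u + 1) * (x : ℂ) ^ j := by
    rw [Finset.sum_range_succ', Finset.mul_sum]
    simp only [Nat.cast_zero, zero_mul, mul_zero, add_zero, Nat.add_sub_cancel]
    refine Finset.sum_congr rfl fun j _ => ?_
    have := negBinom_succ_mul j u
    push_cast
    linear_combination (x : ℂ) ^ j * this
  have h5 := h2.sub h3
  rw [h4] at h5
  refine h5.congr_deriv ?_
  unfold binomRem
  ring

theorem binomRem_zero_right (N : ℕ) (u : ℂ) : binomRem (N + 1) u 0 = 0 := by
  simp [binomRem, Finset.sum_range_succ', negBinom_zero]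

/-- The Taylor remainder bound, uniform for `u` in a bounded set: the derivative of the remainder
of order `N + 1` at `u` is `u` times the remainder of order `N` at `u + 1`. -/
theorem exists_binomRem_bound (N : ℕ) : ∀ K : ℝ, ∃ C : ℝ, 0 ≤ C ∧ ∀ u : ℂ, ‖u‖ ≤ K →
    ∀ x : ℝ, |x| ≤ 1 / 2 → ‖binomRem N u x‖ ≤ C * |x| ^ N := by
  induction N with
  | zero =>
    intro K
    refine ⟨2 ^ |K|, by positivity, fun u hu x hx => ?_⟩
    have hx' := abs_le.1 hx
    have h1 : (0 : ℝ) < 1 - x := by linarith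
    have hK : 0 ≤ K := (norm_nonneg u).trans hu
    rw [binomRem, Finset.range_zero, Finset.sum_empty, sub_zero, pow_zero, mul_one,
      Complex.norm_cpow_eq_rpow_re_of_pos h1, abs_of_nonneg hK]
    have hre := abs_le.1 ((Complex.abs_re_le_norm u).trans hu)
    rw [Complex.neg_re]
    rcases le_or_gt 0 u.re with h | h
    · rw [Real.rpow_neg h1.le, ← Real.inv_rpow h1.le]
      have h2 : (1 - x)⁻¹ ≤ 2 := by
        rw [inv_le_comm₀ h1 two_pos]; linarith
      calc ((1 - x)⁻¹) ^ u.re ≤ 2 ^ u.re := Real.rpow_le_rpow (by positivity) h2 h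
        _ ≤ 2 ^ K := Real.rpow_le_rpow_of_exponent_le one_le_two hre.2
    · calc (1 - x) ^ (-u.re) ≤ 2 ^ (-u.re) :=
            Real.rpow_le_rpow h1.le (by linarith) (by linarith)
        _ ≤ 2 ^ K := Real.rpow_le_rpow_of_exponent_le one_le_two (by linarith)
  | succ N ih =>
    intro K
    obtain ⟨C, hC, h⟩ := ih (K + 1)
    refine ⟨|K| * C, by positivity, fun u hu x hx => ?_⟩
    have hK : 0 ≤ K := (norm_nonneg u).trans hu
    rw [abs_of_nonneg hK]
    have hseg : ∀ y ∈ segment ℝ 0 x, |y| ≤ |x| := by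
      intro y hy
      rw [segment_eq_uIcc] at hy
      simpa using Set.abs_sub_left_of_mem_uIcc hy
    have key := Convex.norm_image_sub_le_of_norm_hasDerivWithin_le
      (f := binomRem (N + 1) u) (f' := fun y => u * binomRem N (u + 1) y)
      (s := segment ℝ 0 x) (C := K * (C * |x| ^ N)) (x := 0) (y := x)
      (fun y hy => ?_) (fun y hy => ?_) (convex_segment 0 x)
      (left_mem_segment ℝ 0 x) (right_mem_segment ℝ 0 x)
    · rw [binomRem_zero_right, sub_zero, sub_zero, Real.norm_eq_abs] at key
      refine key.trans (le_of_eq ?_)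
      ring
    · have := hseg y hy
      have h2 := abs_le.1 (this.trans hx)
      exact (hasDerivAt_binomRem N u (by linarith)).hasDerivWithinAt
    · have hy1 := hseg y hy
      rw [norm_mul]
      refine mul_le_mul hu ((h (u + 1) ?_ y (hy1.trans hx)).trans ?_) (norm_nonneg _) hK
      · exact (norm_add_le _ _).trans (by simpa using hu)
      · gcongr

/-- `|l| ^ z`, with the eigenvalue `0` replaced by `1`. -/
def absCpow (l : ℝ) (z : ℂ) : ℂ := ((|invertedEigenvalue l| : ℝ) : ℂ) ^ z

/-- The sign of `l`, with the eigenvalue `0` replaced by `1`. -/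
def eigenSign (l : ℝ) : ℝ := Real.sign (invertedEigenvalue l)

theorem invertedEigenvalue_ne_zero (l : ℝ) : invertedEigenvalue l ≠ 0 := by
  unfold invertedEigenvalue; split_ifs with h <;> simp [h]

theorem abs_invertedEigenvalue_pos (l : ℝ) : 0 < |invertedEigenvalue l| :=
  abs_pos.2 (invertedEigenvalue_ne_zero l)

theorem norm_absCpow (l : ℝ) (z : ℂ) : ‖absCpow l z‖ = |invertedEigenvalue l| ^ z.re :=
  Complex.norm_cpow_eq_rpow_re_of_pos (abs_invertedEigenvalue_pos l) z

theorem absCpow_add (l : ℝ) (z z' : ℂ) : absCpow l (z + z') = absCpow l z * absCpow l z' :=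
  Complex.cpow_add _ _ (by exact_mod_cast (abs_invertedEigenvalue_pos l).ne')

theorem absCpow_zero (l : ℝ) : absCpow l 0 = 1 := Complex.cpow_zero _

theorem differentiable_absCpow (l : ℝ) : Differentiable ℂ (absCpow l) := by
  have : ((|invertedEigenvalue l| : ℝ) : ℂ) ≠ 0 := by
    exact_mod_cast (abs_invertedEigenvalue_pos l).ne'
  intro z
  exact differentiableAt_id.const_cpow (Or.inl this)

theorem eigenSign_mul_self (l : ℝ) : eigenSign l * eigenSign l = 1 := by
  unfold eigenSign
  rcases (invertedEigenvalue_ne_zero l).lt_or_gt with h | h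
  · simp [Real.sign_of_neg h]
  · simp [Real.sign_of_pos h]

theorem abs_eigenSign (l : ℝ) : |eigenSign l| = 1 := by
  have h := eigenSign_mul_self l
  rw [← abs_mul_abs_self] at h
  nlinarith [abs_nonneg (eigenSign l)]

theorem eigenSign_mul_abs (l : ℝ) :
    eigenSign l * |invertedEigenvalue l| = invertedEigenvalue l := by
  unfold eigenSign
  rcases (invertedEigenvalue_ne_zero l).lt_or_gt with h | h
  · simp [Real.sign_of_neg h, abs_of_neg h]
  · simp [Real.sign_of_pos h, abs_of_pos h]

/-- The remainder of order `N` in the Taylor expansion of `l ↦ |l| ^ (-u)` at the point `d`. -/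
def taylorRem (N : ℕ) (u : ℂ) (d l : ℝ) : ℂ :=
  absCpow l (-u) - ∑ j ∈ Finset.range N,
    negBinom j u * ((eigenSign d * (d - l) : ℝ) : ℂ) ^ j * absCpow d (-(u + j))

/-- If `l` is close to `d`, it has the same sign, and the Taylor remainder is that of the binomial
series in `(d - l) / d`. -/
theorem taylorRem_eq_binomRem {N : ℕ} {u : ℂ} {d l : ℝ} (hd : d ≠ 0) (h : |l - d| ≤ |d| / 2) :
    taylorRem N u d l = absCpow d (-u) * binomRem N u ((d - l) / d) := by
  have hdpos : 0 < |d| := abs_pos.2 hd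
  have hq : |(d - l) / d| ≤ 1 / 2 := by
    rw [abs_div, div_le_iff₀ hdpos, abs_sub_comm]; linarith
  have h1 : 0 < 1 - (d - l) / d := by linarith [(abs_le.1 hq).2]
  have hl : l = d * (1 - (d - l) / d) := by field_simp; ring
  have hl0 : l ≠ 0 := by rw [hl]; exact mul_ne_zero hd h1.ne'
  have hil : invertedEigenvalue l = l := by simp [invertedEigenvalue, hl0]
  have hid : invertedEigenvalue d = d := by simp [invertedEigenvalue, hd]
  have habs : |l| = |d| * (1 - (d - l) / d) := by
    conv_lhs => rw [hl, abs_mul, abs_of_pos h1]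
  have e1 : absCpow l (-u) = absCpow d (-u) * ((1 - (d - l) / d : ℝ) : ℂ) ^ (-u) := by
    unfold absCpow
    rw [hil, hid, habs, Complex.ofReal_mul, Complex.mul_cpow_ofReal_nonneg hdpos.le h1.le]
  have hs : eigenSign d * |d| = d := by simpa [hid] using eigenSign_mul_abs d
  unfold taylorRem binomRem
  rw [e1, mul_sub (absCpow d (-u)), Finset.mul_sum]
  congr 1
  refine Finset.sum_congr rfl fun j _ => ?_
  have e2 : absCpow d (-(u + j)) = absCpow d (-u) * (((|d|)⁻¹ ^ j : ℝ) : ℂ) := by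
    rw [neg_add, absCpow_add]
    congr 1
    unfold absCpow
    rw [hid, Complex.cpow_neg, Complex.cpow_natCast]
    push_cast; rw [inv_pow]
  have e3 : (d - l) / d = eigenSign d * (d - l) * (|d|)⁻¹ := by
    have : eigenSign d * (|d|)⁻¹ = d⁻¹ := by
      have h2 := eigenSign_mul_self d
      rw [eq_comm, inv_eq_iff_eq_inv, mul_inv, inv_inv]
      have h3 : (eigenSign d)⁻¹ = eigenSign d := inv_eq_of_mul_eq_one_left h2
      rw [h3, hs]
    rw [div_eq_mul_inv, ← this]; ring
  rw [e2, e3]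
  push_cast
  rw [mul_pow _ (((|d| : ℝ) : ℂ)⁻¹) j]
  ring

/-- Powers with bounded exponent of a number which is bounded below, and bounded above by a multiple
of `1 + t`, are dominated by one power of `1 + t`. -/
theorem exists_rpow_bound {c B : ℝ} (hc : 0 < c) (K : ℝ) : ∃ C : ℝ, 0 ≤ C ∧ ∃ m : ℕ,
    ∀ y t σ : ℝ, 0 ≤ t → c ≤ y → y ≤ B * (1 + t) → |σ| ≤ K → y ^ σ ≤ C * (1 + t) ^ m := by
  set M := max (max B c⁻¹) 1 with hM
  have hM1 : 1 ≤ M := le_max_right _ _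
  refine ⟨M ^ ⌈K⌉₊, by positivity, ⌈K⌉₊, fun y t σ ht hcy hy hσ => ?_⟩
  have hy0 : 0 < y := hc.trans_le hcy
  have hMt : 1 ≤ M * (1 + t) := by nlinarith
  have hyM : y ≤ M * (1 + t) := hy.trans (by
    have : B ≤ M := (le_max_left _ _).trans (le_max_left _ _)
    gcongr)
  have hyM' : y⁻¹ ≤ M * (1 + t) := by
    have h1 : y⁻¹ ≤ c⁻¹ := inv_anti₀ hc hcy
    have h2 : c⁻¹ ≤ M := (le_max_right _ _).trans (le_max_left _ _)
    nlinarith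
  have key : y ^ σ ≤ (M * (1 + t)) ^ |σ| := by
    rcases le_total 0 σ with h | h
    · rw [abs_of_nonneg h]; exact Real.rpow_le_rpow hy0.le hyM h
    · rw [abs_of_nonpos h]
      have : y ^ σ = (y⁻¹) ^ (-σ) := by rw [Real.inv_rpow hy0.le, Real.rpow_neg hy0.le, inv_inv]
      rw [this]; exact Real.rpow_le_rpow (by positivity) hyM' (by linarith)
  calc y ^ σ ≤ (M * (1 + t)) ^ |σ| := key
    _ ≤ (M * (1 + t)) ^ ((⌈K⌉₊ : ℕ) : ℝ) :=
        Real.rpow_le_rpow_of_exponent_le hMt (hσ.trans (Nat.le_ceil K))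
    _ = M ^ ⌈K⌉₊ * (1 + t) ^ ⌈K⌉₊ := by rw [Real.rpow_natCast, mul_pow]

theorem exists_negBinom_bound (j : ℕ) (K : ℝ) : ∃ C : ℝ, 0 ≤ C ∧ ∀ u : ℂ, ‖u‖ ≤ K →
    ‖negBinom j u‖ ≤ C := by
  obtain ⟨C, hC⟩ := (isCompact_closedBall (0 : ℂ) K).exists_bound_of_continuousOn
    (differentiable_negBinom j).continuous.continuousOn
  exact ⟨max C 0, le_max_right _ _, fun u hu => (hC u (by simpa using hu)).trans (le_max_left _ _)⟩

/-- The decisive estimate: the Taylor remainder of `|l| ^ (-u)` at `d` is bounded by `|d| ^ (-u-N)`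
times a power of `1 + |l - d|`. If `|l - d| > |d| / 2`, in particular if `l` and `d` have opposite
signs or one of them is zero, each single term obeys such a bound, as `|d|` and `|l|` are then at
most a multiple of `1 + |l - d|`. -/
theorem exists_taylorRem_bound {c : ℝ} (hc : 0 < c) (N : ℕ) (K : ℝ) :
    ∃ C : ℝ, 0 ≤ C ∧ ∃ m : ℕ, ∀ u : ℂ, ‖u‖ ≤ K → ∀ d l : ℝ,
      c ≤ |invertedEigenvalue d| → c ≤ |invertedEigenvalue l| →
      ‖taylorRem N u d l‖ ≤ C * (1 + |l - d|) ^ m * |invertedEigenvalue d| ^ (-(u.re + N)) := by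
  obtain ⟨C₁, hC₁, h₁⟩ := exists_binomRem_bound N K
  obtain ⟨C₂, hC₂, m₂, h₂⟩ := exists_rpow_bound (B := 3) hc (|K| + N)
  choose C₃ hC₃ h₃ using fun j => exists_negBinom_bound j K
  have hnear : ∀ u : ℂ, ‖u‖ ≤ K → ∀ d l : ℝ, d ≠ 0 → |l - d| ≤ |d| / 2 →
      ‖taylorRem N u d l‖ ≤ C₁ * (1 + |l - d|) ^ N * |invertedEigenvalue d| ^ (-(u.re + N)) := by
    intro u hu d l hd h
    have hdpos : 0 < |d| := abs_pos.2 hd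
    have hid : invertedEigenvalue d = d := by simp [invertedEigenvalue, hd]
    have hq : |(d - l) / d| ≤ 1 / 2 := by
      rw [abs_div, div_le_iff₀ hdpos, abs_sub_comm]; linarith
    rw [taylorRem_eq_binomRem hd h, norm_mul, norm_absCpow, hid, Complex.neg_re]
    have e : |d| ^ (-(u.re + N)) = |d| ^ (-u.re) * (|d| ^ N)⁻¹ := by
      rw [neg_add, Real.rpow_add hdpos, Real.rpow_neg hdpos.le (N : ℝ), Real.rpow_natCast]
    rw [e]
    calc |d| ^ (-u.re) * ‖binomRem N u ((d - l) / d)‖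
        ≤ |d| ^ (-u.re) * (C₁ * |(d - l) / d| ^ N) := by
          gcongr
          exact h₁ u hu _ hq
      _ = C₁ * |l - d| ^ N * (|d| ^ (-u.re) * (|d| ^ N)⁻¹) := by
          rw [abs_div, div_pow, abs_sub_comm d l]; field_simp
      _ ≤ C₁ * (1 + |l - d|) ^ N * (|d| ^ (-u.re) * (|d| ^ N)⁻¹) := by
          gcongr
          linarith
  -- the Taylor polynomial is no approximation here, and every term is estimated separately
  have hfar : ∀ u : ℂ, ‖u‖ ≤ K → ∀ d l : ℝ,
      c ≤ |invertedEigenvalue d| → c ≤ |invertedEigenvalue l| → |d| ≤ 2 * |l - d| →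
      ‖taylorRem N u d l‖ ≤ (C₂ * C₂ + ∑ j ∈ Finset.range N, C₃ j * C₂) *
        (1 + |l - d|) ^ (N + (m₂ + m₂)) * |invertedEigenvalue d| ^ (-(u.re + N)) := by
    intro u hu d l hcd hcl h
    set t := |l - d| with ht
    have ht0 : 0 ≤ t := abs_nonneg _
    have hinv : ∀ x : ℝ, |invertedEigenvalue x| ≤ max |x| 1 := by
      intro x; unfold invertedEigenvalue; split_ifs <;> simp
    have hd3 : |invertedEigenvalue d| ≤ 3 * (1 + t) :=
      (hinv d).trans (max_le (by linarith) (by linarith))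
    have hl3 : |invertedEigenvalue l| ≤ 3 * (1 + t) := by
      have : |l| ≤ |d| + t := by
        have := abs_add_le d (l - d); rwa [add_sub_cancel] at this
      exact (hinv l).trans (max_le (by linarith) (by linarith))
    have hure := (Complex.abs_re_le_norm u).trans hu
    have hK0 : 0 ≤ K := (norm_nonneg u).trans hu
    have hKK : |K| = K := abs_of_nonneg hK0
    have hdpos := abs_invertedEigenvalue_pos d
    have hone : (1 : ℝ) ≤ 1 + t := by linarith
    have split : ∀ x : ℝ, |invertedEigenvalue d| ^ (-x) = |invertedEigenvalue d| ^ (u.re + N - x) *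
        |invertedEigenvalue d| ^ (-(u.re + N)) := by
      intro x; rw [← Real.rpow_add hdpos]; congr 1; ring
    have hN : |u.re + N| ≤ |K| + N := by
      refine (abs_add_le _ _).trans ?_
      rw [Nat.abs_cast, hKK]; linarith
    have b1 : ‖absCpow l (-u)‖ ≤ C₂ * C₂ * (1 + t) ^ (N + (m₂ + m₂)) *
        |invertedEigenvalue d| ^ (-(u.re + N)) := by
      rw [norm_absCpow, Complex.neg_re]
      have e1 := h₂ _ t (-u.re) ht0 hcl hl3 (by
        rw [abs_neg, hKK]; exact hure.trans (by simp))
      have e2 := h₂ _ t (u.re + N) ht0 hcd hd3 hN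
      have e3 : (1 : ℝ) = |invertedEigenvalue d| ^ (u.re + N) *
          |invertedEigenvalue d| ^ (-(u.re + N)) := by
        rw [← Real.rpow_add hdpos]; simp
      calc |invertedEigenvalue l| ^ (-u.re) = |invertedEigenvalue l| ^ (-u.re) *
            (|invertedEigenvalue d| ^ (u.re + N) * |invertedEigenvalue d| ^ (-(u.re + N))) := by
            rw [← e3, mul_one]
        _ ≤ (C₂ * (1 + t) ^ m₂) * ((C₂ * (1 + t) ^ m₂) *
              |invertedEigenvalue d| ^ (-(u.re + N))) := by gcongr
        _ = C₂ * C₂ * (1 + t) ^ (m₂ + m₂) * |invertedEigenvalue d| ^ (-(u.re + N)) := by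
            rw [pow_add]; ring
        _ ≤ _ := by
            have := pow_le_pow_right₀ hone (show m₂ + m₂ ≤ N + (m₂ + m₂) by omega)
            gcongr
    have b2 : ∀ j ∈ Finset.range N, ‖negBinom j u * ((eigenSign d * (d - l) : ℝ) : ℂ) ^ j *
        absCpow d (-(u + j))‖ ≤ C₃ j * C₂ * (1 + t) ^ (N + (m₂ + m₂)) *
        |invertedEigenvalue d| ^ (-(u.re + N)) := by
      intro j hj
      have hjN : j < N := Finset.mem_range.1 hj
      rw [norm_mul, norm_mul, norm_pow, Complex.norm_real, Real.norm_eq_abs, abs_mul,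
        abs_eigenSign, one_mul, abs_sub_comm, norm_absCpow]
      have e0 : (-(u + (j : ℂ))).re = -(u.re + j) := by simp
      rw [e0, split (u.re + j)]
      have e2 := h₂ _ t (u.re + N - (u.re + j)) ht0 hcd hd3 (by
        have : (j : ℝ) ≤ N := by exact_mod_cast hjN.le
        have hj0 : (0 : ℝ) ≤ j := j.cast_nonneg
        rw [abs_of_nonneg (by linarith)]
        have := abs_nonneg K
        linarith)
      calc ‖negBinom j u‖ * |l - d| ^ j * (|invertedEigenvalue d| ^ (u.re + N - (u.re + j)) *
            |invertedEigenvalue d| ^ (-(u.re + N)))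
          ≤ C₃ j * (1 + t) ^ N * ((C₂ * (1 + t) ^ m₂) *
            |invertedEigenvalue d| ^ (-(u.re + N))) := by
            have e4 : |l - d| ^ j ≤ (1 + t) ^ N :=
              (pow_le_pow_left₀ ht0 (by linarith) j).trans (pow_le_pow_right₀ hone hjN.le)
            gcongr
            · exact mul_nonneg (hC₃ j) (by positivity)
            · exact hC₃ j
            · exact h₃ j u hu
        _ = C₃ j * C₂ * (1 + t) ^ (N + m₂) * |invertedEigenvalue d| ^ (-(u.re + N)) := by
            rw [pow_add]; ring
        _ ≤ _ := by
            have := hC₃ j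
            gcongr
            omega
    unfold taylorRem
    refine (norm_sub_le _ _).trans ?_
    rw [add_mul, add_mul, Finset.sum_mul, Finset.sum_mul]
    exact add_le_add b1 ((norm_sum_le _ _).trans (Finset.sum_le_sum b2))
  set C₄ := C₂ * C₂ + ∑ j ∈ Finset.range N, C₃ j * C₂ with hC₄
  have hC₄0 : 0 ≤ C₄ := add_nonneg (mul_nonneg hC₂ hC₂)
    (Finset.sum_nonneg fun j _ => mul_nonneg (hC₃ j) hC₂)
  refine ⟨C₁ + C₄, by positivity, N + (m₂ + m₂), fun u hu d l hcd hcl => ?_⟩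
  have hone : (1 : ℝ) ≤ 1 + |l - d| := by linarith [abs_nonneg (l - d)]
  by_cases hcase : d ≠ 0 ∧ |l - d| ≤ |d| / 2
  · refine (hnear u hu d l hcase.1 hcase.2).trans ?_
    gcongr
    · linarith
    · omega
  · refine (hfar u hu d l hcd hcl ?_).trans ?_
    · by_cases hd : d = 0
      · simp [hd]
      · have := not_le.1 (fun h => hcase ⟨hd, h⟩)
        linarith
    · gcongr
      linarith

/-! ### Dirichlet series over the spectrum -/

section Series

variable {ι ι' : Type*} {d : ι → ℝ} {l : ι' → ℝ} {w : ι' → ι → ℂ}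

/-- The nonzero members of the family `d` are bounded away from `0`. -/
def HasGap (d : ι → ℝ) : Prop := ∃ c : ℝ, 0 < c ∧ ∀ k, c ≤ |invertedEigenvalue (d k)|

/-- The family `d` of eigenvalues has a gap at `0`, and its abscissa of absolute convergence is at
most `3`. -/
structure IsThreeSummable (d : ι → ℝ) : Prop where
  gap : HasGap d
  summable : ∀ σ : ℝ, 3 < σ → Summable fun k => |invertedEigenvalue (d k)| ^ (-σ)

/-- The weights `w i k` decay rapidly with the distance of `l i` and `d k`, in the sense that all
moments of `|l i - d k|` with respect to `‖w i k‖` are bounded uniformly in `k`. -/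
def HasMoments (w : ι' → ι → ℂ) (l : ι' → ℝ) (d : ι → ℝ) : Prop :=
  ∀ m : ℕ, ∃ C : ℝ, ∀ (k : ι) (s : Finset ι'), ∑ i ∈ s, ‖w i k‖ * (1 + |l i - d k|) ^ m ≤ C

/-- The Dirichlet series `∑ₖ tₖ |dₖ| ^ (-s)`. -/
def dirichlet (d : ι → ℝ) (t : ι → ℂ) (s : ℂ) : ℂ := ∑' k, t k * absCpow (d k) (-s)

/-- The `j`-th moment `∑ᵢ wᵢₖ (dₖ - lᵢ) ^ j`, multiplied by the `j`-th power of the sign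
of `dₖ`. -/
def signedMoment (w : ι' → ι → ℂ) (l : ι' → ℝ) (d : ι → ℝ) (j : ℕ) (k : ι) : ℂ :=
  ∑' i, w i k * ((eigenSign (d k) * (d k - l i) : ℝ) : ℂ) ^ j

/-- Lowering the exponent by a bounded amount costs only a constant, for bases bounded away from
zero. -/
theorem exists_rpow_neg_le {c : ℝ} (hc : 0 < c) (R : ℝ) : ∃ C : ℝ, 0 ≤ C ∧
    ∀ y x x' : ℝ, c ≤ y → x' ≤ x → x - x' ≤ R → y ^ (-x) ≤ C * y ^ (-x') := by
  obtain ⟨C, hC, m, h⟩ := exists_rpow_bound (B := 1) (lt_min hc one_pos) |R|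
  refine ⟨max C (c⁻¹ ^ |R|) + 1, by positivity, fun y x x' hy hx hR => ?_⟩
  have hy0 : 0 < y := hc.trans_le hy
  have e : y ^ (-x) = y ^ (-(x - x')) * y ^ (-x') := by
    rw [← Real.rpow_add hy0]; congr 1; ring
  rw [e]
  gcongr
  rcases le_total 1 y with h1 | h1
  · calc y ^ (-(x - x')) ≤ 1 := Real.rpow_le_one_of_one_le_of_nonpos h1 (by linarith)
      _ ≤ _ := by linarith [le_max_left C (c⁻¹ ^ |R|)]
  · have hci : 1 ≤ c⁻¹ := (one_le_inv₀ hc).2 (hy.trans h1)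
    calc y ^ (-(x - x')) = (y⁻¹) ^ (x - x') := by
          rw [Real.inv_rpow hy0.le, Real.rpow_neg hy0.le]
      _ ≤ (c⁻¹) ^ (x - x') := Real.rpow_le_rpow (by positivity) (inv_anti₀ hc hy) (by linarith)
      _ ≤ (c⁻¹) ^ |R| := Real.rpow_le_rpow_of_exponent_le hci (hR.trans (le_abs_self R))
      _ ≤ _ := by linarith [le_max_right C (c⁻¹ ^ |R|)]

/-- A series of entire functions is analytic at a point near which it has a summable majorant. -/
theorem analyticAt_tsum {κ : Type*} {f : κ → ℂ → ℂ} {s₀ : ℂ} {b : κ → ℝ}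
    (hf : ∀ n, Differentiable ℂ (f n)) (hb : Summable b)
    (h : ∀ᶠ s in 𝓝 s₀, ∀ n, ‖f n s‖ ≤ b n) : AnalyticAt ℂ (fun s => ∑' n, f n s) s₀ := by
  obtain ⟨U, hU, hUo, hsU⟩ := eventually_nhds_iff.1 h
  have h1 := Complex.differentiableOn_tsum_of_summable_norm hb
    (fun n => (hf n).differentiableOn) hUo (fun n s hs => hU s hs n)
  exact h1.analyticAt (hUo.mem_nhds hsU)

theorem IsThreeSummable.eventually_rpow_le (hd : IsThreeSummable d) {x₀ : ℝ} (hx : 3 < x₀) :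
    ∃ b : ι → ℝ, Summable b ∧ (∀ k, 0 ≤ b k) ∧
      ∀ᶠ x in 𝓝 x₀, ∀ k, |invertedEigenvalue (d k)| ^ (-x) ≤ b k := by
  obtain ⟨c, hc, hcd⟩ := hd.gap
  obtain ⟨C, hC, h⟩ := exists_rpow_neg_le hc (x₀ - 3)
  refine ⟨fun k => C * |invertedEigenvalue (d k)| ^ (-((3 + x₀) / 2)),
    (hd.summable _ (by linarith)).mul_left _, fun k => by positivity, ?_⟩
  have h1 : ∀ᶠ x in 𝓝 x₀, x ∈ Set.Ioo ((3 + x₀) / 2) (x₀ + (x₀ - 3) / 2) :=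
    Ioo_mem_nhds (by linarith) (by linarith)
  filter_upwards [h1] with x hx1 k
  exact h _ _ _ (hcd k) hx1.1.le (by linarith [hx1.2])

theorem IsThreeSummable.summable_dirichlet (hd : IsThreeSummable d) {t : ι → ℂ} {B : ℝ}
    (ht : ∀ k, ‖t k‖ ≤ B) {s : ℂ} (hs : 3 < s.re) :
    Summable fun k => t k * absCpow (d k) (-s) := by
  refine Summable.of_norm_bounded ((hd.summable _ hs).mul_left B) fun k => ?_
  rw [norm_mul, norm_absCpow, Complex.neg_re]
  gcongr
  exact ht k

theorem IsThreeSummable.analyticAt_dirichlet (hd : IsThreeSummable d) {t : ι → ℂ} {B : ℝ}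
    (ht : ∀ k, ‖t k‖ ≤ B) {s : ℂ} (hs : 3 < s.re) : AnalyticAt ℂ (dirichlet d t) s := by
  obtain ⟨b, hb, hb0, h⟩ := hd.eventually_rpow_le hs
  refine analyticAt_tsum (b := fun k => |B| * b k) (fun k => ?_) (hb.mul_left _) ?_
  · have h1 := differentiable_absCpow (d k)
    exact (h1.comp differentiable_neg).const_mul _
  · filter_upwards [Complex.continuous_re.continuousAt.eventually h] with z hz k
    rw [norm_mul, norm_absCpow, Complex.neg_re]
    have := hb0 k
    exact mul_le_mul ((ht k).trans (le_abs_self B)) (hz k) (by positivity) (abs_nonneg B)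

theorem HasMoments.summable (hw : HasMoments w l d) (m : ℕ) (k : ι) :
    Summable fun i => ‖w i k‖ * (1 + |l i - d k|) ^ m := by
  obtain ⟨C, hC⟩ := hw m
  exact summable_of_sum_le (fun i => by positivity) (hC k)

theorem HasMoments.exists_tsum_le (hw : HasMoments w l d) (m : ℕ) : ∃ C : ℝ, 0 ≤ C ∧
    ∀ k, ∑' i, ‖w i k‖ * (1 + |l i - d k|) ^ m ≤ C := by
  obtain ⟨C, hC⟩ := hw m
  exact ⟨max C 0, le_max_right _ _, fun k =>
    ((hw.summable m k).tsum_le_of_sum_le (hC k)).trans (le_max_left _ _)⟩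

theorem HasMoments.norm_signedMoment_le (hw : HasMoments w l d) (j : ℕ) : ∃ C : ℝ,
    ∀ k, (Summable fun i => w i k * ((eigenSign (d k) * (d k - l i) : ℝ) : ℂ) ^ j) ∧
      ‖signedMoment w l d j k‖ ≤ C := by
  obtain ⟨C, hC0, hC⟩ := hw.exists_tsum_le j
  refine ⟨C, fun k => ?_⟩
  have hb : ∀ i, ‖w i k * ((eigenSign (d k) * (d k - l i) : ℝ) : ℂ) ^ j‖ ≤
      ‖w i k‖ * (1 + |l i - d k|) ^ j := by
    intro i
    rw [norm_mul, norm_pow, Complex.norm_real, Real.norm_eq_abs, abs_mul, abs_eigenSign, one_mul,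
      abs_sub_comm]
    gcongr
    linarith
  refine ⟨Summable.of_norm_bounded (hw.summable j k) hb, ?_⟩
  exact (tsum_of_norm_bounded (hw.summable j k).hasSum hb).trans (hC k)

/-- Bounded moments make a double series converge as soon as the sum over `k` of the majorant
does. -/
theorem HasMoments.summable_prod (hw : HasMoments w l d) (m : ℕ) {b : ι → ℝ} (hb : Summable b)
    (hb0 : ∀ k, 0 ≤ b k) :
    Summable fun q : ι × ι' => ‖w q.2 q.1‖ * (1 + |l q.2 - d q.1|) ^ m * b q.1 := by
  obtain ⟨C, hC0, hC⟩ := hw.exists_tsum_le m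
  set f : ι × ι' → ℝ := fun q => ‖w q.2 q.1‖ * (1 + |l q.2 - d q.1|) ^ m * b q.1 with hf
  have h0 : 0 ≤ f := fun q => mul_nonneg (by positivity) (hb0 q.1)
  have h1 : ∀ k, Summable fun i => f (k, i) := fun k => (hw.summable m k).mul_right (b k)
  have h2 : ∀ k, ∑' i, f (k, i) ≤ C * b k := by
    intro k
    have : ∑' i, f (k, i) = (∑' i, ‖w i k‖ * (1 + |l i - d k|) ^ m) * b k := by
      rw [← tsum_mul_right]
    rw [this]
    exact mul_le_mul_of_nonneg_right (hC k) (hb0 k)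
  have h3 : ∀ k, 0 ≤ ∑' i, f (k, i) := fun k => tsum_nonneg fun i => h0 (k, i)
  exact (summable_prod_of_nonneg h0).2 ⟨h1, Summable.of_nonneg_of_le h3 h2 (hb.mul_left C)⟩

/-- The double series `∑ₖᵢ wᵢₖ r(dₖ, lᵢ) |dₖ| ^ (u s - s - κ)` in which `r` is the Taylor remainder
of order `N` of `|l| ^ (- u s)`. For `N = 0` it is the double series
`∑ₖᵢ wᵢₖ |lᵢ| ^ (- u s) |dₖ| ^ (u s - s - κ)` itself. -/
def remSeries (w : ι' → ι → ℂ) (l : ι' → ℝ) (d : ι → ℝ) (u : ℂ → ℂ) (κ : ℝ) (N : ℕ) (s : ℂ) : ℂ :=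
  ∑' q : ι × ι', w q.2 q.1 * taylorRem N (u s) (d q.1) (l q.2) * absCpow (d q.1) (u s - s - κ)

/-- The terms of the double series with the remainder of order `N` gain `N` powers of `|dₖ|`. -/
theorem exists_remSeries_term_bound (w : ι' → ι → ℂ) (hd : HasGap d) (hl : HasGap l)
    (N : ℕ) (K : ℝ) : ∃ C : ℝ, 0 ≤ C ∧ ∃ m : ℕ, ∀ (u s : ℂ) (κ : ℝ) (k : ι) (i : ι'), ‖u‖ ≤ K →
      ‖w i k * taylorRem N u (d k) (l i) * absCpow (d k) (u - s - κ)‖ ≤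
        C * (‖w i k‖ * (1 + |l i - d k|) ^ m *
          |invertedEigenvalue (d k)| ^ (-(s.re + κ + N))) := by
  obtain ⟨c, hc, hcd⟩ := hd
  obtain ⟨c', hc', hcl⟩ := hl
  obtain ⟨C, hC, m, h⟩ := exists_taylorRem_bound (lt_min hc hc') N K
  refine ⟨C, hC, m, fun u s κ k i hu => ?_⟩
  have hpos := abs_invertedEigenvalue_pos (d k)
  rw [norm_mul, norm_mul, norm_absCpow]
  have e : |invertedEigenvalue (d k)| ^ (-(s.re + κ + N)) =
      |invertedEigenvalue (d k)| ^ (-(u.re + N)) *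
        |invertedEigenvalue (d k)| ^ (u - s - κ).re := by
    rw [← Real.rpow_add hpos]
    congr 1
    simp only [Complex.sub_re, Complex.ofReal_re]; ring
  rw [e]
  calc ‖w i k‖ * ‖taylorRem N u (d k) (l i)‖ * |invertedEigenvalue (d k)| ^ (u - s - κ).re
      ≤ ‖w i k‖ * (C * (1 + |l i - d k|) ^ m * |invertedEigenvalue (d k)| ^ (-(u.re + N))) *
          |invertedEigenvalue (d k)| ^ (u - s - κ).re := by
        gcongr
        exact h u hu _ _ ((min_le_left _ _).trans (hcd k)) ((min_le_right _ _).trans (hcl i))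
    _ = _ := by ring

theorem summable_remSeries (hw : HasMoments w l d) (hd : IsThreeSummable d) (hl : HasGap l)
    (N : ℕ) (u s : ℂ) (κ : ℝ) (hs : 3 < s.re + κ + N) :
    Summable fun q : ι × ι' =>
      w q.2 q.1 * taylorRem N u (d q.1) (l q.2) * absCpow (d q.1) (u - s - κ) := by
  obtain ⟨C, hC, m, h⟩ := exists_remSeries_term_bound w hd.gap hl N ‖u‖
  exact Summable.of_norm_bounded
    ((hw.summable_prod m (hd.summable _ hs) fun k => by positivity).mul_left C)
    fun q => h u s κ q.1 q.2 le_rfl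

theorem differentiable_taylorRem (N : ℕ) (d l : ℝ) :
    Differentiable ℂ fun u => taylorRem N u d l := by
  unfold taylorRem
  have h1 := differentiable_absCpow d
  have h2 := differentiable_absCpow l
  have h3 := differentiable_negBinom
  refine Differentiable.sub (h2.comp differentiable_neg) (Differentiable.fun_sum fun j _ => ?_)
  exact ((h3 j).mul_const _).mul (h1.comp (differentiable_id.add_const _).neg)

theorem analyticAt_remSeries (hw : HasMoments w l d) (hd : IsThreeSummable d) (hl : HasGap l)
    {u : ℂ → ℂ} (hu : Differentiable ℂ u) (κ : ℝ) (N : ℕ) {s₀ : ℂ} (hs : 3 < s₀.re + κ + N) :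
    AnalyticAt ℂ (remSeries w l d u κ N) s₀ := by
  obtain ⟨C, hC, m, h⟩ := exists_remSeries_term_bound w hd.gap hl N (‖u s₀‖ + 1)
  obtain ⟨b, hb, hb0, hbd⟩ := hd.eventually_rpow_le hs
  refine analyticAt_tsum (b := fun q : ι × ι' => C * (‖w q.2 q.1‖ * (1 + |l q.2 - d q.1|) ^ m *
    b q.1)) (fun q => ?_) ((hw.summable_prod m hb hb0).mul_left C) ?_
  · have h1 := differentiable_absCpow (d q.1)
    have h2 := differentiable_taylorRem N (d q.1) (l q.2)
    exact ((h2.comp hu).const_mul _).mul (h1.comp ((hu.sub differentiable_id).sub_const _))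
  · have e1 : ∀ᶠ s in 𝓝 s₀, ‖u s‖ < ‖u s₀‖ + 1 :=
      (hu.continuous.norm.continuousAt).eventually_lt continuousAt_const (by simp)
    have e2 : ContinuousAt (fun s : ℂ => s.re + κ + N) s₀ := by fun_prop
    filter_upwards [e1, e2.eventually hbd] with s hs1 hs2 q
    refine (h (u s) s κ q.1 q.2 hs1.le).trans ?_
    gcongr
    exact hs2 q.1

/-- Summation of the Taylor expansion: the double series is a combination of Dirichlet series,
up to a remainder which converges further to the left. -/
theorem remSeries_zero_eq (hw : HasMoments w l d) (hd : IsThreeSummable d) (hl : HasGap l)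
    (u : ℂ → ℂ) (κ : ℝ) (N : ℕ) {s : ℂ} (hs : 3 < s.re + κ) :
    remSeries w l d u κ 0 s = ∑ j ∈ Finset.range N, negBinom j (u s) *
      dirichlet d (signedMoment w l d j) (s + κ + j) + remSeries w l d u κ N s := by
  set g : ℕ → ι × ι' → ℂ := fun j q => w q.2 q.1 *
    ((eigenSign (d q.1) * (d q.1 - l q.2) : ℝ) : ℂ) ^ j * absCpow (d q.1) (-(s + κ + j)) with hg
  have hN : ∀ n : ℕ, 3 < s.re + κ + n := fun n => by
    have : (0 : ℝ) ≤ n := n.cast_nonneg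
    linarith
  have hgs : ∀ j, Summable (g j) := by
    intro j
    refine Summable.of_norm_bounded
      (hw.summable_prod j (hd.summable _ (hN j)) fun k => by positivity) fun q => ?_
    simp only [hg]
    rw [norm_mul, norm_mul, norm_pow, Complex.norm_real, Real.norm_eq_abs, abs_mul, abs_eigenSign,
      one_mul, abs_sub_comm, norm_absCpow]
    have : (-(s + κ + (j : ℂ))).re = -(s.re + κ + j) := by simp
    rw [this]
    gcongr
    linarith
  have hgt : ∀ j, ∑' q, g j q = dirichlet d (signedMoment w l d j) (s + κ + j) := by
    intro j
    rw [(hgs j).tsum_prod]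
    unfold dirichlet signedMoment
    refine tsum_congr fun k => ?_
    rw [← tsum_mul_right]
  have h0 := summable_remSeries hw hd hl 0 (u s) s κ (hN 0)
  have hN' := summable_remSeries hw hd hl N (u s) s κ (hN N)
  have hfin : Summable fun q => ∑ j ∈ Finset.range N, negBinom j (u s) * g j q :=
    summable_sum fun j _ => (hgs j).mul_left _
  unfold remSeries
  simp_rw [← hgt, ← tsum_mul_left]
  rw [← Summable.tsum_finsetSum (fun j _ => (hgs j).mul_left _), ← hfin.tsum_add hN']
  refine tsum_congr fun q => ?_
  have key : absCpow (d q.1) (u s - s - κ) * taylorRem N (u s) (d q.1) (l q.2) * w q.2 q.1 =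
      absCpow (d q.1) (u s - s - κ) * absCpow (l q.2) (-(u s)) * w q.2 q.1 -
        ∑ j ∈ Finset.range N, negBinom j (u s) * g j q := by
    unfold taylorRem
    rw [mul_sub, sub_mul, Finset.mul_sum, Finset.sum_mul]
    congr 1
    refine Finset.sum_congr rfl fun j _ => ?_
    simp only [hg]
    rw [show -(s + κ + (j : ℂ)) = (u s - s - κ) + (-(u s + j)) by ring, absCpow_add]
    ring
  have e0 : taylorRem 0 (u s) (d q.1) (l q.2) = absCpow (l q.2) (-(u s)) := by
    simp [taylorRem]
  rw [e0]
  linear_combination -key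

end Series

/-! ### Meromorphic continuation -/

section Continuation

theorem meromorphicAt_comp_add {f : ℂ → ℂ} {c s : ℂ} (hf : MeromorphicAt f (s + c)) :
    MeromorphicAt (fun z => f (z + c)) s :=
  MeromorphicAt.comp_analyticAt (g := fun z => z + c) hf (by fun_prop)

/-- Two meromorphic functions on a right half plane which agree far to the right agree near every
point of it. -/
theorem eventuallyEq_of_eq_of_lt_re {f g : ℂ → ℂ} {a b : ℝ}
    (hf : MeromorphicOn f {s | a < s.re}) (hg : MeromorphicOn g {s | a < s.re})
    (h : ∀ s : ℂ, b < s.re → f s = g s) {s₀ : ℂ} (hs : a < s₀.re) : f =ᶠ[𝓝[≠] s₀] g := by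
  have hU : IsPreconnected {s : ℂ | a < s.re} := (convex_halfSpace_re_gt a).isPreconnected
  have hfg : MeromorphicOn (f - g) {s | a < s.re} := hf.sub hg
  have hx : ((max a b + 1 : ℝ) : ℂ) ∈ {s : ℂ | a < s.re} := by
    simp only [Set.mem_ofPred_eq, Complex.ofReal_re]
    linarith [le_max_left a b]
  have htop : meromorphicOrderAt (f - g) ((max a b + 1 : ℝ) : ℂ) = ⊤ := by
    rw [meromorphicOrderAt_eq_top_iff]
    have : ∀ᶠ s in 𝓝 ((max a b + 1 : ℝ) : ℂ), b < s.re :=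
      (isOpen_lt continuous_const Complex.continuous_re).mem_nhds (by
        simp only [Set.mem_ofPred_eq, Complex.ofReal_re]
        linarith [le_max_right a b])
    filter_upwards [this.filter_mono nhdsWithin_le_nhds] with s hs'
    simp [h s hs']
  have h0 : meromorphicOrderAt (f - g) s₀ = ⊤ := by
    by_contra hne
    exact hfg.meromorphicOrderAt_ne_top_of_isPreconnected hU hs hx hne htop
  rw [meromorphicOrderAt_eq_top_iff] at h0
  filter_upwards [h0] with s hs'
  exact sub_eq_zero.1 hs'

/-- A meromorphic function can be changed into one in normal form without changing it where it is
analytic. -/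
theorem exists_meromorphicNFOn {Z : ℂ → ℂ} (hZ : MeromorphicOn Z Set.univ) :
    ∃ Z' : ℂ → ℂ, MeromorphicNFOn Z' Set.univ ∧ (∀ s, AnalyticAt ℂ Z s → Z' s = Z s) ∧
      ∀ s, Z' =ᶠ[𝓝[≠] s] Z := by
  refine ⟨toMeromorphicNFOn Z Set.univ, meromorphicNFOn_toMeromorphicNFOn _ _, fun s hs => ?_,
    fun s => ?_⟩
  · rw [toMeromorphicNFOn_eq_toMeromorphicNFAt hZ (Set.mem_univ s),
      toMeromorphicNFAt_eq_self.2 hs.meromorphicNFAt]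
  · exact hZ.toMeromorphicNFOn_eq_self_on_nhdsNE (Set.mem_univ s)

theorem tendsto_add_nhdsNE (c s : ℂ) : Tendsto (fun z => z + c) (𝓝[≠] s) (𝓝[≠] (s + c)) := by
  refine tendsto_nhdsWithin_iff.2 ⟨?_, ?_⟩
  · exact ((continuous_id.add continuous_const).tendsto s).mono_left nhdsWithin_le_nhds
  · filter_upwards [self_mem_nhdsWithin] with z hz
    simpa using hz

theorem tendsto_sub_mul_of_analyticAt {f : ℂ → ℂ} {s : ℂ} (hf : AnalyticAt ℂ f s) :
    HasSimpleResidue f s 0 := by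
  have : ContinuousAt (fun z => (z - s) * f z) s :=
    (continuousAt_id.sub continuousAt_const).mul hf.continuousAt
  have h := this.tendsto
  simp only [sub_self, zero_mul] at h
  exact h.mono_left nhdsWithin_le_nhds

theorem HasSimpleResidue.congr {f g : ℂ → ℂ} {s r : ℂ} (h : HasSimpleResidue f s r)
    (hfg : f =ᶠ[𝓝[≠] s] g) : HasSimpleResidue g s r := by
  refine Tendsto.congr' ?_ h
  filter_upwards [hfg] with z hz
  rw [hz]

theorem HasSimpleResidue.unique {f : ℂ → ℂ} {s r r' : ℂ} (h : HasSimpleResidue f s r)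
    (h' : HasSimpleResidue f s r') : r = r' :=
  tendsto_nhds_unique h h'

theorem HasSimpleResidue.comp_add {f : ℂ → ℂ} {s c r : ℂ} (h : HasSimpleResidue f (s + c) r) :
    HasSimpleResidue (fun z => f (z + c)) s r := by
  have := h.comp (tendsto_add_nhdsNE c s)
  refine this.congr fun z => ?_
  simp

theorem HasSimpleResidue.exists_of_order {f : ℂ → ℂ} {s : ℂ} (hf : MeromorphicAt f s)
    (h : ((-1 : ℤ) : WithTop ℤ) ≤ meromorphicOrderAt f s) : ∃ r, HasSimpleResidue f s r := by
  have h1 : MeromorphicAt (fun z : ℂ => z - s) s := by fun_prop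
  have h2 : meromorphicOrderAt (fun z : ℂ => z - s) s = ((1 : ℤ) : WithTop ℤ) :=
    meromorphicOrderAt_id_sub_const
  have h3 : 0 ≤ meromorphicOrderAt ((fun z : ℂ => z - s) * f) s := by
    rw [meromorphicOrderAt_mul h1 hf, h2]
    calc (0 : WithTop ℤ) = ((1 : ℤ) : WithTop ℤ) + ((-1 : ℤ) : WithTop ℤ) := by
          rw [← WithTop.coe_add]; rfl
      _ ≤ _ := by gcongr
  exact tendsto_nhds_of_meromorphicOrderAt_nonneg (h1.mul hf) h3

variable {ι ι' : Type*} {d : ι → ℝ} {l : ι' → ℝ} {w : ι' → ι → ℂ} {t t' : ι → ℂ}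

/-- `Z` is a meromorphic continuation of the Dirichlet series of `t` to the plane, with at most
simple poles. -/
structure IsContinuation (d : ι → ℝ) (t : ι → ℂ) (Z : ℂ → ℂ) : Prop where
  meromorphicOn : MeromorphicOn Z Set.univ
  order : ∀ s : ℂ, ((-1 : ℤ) : WithTop ℤ) ≤ meromorphicOrderAt Z s
  eq : ∀ s : ℂ, 3 < s.re → Z s = dirichlet d t s

/-- The meromorphic continuation of the Dirichlet series of `t` has residue `r` at `m`. -/
def HasRes (d : ι → ℝ) (t : ι → ℂ) (m r : ℂ) : Prop :=
  ∃ Z, IsContinuation d t Z ∧ HasSimpleResidue Z m r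

theorem IsContinuation.eventuallyEq {Z Z' : ℂ → ℂ} (h : IsContinuation d t Z)
    (h' : IsContinuation d t Z') (s : ℂ) : Z =ᶠ[𝓝[≠] s] Z' :=
  eventuallyEq_of_eq_of_lt_re (a := s.re - 1) (b := 3) (fun z _ => h.meromorphicOn z trivial)
    (fun z _ => h'.meromorphicOn z trivial) (fun z hz => (h.eq z hz).trans (h'.eq z hz).symm)
    (by linarith)

theorem IsContinuation.exists_residue {Z : ℂ → ℂ} (h : IsContinuation d t Z) (m : ℂ) :
    ∃ r, HasSimpleResidue Z m r :=
  HasSimpleResidue.exists_of_order (h.meromorphicOn m trivial) (h.order m)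

theorem HasRes.residue {Z : ℂ → ℂ} {m r : ℂ} (h : HasRes d t m r) (hZ : IsContinuation d t Z) :
    HasSimpleResidue Z m r := by
  obtain ⟨Z', hZ', hr⟩ := h
  exact hr.congr (hZ'.eventuallyEq hZ m)

theorem IsContinuation.congr {Z : ℂ → ℂ} (h : IsContinuation d t Z)
    (e : ∀ s : ℂ, 3 < s.re → dirichlet d t s = dirichlet d t' s) : IsContinuation d t' Z :=
  ⟨h.1, h.2, fun s hs => (h.3 s hs).trans (e s hs)⟩

theorem HasRes.congr {m r : ℂ} (h : HasRes d t m r)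
    (e : ∀ s : ℂ, 3 < s.re → dirichlet d t s = dirichlet d t' s) : HasRes d t' m r := by
  obtain ⟨Z, hZ, hr⟩ := h
  exact ⟨Z, hZ.congr e, hr⟩

theorem HasRes.add (hd : IsThreeSummable d) {B B' : ℝ} (ht : ∀ k, ‖t k‖ ≤ B)
    (ht' : ∀ k, ‖t' k‖ ≤ B') {m r r' : ℂ} (h : HasRes d t m r) (h' : HasRes d t' m r') :
    HasRes d (fun k => t k + t' k) m (r + r') := by
  obtain ⟨Z, hZ, hr⟩ := h
  obtain ⟨Z', hZ', hr'⟩ := h'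
  refine ⟨fun s => Z s + Z' s, ⟨fun s hs => (hZ.1 s hs).add (hZ'.1 s hs), fun s => ?_,
    fun s hs => ?_⟩, ?_⟩
  · exact (le_min (hZ.2 s) (hZ'.2 s)).trans
      (meromorphicOrderAt_add (hZ.1 s trivial) (hZ'.1 s trivial))
  · rw [hZ.3 s hs, hZ'.3 s hs]
    unfold dirichlet
    rw [← (hd.summable_dirichlet ht hs).tsum_add (hd.summable_dirichlet ht' hs)]
    simp_rw [add_mul]
  · refine (hr.add hr').congr fun s => ?_
    ring

theorem HasRes.const_mul (c : ℂ) {m r : ℂ} (h : HasRes d t m r) :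
    HasRes d (fun k => c * t k) m (c * r) := by
  obtain ⟨Z, hZ, hr⟩ := h
  have hc : MeromorphicOn (fun _ : ℂ => c) Set.univ := fun s _ => by fun_prop
  refine ⟨fun s => c * Z s, ⟨fun s hs => (hc s hs).mul (hZ.1 s hs), fun s => ?_, fun s hs => ?_⟩,
    ?_⟩
  · have h1 : 0 ≤ meromorphicOrderAt (fun _ : ℂ => c) s :=
      AnalyticAt.meromorphicOrderAt_nonneg analyticAt_const
    have h2 := meromorphicOrderAt_mul (hc s trivial) (hZ.1 s trivial)
    calc ((-1 : ℤ) : WithTop ℤ) ≤ meromorphicOrderAt Z s := hZ.2 s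
      _ = 0 + meromorphicOrderAt Z s := (zero_add _).symm
      _ ≤ meromorphicOrderAt (fun _ : ℂ => c) s + meromorphicOrderAt Z s := by gcongr
      _ = _ := h2.symm
  · rw [hZ.3 s hs]
    unfold dirichlet
    rw [← tsum_mul_left]
    simp_rw [mul_assoc]
  · have h1 : Tendsto (fun s => c * ((s - m) * Z s)) (𝓝[≠] m) (𝓝 (c * r)) :=
      Tendsto.const_mul c hr
    refine h1.congr fun s => ?_
    ring

theorem IsContinuation.analyticAt_dirichlet (hd : IsThreeSummable d) {B : ℝ}
    (ht : ∀ k, ‖t k‖ ≤ B) {Z : ℂ → ℂ} (h : IsContinuation d t Z) {s : ℂ} (hs : 3 < s.re) :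
    AnalyticAt ℂ Z s := by
  refine (hd.analyticAt_dirichlet ht hs).congr ?_
  have h1 : ∀ᶠ z in 𝓝 s, 3 < z.re :=
    (isOpen_lt continuous_const Complex.continuous_re).mem_nhds hs
  filter_upwards [h1] with z hz using (h.3 z hz).symm

theorem IsContinuation.hasRes_of_lt (hd : IsThreeSummable d) {B : ℝ} (ht : ∀ k, ‖t k‖ ≤ B)
    {Z : ℂ → ℂ} (h : IsContinuation d t Z) {m : ℂ} (hm : 3 < m.re) : HasRes d t m 0 :=
  ⟨Z, h, tendsto_sub_mul_of_analyticAt (h.analyticAt_dirichlet hd ht hm)⟩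

/-- The meromorphic function which represents the double series `remSeries` to the right of
`3 - κ - N`, given the continuations `Zj` of the Dirichlet series of the moments. -/
def partialExpansion (w : ι' → ι → ℂ) (l : ι' → ℝ) (d : ι → ℝ) (u : ℂ → ℂ) (κ : ℝ)
    (Zj : ℕ → ℂ → ℂ) (N : ℕ) (s : ℂ) : ℂ :=
  ∑ j ∈ Finset.range N, negBinom j (u s) * Zj j (s + (κ + j)) + remSeries w l d u κ N s

section

variable (hw : HasMoments w l d) (hd : IsThreeSummable d) (hl : HasGap l) {u : ℂ → ℂ}
  (κ : ℝ) {Zj : ℕ → ℂ → ℂ}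
  (hZ : ∀ j, IsContinuation d (signedMoment w l d j) (Zj j))
include hw hd hl hZ

theorem meromorphicAt_partialExpansion (hu : Differentiable ℂ u) (N : ℕ) {s : ℂ}
    (hs : 3 < s.re + κ + N) : MeromorphicAt (partialExpansion w l d u κ Zj N) s := by
  refine MeromorphicAt.add (MeromorphicAt.fun_sum fun j _ => MeromorphicAt.mul ?_ ?_)
    (analyticAt_remSeries hw hd hl hu κ N hs).meromorphicAt
  · exact (((differentiable_negBinom j).comp hu).analyticAt s).meromorphicAt
  · exact meromorphicAt_comp_add ((hZ j).1 _ trivial)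

theorem partialExpansion_eq (N : ℕ) {s : ℂ} (hs : 3 < s.re + κ) :
    partialExpansion w l d u κ Zj N s = remSeries w l d u κ 0 s := by
  rw [remSeries_zero_eq hw hd hl u κ N hs]
  unfold partialExpansion
  congr 1
  refine Finset.sum_congr rfl fun j _ => ?_
  rw [(hZ j).3, add_assoc]
  have : (0 : ℝ) ≤ j := j.cast_nonneg
  simp only [Complex.add_re, Complex.ofReal_re, Complex.natCast_re]
  linarith

/-- The double series has a meromorphic continuation to the plane, obtained by glueing the partial
expansions. -/
theorem exists_continuation_remSeries (hu : Differentiable ℂ u) :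
    ∃ Z : ℂ → ℂ, MeromorphicNFOn Z Set.univ ∧
    (∀ s : ℂ, 3 < s.re + κ → Z s = remSeries w l d u κ 0 s) ∧
    ∀ (N : ℕ) (s : ℂ), 3 < s.re + κ + N → Z =ᶠ[𝓝[≠] s] partialExpansion w l d u κ Zj N := by
  set M := partialExpansion w l d u κ Zj with hM
  have hmero : ∀ (N : ℕ) (s : ℂ), 3 < s.re + κ + N → MeromorphicAt (M N) s := fun N s hs =>
    meromorphicAt_partialExpansion hw hd hl κ hZ hu N hs
  have hcongr : ∀ (N N' : ℕ) (s : ℂ), 3 < s.re + κ + N → 3 < s.re + κ + N' →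
      M N =ᶠ[𝓝[≠] s] M N' := by
    intro N N' s hs hs'
    refine eventuallyEq_of_eq_of_lt_re (a := max (3 - κ - N) (3 - κ - N')) (b := 3 - κ)
      (fun z hz => hmero N z ?_) (fun z hz => hmero N' z ?_) (fun z hz => ?_) ?_
    · have := (le_max_left (3 - κ - (N : ℝ)) (3 - κ - N')).trans_lt hz
      linarith
    · have := (le_max_right (3 - κ - (N : ℝ)) (3 - κ - N')).trans_lt hz
      linarith
    · rw [hM, partialExpansion_eq hw hd hl κ hZ N (by linarith),
        partialExpansion_eq hw hd hl κ hZ N' (by linarith)]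
    · exact max_lt (by linarith) (by linarith)
  have hex : ∀ s : ℂ, ∃ n : ℕ, 3 < s.re + κ + n := by
    intro s
    obtain ⟨n, hn⟩ := exists_nat_gt (3 - s.re - κ)
    exact ⟨n, by linarith⟩
  choose n hn using hex
  -- the value at each point is that of the normal form of any partial expansion defined there
  set Z : ℂ → ℂ := fun s => toMeromorphicNFAt (M (n s)) s s with hZdef
  have hval : ∀ (N : ℕ) (s : ℂ), 3 < s.re + κ + N → Z s = toMeromorphicNFAt (M N) s s := by
    intro N s hs
    exact (toMeromorphicNFAt_eventuallyEq_nhds_congr (hcongr (n s) N s (hn s) hs)).eq_of_nhds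
  have hana : ∀ (N : ℕ) (s : ℂ), 3 < s.re + κ + N → AnalyticAt ℂ (M N) s → Z s = M N s := by
    intro N s hs ha
    rw [hval N s hs, toMeromorphicNFAt_eq_self.2 ha.meromorphicNFAt]
  have hne : ∀ (N : ℕ) (s : ℂ), 3 < s.re + κ + N → Z =ᶠ[𝓝[≠] s] M N := by
    intro N s hs
    have h1 : ∀ᶠ z in 𝓝 s, 3 < z.re + κ + N := by
      have : Continuous fun z : ℂ => z.re + κ + N := by fun_prop
      exact (isOpen_lt continuous_const this).mem_nhds hs
    filter_upwards [h1.filter_mono nhdsWithin_le_nhds, (hmero N s hs).eventually_analyticAt]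
      with z hz1 hz2
    exact hana N z hz1 hz2
  refine ⟨Z, fun s _ => ?_, fun s hs => ?_, hne⟩
  · have h1 : Z =ᶠ[𝓝 s] toMeromorphicNFAt (M (n s)) s := by
      have h2 := (hne (n s) s (hn s)).trans (hmero _ s (hn s)).eq_nhdsNE_toMeromorphicNFAt
      rw [Filter.EventuallyEq, eventually_nhdsWithin_iff] at h2
      filter_upwards [h2] with z hz
      by_cases h : z = s
      · subst h; rfl
      · exact hz h
    exact (meromorphicNFAt_congr h1).2 meromorphicNFAt_toMeromorphicNFAt
  · have h0 : M 0 = remSeries w l d u κ 0 := by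
      funext z; simp [hM, partialExpansion]
    have hs0 : 3 < s.re + κ + ((0 : ℕ) : ℝ) := by simpa using hs
    rw [hana 0 s hs0, h0]
    rw [h0]
    exact analyticAt_remSeries hw hd hl hu κ 0 hs0

/-- The residue of the continued double series at a point to the right of `-1 - κ`. -/
theorem hasSimpleResidue_of_partialExpansion (hu : Differentiable ℂ u) {Z : ℂ → ℂ} {s : ℂ}
    (hs : -1 < s.re + κ)
    (hZe : Z =ᶠ[𝓝[≠] s] partialExpansion w l d u κ Zj 4) {r : ℕ → ℂ}
    (hr : ∀ j < 4, HasRes d (signedMoment w l d j) (s + (κ + j)) (r j)) :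
    HasSimpleResidue Z s (∑ j ∈ Finset.range 4, negBinom j (u s) * r j) := by
  refine HasSimpleResidue.congr ?_ hZe.symm
  have h1 : ∀ j ∈ Finset.range 4,
      Tendsto (fun z => negBinom j (u z) * ((z - s) * Zj j (z + (κ + j)))) (𝓝[≠] s)
        (𝓝 (negBinom j (u s) * r j)) := by
    intro j hj
    have e1 : Tendsto (fun z => negBinom j (u z)) (𝓝[≠] s) (𝓝 (negBinom j (u s))) :=
      (((differentiable_negBinom j).comp hu).continuous.tendsto s).mono_left nhdsWithin_le_nhds
    exact e1.mul ((hr j (Finset.mem_range.1 hj)).residue (hZ j)).comp_add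
  have h2 := tendsto_sub_mul_of_analyticAt
    (analyticAt_remSeries hw hd hl hu κ 4 (s₀ := s) (by push_cast; linarith))
  have h3 := (tendsto_finsetSum _ h1).add h2
  rw [add_zero] at h3
  refine h3.congr fun z => ?_
  unfold partialExpansion
  rw [mul_add, Finset.mul_sum]
  congr 1
  refine Finset.sum_congr rfl fun j _ => ?_
  ring

end

/-- If the double series `∑ₖᵢ wᵢₖ (|dₖ| ^ (-s) - |lᵢ| ^ (-s))` vanishes, the first moment has no
residue at `3`. -/
theorem hasRes_signedMoment_one_eq_zero (hw : HasMoments w l d) (hd : IsThreeSummable d)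
    (hl : HasGap l) {Z : ℂ → ℂ} (hZ : IsContinuation d (signedMoment w l d 1) Z)
    (h : ∀ s : ℂ, 3 < s.re →
      remSeries w l d id 0 0 s = dirichlet d (signedMoment w l d 0) s) :
    HasRes d (signedMoment w l d 1) 3 0 := by
  refine ⟨Z, hZ, ?_⟩
  have hR : ∀ s : ℂ, 1 < s.re → AnalyticAt ℂ (remSeries w l d id 0 2) s := fun s hs =>
    analyticAt_remSeries hw hd hl differentiable_id 0 2 (by push_cast; linarith)
  have key : ∀ s : ℂ, 3 < s.re → s * Z (s + 1) = -remSeries w l d id 0 2 s := by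
    intro s hs
    have h1 := remSeries_zero_eq hw hd hl id 0 2 (s := s) (by linarith)
    rw [h s hs] at h1
    simp only [Finset.sum_range_succ, Finset.sum_range_zero, zero_add, negBinom_zero, one_mul,
      Complex.ofReal_zero, add_zero, Nat.cast_zero, Nat.cast_one, id_eq] at h1
    have h2 : negBinom 1 s = s := by simp [negBinom]
    rw [h2, ← hZ.3 (s + 1) (by simp; linarith)] at h1
    linear_combination -h1
  have h1 : (fun s => s * Z (s + 1)) =ᶠ[𝓝[≠] 2] fun s => -remSeries w l d id 0 2 s :=
    eventuallyEq_of_eq_of_lt_re (a := 1) (b := 3)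
      (fun s _ => MeromorphicAt.mul (by fun_prop) (meromorphicAt_comp_add (hZ.1 _ trivial)))
      (fun s hs => (hR s hs).meromorphicAt.neg) key (by norm_num)
  obtain ⟨r, hr⟩ := hZ.exists_residue 3
  have h2 : HasSimpleResidue (fun s => Z (s + 1)) 2 r :=
    HasSimpleResidue.comp_add (by norm_num; exact hr)
  have h3 : HasSimpleResidue (fun s => s * Z (s + 1)) 2 (2 * r) := by
    have e1 : Tendsto (fun z : ℂ => z) (𝓝[≠] 2) (𝓝 2) := tendsto_id.mono_left nhdsWithin_le_nhds
    refine (e1.mul h2).congr fun z => ?_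
    ring
  have h4 : HasSimpleResidue (fun s => s * Z (s + 1)) 2 0 :=
    (tendsto_sub_mul_of_analyticAt (hR 2 (by norm_num)).neg).congr h1.symm
  have h5 : r = 0 := by simpa using h3.unique h4
  rwa [h5] at hr

end Continuation

/-! ### Diagonalization of selfadjoint operators with compact resolvent -/

section Diagonalization

variable {H : Type u} [NormedAddCommGroup H] [InnerProductSpace ℂ H]

/-- `R` is the resolvent `(D - c)⁻¹`, expressed through the graph of `D`. -/
def IsResolvent (D : H →ₗ.[ℂ] H) (c : ℂ) (R : H →L[ℂ] H) : Prop :=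
  ∀ x y : H, (x, y) ∈ D.graph ↔ R (y - c • x) = x

/-- `D` is symmetric, expressed through the graph of `D`. -/
def IsSymmetricOp (D : H →ₗ.[ℂ] H) : Prop :=
  ∀ x y x' y' : H, (x, y) ∈ D.graph → (x', y') ∈ D.graph → ⟪y, x'⟫_ℂ = ⟪x, y'⟫_ℂ

theorem mem_graph_iff' {D : H →ₗ.[ℂ] H} {x y : H} :
    (x, y) ∈ D.graph ↔ ∃ h : x ∈ D.domain, D ⟨x, h⟩ = y := by
  rw [LinearPMap.mem_graph_iff]
  constructor
  · rintro ⟨z, rfl, hz⟩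
    exact ⟨z.2, hz⟩
  · rintro ⟨h, hy⟩
    exact ⟨⟨x, h⟩, rfl, hy⟩

theorem graph_unique {D : H →ₗ.[ℂ] H} {x y y' : H} (h : (x, y) ∈ D.graph)
    (h' : (x, y') ∈ D.graph) : y = y' := by
  obtain ⟨_, rfl⟩ := mem_graph_iff'.1 h
  obtain ⟨_, rfl⟩ := mem_graph_iff'.1 h'
  rfl

theorem graph_sub {D : H →ₗ.[ℂ] H} {x y x' y' : H} (h : (x, y) ∈ D.graph)
    (h' : (x', y') ∈ D.graph) : (x - x', y - y') ∈ D.graph := D.graph.sub_mem h h'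

theorem graph_smul {D : H →ₗ.[ℂ] H} (c : ℂ) {x y : H} (h : (x, y) ∈ D.graph) :
    (c • x, c • y) ∈ D.graph := D.graph.smul_mem c h

theorem mem_eigenspace_iff {D : H →ₗ.[ℂ] H} {l : ℝ} {x : H} :
    x ∈ eigenspace D l ↔ (x, (l : ℂ) • x) ∈ D.graph := by
  rw [mem_graph_iff', eigenspace, Submodule.mem_map]
  constructor
  · rintro ⟨y, hy, rfl⟩
    refine ⟨y.2, ?_⟩
    rw [LinearMap.mem_ker, LinearMap.sub_apply, sub_eq_zero] at hy
    exact hy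
  · rintro ⟨h, hx⟩
    refine ⟨⟨x, h⟩, ?_, rfl⟩
    rw [LinearMap.mem_ker, LinearMap.sub_apply, sub_eq_zero]
    exact hx

theorem IsResolvent.mem_graph {D : H →ₗ.[ℂ] H} {c : ℂ} {R : H →L[ℂ] H} (hR : IsResolvent D c R)
    (x : H) : (R x, x + c • R x) ∈ D.graph := by
  rw [hR, add_sub_cancel_right]

theorem isResolvent_of_hasCompactResolvent {D : H →ₗ.[ℂ] H} (h : HasCompactResolvent D) :
    ∃ R : H →L[ℂ] H, IsCompactOperator R ∧ IsResolvent D Complex.I R := by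
  obtain ⟨R, hc, h1, h2⟩ := h
  refine ⟨R, hc, fun x y => ⟨fun hxy => ?_, fun hxy => ?_⟩⟩
  · obtain ⟨hx, rfl⟩ := mem_graph_iff'.1 hxy
    exact h2 ⟨x, hx⟩
  · obtain ⟨hx, he⟩ := h1 (y - Complex.I • x)
    refine mem_graph_iff'.2 ⟨hxy ▸ hx, ?_⟩
    have e : D ⟨x, hxy ▸ hx⟩ = D ⟨R (y - Complex.I • x), hx⟩ := by
      congr 2
      exact hxy.symm
    rw [e, sub_eq_iff_eq_add.1 he, hxy, sub_add_cancel]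

/-- `D` is the maximal diagonal operator with eigenvalues `d k` on the Hilbert basis `e`. -/
def Diagonalizes {ι : Type*} (D : H →ₗ.[ℂ] H) (e : HilbertBasis ι ℂ H) (d : ι → ℝ) : Prop :=
  ∀ x y : H, (x, y) ∈ D.graph ↔ ∀ k, ⟪e k, y⟫_ℂ = d k * ⟪e k, x⟫_ℂ

theorem ext_inner_basis {ι : Type*} (e : HilbertBasis ι ℂ H) {x y : H}
    (h : ∀ k, ⟪e k, x⟫_ℂ = ⟪e k, y⟫_ℂ) : x = y := by
  refine e.repr.injective (lp.ext (funext fun k => ?_))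
  rw [e.repr_apply_apply, e.repr_apply_apply, h k]

/-- If a symmetric operator has a resolvent and a Hilbert basis of eigenvectors, it is the maximal
operator that is diagonal in this basis. -/
theorem diagonalizes_of_eigenbasis {ι : Type*} {D : H →ₗ.[ℂ] H} (hs : IsSymmetricOp D)
    {R : H →L[ℂ] H} (hR : IsResolvent D Complex.I R) {e : HilbertBasis ι ℂ H} {d : ι → ℝ}
    (he : ∀ k, (e k, (d k : ℂ) • e k) ∈ D.graph) : Diagonalizes D e d := by
  have h1 : ∀ x y, (x, y) ∈ D.graph → ∀ k, ⟪e k, y⟫_ℂ = d k * ⟪e k, x⟫_ℂ := by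
    intro x y h k
    rw [← hs _ _ _ _ (he k) h, inner_smul_left, Complex.conj_ofReal]
  refine fun x y => ⟨h1 x y, fun h => ?_⟩
  have h2 := hR.mem_graph (y - Complex.I • x)
  have h3 : R (y - Complex.I • x) = x := by
    refine ext_inner_basis e fun k => ?_
    have h4 := h1 _ _ h2 k
    rw [inner_add_right, inner_sub_right, inner_smul_right, inner_smul_right, h k] at h4
    have h5 : ((d k : ℂ) - Complex.I) ≠ 0 := by
      intro h0
      have := congrArg Complex.im h0
      simp at this
    apply mul_left_cancel₀ h5
    linear_combination -h4
  exact (hR x y).2 h3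

theorem IsResolvent.inner_eq {D : H →ₗ.[ℂ] H} (hs : IsSymmetricOp D) {R R' : H →L[ℂ] H}
    (hR : IsResolvent D Complex.I R) (hR' : IsResolvent D (-Complex.I) R') (x y : H) :
    ⟪R x, y⟫_ℂ = ⟪x, R' y⟫_ℂ := by
  have h := hs _ _ _ _ (hR.mem_graph x) (hR'.mem_graph y)
  rw [inner_add_left, inner_add_right, inner_smul_left, inner_smul_right, Complex.conj_I] at h
  linear_combination -h

/-- The resolvents at `i` and `-i` commute. -/
theorem IsResolvent.comm {D : H →ₗ.[ℂ] H} {R R' : H →L[ℂ] H}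
    (hR : IsResolvent D Complex.I R) (hR' : IsResolvent D (-Complex.I) R') (v : H) :
    R (R' v) = R' (R v) := by
  set a := R v with ha
  set b := R' a with hb
  have h1 : (a, v + Complex.I • a) ∈ D.graph := hR.mem_graph v
  have h2 : (b, a + -Complex.I • b) ∈ D.graph := hR'.mem_graph a
  have h3 := graph_sub h1 (graph_smul (2 * Complex.I) h2)
  have hI : Complex.I * Complex.I = -1 := Complex.I_mul_I
  have h4 : R' v = a - (2 * Complex.I) • b := by
    have h5 := (hR' _ _).1 h3
    rw [← h5]
    congr 1
    have : (2 * Complex.I) • -Complex.I • b = (2 : ℂ) • b := by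
      rw [smul_smul]; congr 1; linear_combination -2 * hI
    have h6 : -Complex.I • (2 * Complex.I) • b = (2 : ℂ) • b := by
      rw [smul_smul]; congr 1; linear_combination -2 * hI
    rw [smul_add, smul_sub, this, h6]
    module
  rw [h4]
  have h5 := (hR _ _).1 h2
  rw [← h5]
  congr 1
  rw [h5]
  module

/-- Infinitely many eigenvalues in a bounded set would give an orthonormal sequence whose images
under the compact resolvent keep a positive distance. -/
theorem finite_eigenvalues_le {ι : Type*} {D : H →ₗ.[ℂ] H} {R : H →L[ℂ] H}
    (hc : IsCompactOperator R) (hR : IsResolvent D Complex.I R) {e : HilbertBasis ι ℂ H}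
    {d : ι → ℝ} (he : ∀ k, (e k, (d k : ℂ) • e k) ∈ D.graph) (M : ℝ) :
    {k | |d k| ≤ M}.Finite := by
  by_contra hinf
  have hinf : {k | |d k| ≤ M}.Infinite := hinf
  set f := hinf.natEmbedding with hf
  have hRe : ∀ k, R (e k) = ((d k : ℂ) - Complex.I)⁻¹ • e k := by
    intro k
    have h0 : ((d k : ℂ) - Complex.I) ≠ 0 := by
      intro h0
      have := congrArg Complex.im h0
      simp at this
    have h1 := (hR _ _).1 (he k)
    rw [← sub_smul, map_smul] at h1
    rw [← h1, smul_smul, h1, inv_mul_cancel₀ h0, one_smul]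
  obtain ⟨K, hK, hK'⟩ := hc.image_closedBall_subset_compact (1 : ℝ)
  obtain ⟨y, -, ψ, hψ, hψy⟩ := hK.tendsto_subseq (x := fun n => R (e (f n)))
    (fun n => hK' ⟨e (f n), by simp [e.orthonormal.1], rfl⟩)
  have hcau := hψy.cauchySeq
  rw [Metric.cauchySeq_iff'] at hcau
  set δ : ℝ := (|M| + 1)⁻¹ with hδ
  have hδ0 : 0 < δ := by positivity
  obtain ⟨N, hN⟩ := hcau δ hδ0
  have h1 := hN (N + 1) (Nat.le_succ N)
  have hne : (f (ψ (N + 1)) : ι) ≠ f (ψ N) := by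
    intro h
    have := hψ.injective (f.injective (Subtype.ext h))
    omega
  set a := (f (ψ (N + 1)) : ι) with ha
  set b := (f (ψ N) : ι) with hb
  have hlow : δ ≤ ‖((d a : ℂ) - Complex.I)⁻¹‖ := by
    rw [norm_inv, hδ]
    have h0 : ((d a : ℂ) - Complex.I) ≠ 0 := by
      intro h0
      have := congrArg Complex.im h0
      simp at this
    refine inv_anti₀ (norm_pos_iff.2 h0) ((norm_sub_le _ _).trans ?_)
    have h2 : |d a| ≤ M := (f (ψ (N + 1))).2
    rw [Complex.norm_I, Complex.norm_real, Real.norm_eq_abs]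
    linarith [le_abs_self M]
  have hd : ‖((d a : ℂ) - Complex.I)⁻¹‖ ≤ dist (R (e a)) (R (e b)) := by
    rw [dist_eq_norm]
    have h3 : ⟪e a, R (e a) - R (e b)⟫_ℂ = ((d a : ℂ) - Complex.I)⁻¹ := by
      rw [hRe, hRe, inner_sub_right, inner_smul_right, inner_smul_right,
        inner_self_eq_norm_sq_to_K, e.orthonormal.1, e.orthonormal.2 hne]
      simp
    rw [← h3]
    exact (norm_inner_le_norm _ _).trans (by rw [e.orthonormal.1, one_mul])
  exact absurd (hlow.trans hd) (not_le.2 h1)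

theorem mem_graph_vadd {D : H →ₗ.[ℂ] H} {B : H →L[ℂ] H} {x y : H} :
    (x, y) ∈ ((B : H →ₗ[ℂ] H) +ᵥ D).graph ↔ (x, y - B x) ∈ D.graph := by
  rw [mem_graph_iff', mem_graph_iff']
  constructor
  · rintro ⟨h, rfl⟩
    refine ⟨h, ?_⟩
    rw [LinearPMap.vadd_apply]
    exact (add_sub_cancel_left _ _).symm
  · rintro ⟨h, he⟩
    refine ⟨h, ?_⟩
    rw [LinearPMap.vadd_apply]
    change B x + D ⟨x, h⟩ = y
    rw [he, add_sub_cancel]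

theorem IsSymmetricOp.vadd {D : H →ₗ.[ℂ] H} (hs : IsSymmetricOp D) {B : H →L[ℂ] H}
    (hB : ∀ x y, ⟪B x, y⟫_ℂ = ⟪x, B y⟫_ℂ) : IsSymmetricOp ((B : H →ₗ[ℂ] H) +ᵥ D) := by
  intro x y x' y' h h'
  have h1 := hs _ _ _ _ (mem_graph_vadd.1 h) (mem_graph_vadd.1 h')
  rw [inner_sub_left, inner_sub_right, hB] at h1
  exact sub_left_injective h1

variable [CompleteSpace H]

/-- A vector orthogonal to all eigenvectors of `D` is zero: the eigenspaces of the compact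
selfadjoint operator `(D - i)⁻¹ (D + i)⁻¹` are finite dimensional and invariant under `D`. -/
theorem eq_zero_of_orthogonal_eigenvectors {D : H →ₗ.[ℂ] H} (hs : IsSymmetricOp D)
    {R R' : H →L[ℂ] H} (hc : IsCompactOperator R) (hR : IsResolvent D Complex.I R)
    (hR' : IsResolvent D (-Complex.I) R') {x : H}
    (hx : ∀ (l : ℝ) (v : H), v ∈ eigenspace D l → ⟪v, x⟫_ℂ = 0) : x = 0 := by
  set T : H →L[ℂ] H := R.comp R' with hT
  have hTc : IsCompactOperator T := hc.comp_clm R'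
  have hin := hR.inner_eq hs hR'
  have hin' : ∀ a b, ⟪R' a, b⟫_ℂ = ⟪a, R b⟫_ℂ := by
    intro a b
    rw [← inner_conj_symm, ← hin b a, inner_conj_symm]
  have hTs : (T : H →ₗ[ℂ] H).IsSymmetric := by
    intro a b
    change ⟪R (R' a), b⟫_ℂ = ⟪a, R (R' b)⟫_ℂ
    rw [hin, hin']
  have hbot := ContinuousLinearMap.orthogonalComplement_iSup_eigenspaces_eq_bot hTc hTs
  have hxmem : x ∈ (⨆ μ, Module.End.eigenspace (T : Module.End ℂ H) μ)ᗮ := by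
    rw [← Submodule.iInf_orthogonal, Submodule.mem_iInf]
    intro τ
    rw [Submodule.mem_orthogonal]
    intro v hv
    rw [Module.End.mem_eigenspace_iff] at hv
    have hv' : R (R' v) = τ • v := hv
    by_cases hτ : τ = 0
    · have h1 : R (R' v) = 0 := by rw [hv', hτ, zero_smul]
      have h2 := hR.mem_graph (R' v)
      rw [h1, smul_zero, add_zero] at h2
      have h3 : R' v = 0 := graph_unique h2 D.graph.zero_mem
      have h4 := hR'.mem_graph v
      rw [h3, smul_zero, add_zero] at h4
      rw [graph_unique h4 D.graph.zero_mem, inner_zero_left]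
    · set V := Module.End.eigenspace (T : Module.End ℂ H) τ with hV
      have hfin : FiniteDimensional ℂ V :=
        ContinuousLinearMap.finite_dimensional_eigenspace hTc τ hτ
      have hgr : ∀ y : H, y ∈ V → (y, τ⁻¹ • R' y + Complex.I • y) ∈ D.graph := by
        intro y hy
        have hy' : R (R' y) = τ • y := Module.End.mem_eigenspace_iff.1 hy
        have := graph_smul τ⁻¹ (hR.mem_graph (R' y))
        rwa [hy', smul_add, smul_comm τ⁻¹ Complex.I, inv_smul_smul₀ hτ] at this
      set S₀ : H →ₗ[ℂ] H := τ⁻¹ • (R' : H →ₗ[ℂ] H) + Complex.I • LinearMap.id with hS₀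
      have hinv : ∀ y ∈ V, S₀ y ∈ V := by
        intro y hy
        refine V.add_mem (V.smul_mem _ ?_) (V.smul_mem _ hy)
        have hy' : R (R' y) = τ • y := Module.End.mem_eigenspace_iff.1 hy
        refine Module.End.mem_eigenspace_iff.2 ?_
        change R (R' (R' y)) = τ • R' y
        rw [hR.comm hR', hy', map_smul]
      set S : V →ₗ[ℂ] V := S₀.restrict hinv with hS
      have hSs : S.IsSymmetric := by
        intro a b
        exact hs _ _ _ _ (hgr a a.2) (hgr b b.2)
      have hsum := (hSs.eigenvectorBasis rfl).sum_repr ⟨v, Module.End.mem_eigenspace_iff.2 hv⟩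
      have hsum' := congrArg (Subtype.val : V → H) hsum
      change _ = v at hsum'
      rw [← hsum', Submodule.coe_sum, sum_inner]
      refine Finset.sum_eq_zero fun i _ => ?_
      rw [Submodule.coe_smul, inner_smul_left]
      refine mul_eq_zero_of_right _ (hx (hSs.eigenvalues rfl i) _ ?_)
      rw [mem_eigenspace_iff]
      have h1 := hSs.apply_eigenvectorBasis rfl i
      have h2 := congrArg (Subtype.val : V → H) h1
      rw [Submodule.coe_smul] at h2
      have h3 := hgr _ (hSs.eigenvectorBasis rfl i).2
      have h4 : ((S (hSs.eigenvectorBasis rfl i) : V) : H) =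
        τ⁻¹ • R' ((hSs.eigenvectorBasis rfl i : V) : H) +
          Complex.I • ((hSs.eigenvectorBasis rfl i : V) : H) := rfl
      rw [← h4, h2] at h3
      exact h3
  rw [hbot] at hxmem
  exact (Submodule.mem_bot ℂ).1 hxmem

/-- The spectral theorem: a symmetric operator with compact resolvents at `i` and `-i` is diagonal
in a Hilbert basis, and only finitely many eigenvalues lie in a bounded set. -/
theorem exists_diagonalization {D : H →ₗ.[ℂ] H} (hs : IsSymmetricOp D)
    {R R' : H →L[ℂ] H} (hc : IsCompactOperator R) (hR : IsResolvent D Complex.I R)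
    (hR' : IsResolvent D (-Complex.I) R') :
    ∃ (ι : Type u) (e : HilbertBasis ι ℂ H) (d : ι → ℝ), Diagonalizes D e d ∧
      ∀ M : ℝ, {k | |d k| ≤ M}.Finite := by
  have hclosed : ∀ l : ℝ, IsClosed (eigenspace D l : Set H) := by
    intro l
    have : (eigenspace D l : Set H) = {v | R ((l : ℂ) • v - Complex.I • v) = v} := by
      ext v
      rw [SetLike.mem_coe, mem_eigenspace_iff, hR]
      rfl
    rw [this]
    exact isClosed_eq (by fun_prop) continuous_id
  have hcomp : ∀ l : ℝ, CompleteSpace (eigenspace D l) := fun l => (hclosed l).completeSpace_coe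
  choose w b hb using fun l : ℝ => exists_hilbertBasis ℂ (eigenspace D l)
  have horth : OrthogonalFamily ℂ (fun l : ℝ => eigenspace D l)
      fun l => (eigenspace D l).subtypeₗᵢ := by
    intro l m hlm v v'
    have h1 := hs _ _ _ _ (mem_eigenspace_iff.1 v.2) (mem_eigenspace_iff.1 v'.2)
    rw [inner_smul_left, inner_smul_right, Complex.conj_ofReal] at h1
    have h2 : ((l : ℂ) - m) ≠ 0 := by
      rw [sub_ne_zero]; exact_mod_cast hlm
    change ⟪(v : H), (v' : H)⟫_ℂ = 0
    apply mul_left_cancel₀ h2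
    linear_combination h1
  have hon := horth.orthonormal_sigma_orthonormal (fun l => (b l).orthonormal)
  have hspan : (Submodule.span ℂ (Set.range fun a : (l : ℝ) × w l =>
      (eigenspace D a.1).subtypeₗᵢ (b a.1 a.2)))ᗮ = ⊥ := by
    rw [Submodule.eq_bot_iff]
    intro x hx
    refine eq_zero_of_orthogonal_eigenvectors hs hc hR hR' fun l v hv => ?_
    have h1 := ((b l).hasSum_repr ⟨v, hv⟩).mapL (eigenspace D l).subtypeL
    have h2 := h1.mapL (innerSL ℂ x)
    have h3 : ∀ i,
        (innerSL ℂ x) ((eigenspace D l).subtypeL ((b l).repr ⟨v, hv⟩ i • b l i)) = 0 := by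
      intro i
      rw [map_smul, map_smul, innerSL_apply_apply]
      have := (Submodule.mem_orthogonal' _ _).1 hx _ (Submodule.subset_span ⟨⟨l, i⟩, rfl⟩)
      refine (congrArg _ this).trans (smul_zero _)
    simp_rw [h3] at h2
    have h4 := h2.unique hasSum_zero
    rw [innerSL_apply_apply] at h4
    rw [← inner_conj_symm]
    change starRingEnd ℂ ⟪x, v⟫_ℂ = 0
    have h5 : ⟪x, v⟫_ℂ = 0 := h4
    rw [h5, map_zero]
  refine ⟨(l : ℝ) × w l, HilbertBasis.mkOfOrthogonalEqBot hon hspan, fun a => a.1, ?_⟩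
  have he : ∀ k : (l : ℝ) × w l, ((HilbertBasis.mkOfOrthogonalEqBot hon hspan) k,
      ((k.1 : ℝ) : ℂ) • (HilbertBasis.mkOfOrthogonalEqBot hon hspan) k) ∈ D.graph := by
    intro k
    rw [HilbertBasis.coe_mkOfOrthogonalEqBot]
    exact mem_eigenspace_iff.1 (b k.1 k.2).2
  exact ⟨diagonalizes_of_eigenbasis hs hR he, finite_eigenvalues_le hc hR he⟩

theorem IsSelfAdjoint.isSymmetricOp {D : H →ₗ.[ℂ] H} (hD : IsSelfAdjoint D) : IsSymmetricOp D := by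
  intro x y x' y' h h'
  obtain ⟨hx, rfl⟩ := mem_graph_iff'.1 h
  obtain ⟨hx', rfl⟩ := mem_graph_iff'.1 h'
  have h1 := LinearPMap.adjoint_isFormalAdjoint (T := D) hD.dense_domain
  rw [LinearPMap.isSelfAdjoint_def.1 hD] at h1
  exact h1 ⟨x, hx⟩ ⟨x', hx'⟩

/-- The adjoint of the resolvent at `i` is the resolvent at `-i`. -/
theorem IsSelfAdjoint.isResolvent_adjoint {D : H →ₗ.[ℂ] H} (hD : IsSelfAdjoint D)
    {R : H →L[ℂ] H} (hR : IsResolvent D Complex.I R) :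
    IsResolvent D (-Complex.I) (ContinuousLinearMap.adjoint R) := by
  set R' := ContinuousLinearMap.adjoint R with hR'
  have hs := IsSelfAdjoint.isSymmetricOp hD
  have hgr : ∀ y, (R' y, y + -Complex.I • R' y) ∈ D.graph := by
    intro y
    have h0 : ∀ x : D.domain, ⟪y + -Complex.I • R' y, (x : H)⟫_ℂ = ⟪R' y, D x⟫_ℂ := by
      intro x
      have h1 := (hR _ _).1 (mem_graph_iff'.2 ⟨x.2, rfl⟩)
      have h2 : ⟪R' y, D x - Complex.I • (x : H)⟫_ℂ = ⟪y, (x : H)⟫_ℂ := by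
        rw [hR', ContinuousLinearMap.adjoint_inner_left]
        exact congrArg _ h1
      rw [inner_sub_right, inner_smul_right] at h2
      rw [inner_add_left, inner_smul_left, map_neg, Complex.conj_I, neg_neg]
      linear_combination -h2
    have h1 := LinearPMap.mem_adjoint_domain_of_exists (T := D) (R' y) ⟨_, h0⟩
    have h2 := LinearPMap.adjoint_apply_eq (T := D) hD.dense_domain ⟨R' y, h1⟩ h0
    have h3 : (R' y, y + -Complex.I • R' y) ∈ (LinearPMap.adjoint D).graph :=
      mem_graph_iff'.2 ⟨h1, h2⟩
    rwa [LinearPMap.isSelfAdjoint_def.1 hD] at h3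
  refine fun x y => ⟨fun h => ?_, fun h => ?_⟩
  · have h1 := hgr (y - -Complex.I • x)
    have h2 := graph_sub h1 h
    set z := R' (y - -Complex.I • x) - x with hz
    have h3 : (z, -Complex.I • z) ∈ D.graph := by
      convert h2 using 2
      rw [hz]; module
    have h4 := hs _ _ _ _ h3 h3
    rw [inner_smul_left, inner_smul_right, map_neg, Complex.conj_I, neg_neg] at h4
    have h5 : ⟪z, z⟫_ℂ = 0 := by
      have h6 : (2 * Complex.I) ≠ 0 := by simp
      apply mul_left_cancel₀ h6
      linear_combination h4
    exact sub_eq_zero.1 (inner_self_eq_zero.1 h5)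
  · have h1 := hgr (y - -Complex.I • x)
    rw [h] at h1
    convert h1 using 2
    module

/-- A bounded symmetric perturbation keeps the resolvent compact, by the Fredholm alternative. -/
theorem exists_isResolvent_vadd {D : H →ₗ.[ℂ] H} (hs : IsSymmetricOp D) {B R : H →L[ℂ] H}
    (hB : ∀ x y, ⟪B x, y⟫_ℂ = ⟪x, B y⟫_ℂ) {c : ℂ} (hc : c.im ≠ 0) (hRc : IsCompactOperator R)
    (hR : IsResolvent D c R) : ∃ R' : H →L[ℂ] H, IsCompactOperator R' ∧
      IsResolvent ((B : H →ₗ[ℂ] H) +ᵥ D) c R' := by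
  have hK : IsCompactOperator (B.comp R) := hRc.clm_comp B
  have hne : ¬ Module.End.HasEigenvalue ((B.comp R : H →L[ℂ] H) : Module.End ℂ H) (-1) := by
    intro h
    obtain ⟨y, hy⟩ := h.exists_hasEigenvector
    have h1 : B (R y) = (-1 : ℂ) • y := hy.apply_eq_smul
    rw [neg_one_smul] at h1
    set x := R y with hx
    have h2 : (x, c • x) ∈ ((B : H →ₗ[ℂ] H) +ᵥ D).graph := by
      rw [mem_graph_vadd, h1, sub_neg_eq_add, add_comm]
      exact hR.mem_graph y
    have h3 := hs.vadd hB _ _ _ _ h2 h2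
    rw [inner_smul_left, inner_smul_right] at h3
    have h4 : ⟪x, x⟫_ℂ = 0 := by
      by_contra h0
      have h5 := mul_right_cancel₀ h0 h3
      exact hc (Complex.conj_eq_iff_im.1 h5)
    have h5 : x = 0 := inner_self_eq_zero.1 h4
    rw [h5, map_zero] at h1
    exact hy.2 (neg_eq_zero.1 h1.symm)
  have hunit : IsUnit (1 + B.comp R) := by
    have h1 := (hK.hasEigenvalue_or_mem_resolventSet (μ := (-1 : ℂ)) (by simp)).resolve_left hne
    rw [spectrum.mem_resolventSet_iff] at h1
    have h2 := h1.neg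
    convert h2 using 1
    simp [Algebra.algebraMap_eq_smul_one]
    abel
  obtain ⟨U, hU⟩ := hunit
  have hU1 : ∀ z, (U⁻¹ : (H →L[ℂ] H)ˣ).1 (z + B (R z)) = z := by
    intro z
    have := congrArg (fun T : H →L[ℂ] H => T z) U.inv_mul
    rw [hU] at this
    exact this
  have hU2 : ∀ z, (U⁻¹ : (H →L[ℂ] H)ˣ).1 z + B (R ((U⁻¹ : (H →L[ℂ] H)ˣ).1 z)) = z := by
    intro z
    have := congrArg (fun T : H →L[ℂ] H => T z) U.mul_inv
    rw [hU] at this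
    exact this
  refine ⟨R.comp (U⁻¹ : (H →L[ℂ] H)ˣ).1, hRc.comp_clm _, fun x y => ?_⟩
  rw [mem_graph_vadd, hR, ContinuousLinearMap.comp_apply]
  constructor
  · intro h
    have h1 := hU1 (y - B x - c • x)
    rw [h, show y - B x - c • x + B x = y - c • x by abel] at h1
    rw [h1, h]
  · intro h
    have h1 := hU2 (y - c • x)
    rw [h] at h1
    rw [show y - B x - c • x = (U⁻¹ : (H →L[ℂ] H)ˣ).1 (y - c • x) by
      rw [← sub_eq_of_eq_add h1.symm]; abel]
    exact h

end Diagonalization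

/-! ### Functional calculus in an eigenbasis -/

section FunctionalCalculus

variable {H : Type u} [NormedAddCommGroup H] [InnerProductSpace ℂ H] [CompleteSpace H]
  {ι : Type*} {D : H →ₗ.[ℂ] H} {e : HilbertBasis ι ℂ H} {d : ι → ℝ}

theorem summable_norm_inner_sq (e : HilbertBasis ι ℂ H) (x : H) :
    Summable fun k => ‖⟪e k, x⟫_ℂ‖ ^ 2 :=
  e.orthonormal.inner_products_summable x

theorem tsum_norm_inner_sq (e : HilbertBasis ι ℂ H) (x : H) :
    ∑' k, ‖⟪e k, x⟫_ℂ‖ ^ 2 = ‖x‖ ^ 2 := by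
  have h := (e.hasSum_inner_mul_inner x x).mapL Complex.reCLM
  rw [inner_self_eq_norm_sq_to_K] at h
  have h2 := h.tsum_eq
  rw [Complex.reCLM_apply] at h2
  norm_cast at h2
  refine Eq.trans ?_ (h2.trans (Complex.ofReal_re _))
  refine tsum_congr fun k => ?_
  rw [← inner_conj_symm x, ← Complex.normSq_eq_conj_mul_self, Complex.reCLM_apply,
    Complex.ofReal_re, Complex.normSq_eq_norm_sq]

theorem exists_inner_eq (e : HilbertBasis ι ℂ H) {y : ι → ℂ}
    (hy : Summable fun k => ‖y k‖ ^ 2) : ∃ x : H, ∀ k, ⟪e k, x⟫_ℂ = y k := by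
  have hm : Memℓp y 2 := by
    refine memℓp_gen ?_
    simpa using hy
  refine ⟨e.repr.symm ⟨y, hm⟩, fun k => ?_⟩
  rw [← e.repr_apply_apply, LinearIsometryEquiv.apply_symm_apply]

theorem hasSum_inner_smul (e : HilbertBasis ι ℂ H) (x : H) :
    HasSum (fun k => ⟪e k, x⟫_ℂ • e k) x := by
  simpa only [e.repr_apply_apply] using e.hasSum_repr x

variable (hD : Diagonalizes D e d)
include hD

theorem Diagonalizes.mem_eigenspace {l : ℝ} {x : H} :
    x ∈ eigenspace D l ↔ ∀ k, d k ≠ l → ⟪e k, x⟫_ℂ = 0 := by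
  rw [mem_eigenspace_iff, hD]
  refine forall_congr' fun k => ?_
  rw [inner_smul_right]
  constructor
  · intro h hne
    have h1 : ((l : ℂ) - d k) ≠ 0 := by
      rw [sub_ne_zero]; exact_mod_cast hne.symm
    apply mul_left_cancel₀ h1
    linear_combination h
  · intro h
    by_cases hk : d k = l
    · rw [hk]
    · rw [h hk, mul_zero, mul_zero]

/-- The spectral projections are the partial sums of the expansion in the eigenbasis over the
indices of one eigenvalue. -/
theorem Diagonalizes.hasSum_eigenProj (l : ℝ) (x : H) :
    HasSum (fun k : {k // d k = l} => ⟪e k, x⟫_ℂ • e k) (eigenProj D l x) := by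
  have hs := (hasSum_inner_smul e x).summable.subtype {k | d k = l}
  obtain ⟨z, hz⟩ := hs
  have hz' : HasSum (fun k : {k // d k = l} => ⟪e k, x⟫_ℂ • e k) z := hz
  have hin : ∀ j, ⟪e j, z⟫_ℂ = if d j = l then ⟪e j, x⟫_ℂ else 0 := by
    intro j
    have h1 := hz'.mapL (innerSL ℂ (e j))
    simp only [innerSL_apply_apply, inner_smul_right] at h1
    split_ifs with hj
    · refine h1.unique ?_
      have h2 := hasSum_single (f := fun k : {k // d k = l} => ⟪e k, x⟫_ℂ * ⟪e j, e k⟫_ℂ) ⟨j, hj⟩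
        (fun k hk => by
          rw [e.orthonormal.2 (fun h => hk (Subtype.ext h.symm)), mul_zero])
      rw [inner_self_eq_norm_sq_to_K, e.orthonormal.1] at h2
      simpa using h2
    · refine h1.unique ?_
      convert hasSum_zero using 2 with k
      rw [e.orthonormal.2 (fun h => hj (by rw [h]; exact k.2)), mul_zero]
  have hzmem : z ∈ eigenspace D l := hD.mem_eigenspace.2 fun k hk => by rw [hin, if_neg hk]
  have horth : x - z ∈ (eigenspace D l).topologicalClosureᗮ := by
    rw [Submodule.orthogonal_closure, Submodule.mem_orthogonal]
    intro v hv
    refine (e.hasSum_inner_mul_inner v (x - z)).unique ?_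
    convert hasSum_zero using 2 with k
    rw [inner_sub_right, hin]
    by_cases hk : d k = l
    · rw [if_pos hk, sub_self, mul_zero]
    · rw [← inner_conj_symm v, hD.mem_eigenspace.1 hv k hk, map_zero, zero_mul]
  have : eigenProj D l x = z :=
    Submodule.eq_starProjection_of_mem_orthogonal (Submodule.le_topologicalClosure _ hzmem) horth
  rw [this]
  exact hz'

/-- On its natural domain, `f(D)` multiplies the coefficients in the eigenbasis by `f (d k)`.
Outside it the series that defines `f(D) x` may diverge. -/
theorem Diagonalizes.inner_funCalc {f : ℝ → ℂ} {x : H}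
    (hs : Summable fun k => ‖f (d k) * ⟪e k, x⟫_ℂ‖ ^ 2) (k : ι) :
    ⟪e k, funCalc D f x⟫_ℂ = f (d k) * ⟪e k, x⟫_ℂ := by
  obtain ⟨y, hy⟩ := exists_inner_eq e hs
  have h1 := hasSum_inner_smul e y
  simp_rw [hy] at h1
  have h2 := (Equiv.sigmaFiberEquiv d).hasSum_iff.2 h1
  have h3 := h2.sigma (g := fun l => f l • eigenProj D l x) (fun l => by
    have := (hD.hasSum_eigenProj l x).const_smul (f l)
    convert this using 2 with j
    change (f (d j) * ⟪e j, x⟫_ℂ) • e j = _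
    rw [j.2, mul_smul])
  have h4 : funCalc D f x = y := h3.tsum_eq
  rw [h4, hy]

/-- The domain of `D ^ n`, by the decay of the coefficients in the eigenbasis. -/
theorem Diagonalizes.mem_domPow (n : ℕ) : ∀ x : H,
    x ∈ domPow D n ↔ Summable fun k => ‖(d k : ℂ) ^ n * ⟪e k, x⟫_ℂ‖ ^ 2 := by
  induction n with
  | zero =>
    intro x
    simp only [domPow, pow_zero, one_mul, Submodule.mem_top, true_iff]
    exact summable_norm_inner_sq e x
  | succ n ih =>
    intro x
    rw [mem_domPow_succ]
    constructor
    · rintro ⟨h, hx⟩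
      rw [ih] at hx
      have h1 := (hD _ _).1 (mem_graph_iff'.2 ⟨h, rfl⟩)
      simp_rw [h1] at hx
      refine hx.congr fun k => ?_
      rw [pow_succ (d k : ℂ), mul_assoc]
    · intro hx
      have hs : Summable fun k => ‖(d k : ℂ) * ⟪e k, x⟫_ℂ‖ ^ 2 := by
        refine Summable.of_nonneg_of_le (fun k => by positivity) (fun k => ?_)
          ((summable_norm_inner_sq e x).add hx)
        rw [norm_mul, norm_mul, mul_pow, mul_pow, norm_pow, Complex.norm_real]
        have h0 : 0 ≤ ‖⟪e k, x⟫_ℂ‖ ^ 2 := by positivity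
        have h1 : ‖d k‖ ^ 2 ≤ 1 + (‖d k‖ ^ (n + 1)) ^ 2 := by
          rcases le_total ‖d k‖ 1 with h | h
          · have : ‖d k‖ ^ 2 ≤ 1 := pow_le_one₀ (norm_nonneg _) h
            have h2 : 0 ≤ (‖d k‖ ^ (n + 1)) ^ 2 := by positivity
            linarith
          · have : ‖d k‖ ^ 2 ≤ (‖d k‖ ^ (n + 1)) ^ 2 := by
              rw [← pow_mul]
              exact pow_le_pow_right₀ h (by omega)
            linarith
        nlinarith
      obtain ⟨y, hy⟩ := exists_inner_eq e hs
      obtain ⟨h, hxy⟩ := mem_graph_iff'.1 ((hD _ _).2 hy)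
      refine ⟨h, ?_⟩
      rw [ih, hxy]
      refine hx.congr fun k => ?_
      rw [hy, pow_succ (d k : ℂ), mul_assoc]

theorem Diagonalizes.mem_smoothVectors {x : H} :
    x ∈ smoothVectors D ↔ ∀ n : ℕ, Summable fun k => ‖(d k : ℂ) ^ n * ⟪e k, x⟫_ℂ‖ ^ 2 := by
  rw [smoothVectors, Submodule.mem_iInf]
  exact forall_congr' fun n => hD.mem_domPow n x

theorem Diagonalizes.basis_mem (k : ι) : e k ∈ smoothVectors D := by
  classical
  rw [hD.mem_smoothVectors]
  intro n
  refine summable_of_ne_finset_zero (s := {k}) fun j hj => ?_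
  rw [Finset.mem_singleton] at hj
  rw [e.orthonormal.2 hj]
  simp

omit hD in
/-- `f` is polynomially bounded on the family `d` of eigenvalues. -/
def PolyBounded (d : ι → ℝ) (f : ℝ → ℂ) : Prop :=
  ∃ (C : ℝ) (n : ℕ), ∀ k, ‖f (d k)‖ ≤ C * (1 + |d k| ^ n)

theorem Diagonalizes.mem_smoothVectors_of_inner {f : ℝ → ℂ} (hf : PolyBounded d f) {x y : H}
    (hx : x ∈ smoothVectors D) (hy : ∀ k, ⟪e k, y⟫_ℂ = f (d k) * ⟪e k, x⟫_ℂ) :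
    y ∈ smoothVectors D := by
  rw [hD.mem_smoothVectors] at hx ⊢
  obtain ⟨C, n, hC⟩ := hf
  intro m
  refine Summable.of_nonneg_of_le (fun k => by positivity) (fun k => ?_)
    (((hx m).add (hx (m + n))).mul_left (2 * C ^ 2))
  rw [hy]
  simp only [norm_mul, norm_pow, Complex.norm_real, Real.norm_eq_abs, mul_pow]
  have h0 : 0 ≤ ‖⟪e k, x⟫_ℂ‖ ^ 2 := by positivity
  have h1 : ‖f (d k)‖ ^ 2 ≤ C ^ 2 * (1 + |d k| ^ n) ^ 2 := by
    rw [← mul_pow]; exact pow_le_pow_left₀ (norm_nonneg _) (hC k) 2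
  have h2 : (1 + |d k| ^ n) ^ 2 ≤ 2 * (1 + (|d k| ^ n) ^ 2) := by
    nlinarith [sq_nonneg (1 - |d k| ^ n)]
  calc (|d k| ^ m) ^ 2 * (‖f (d k)‖ ^ 2 * ‖⟪e k, x⟫_ℂ‖ ^ 2)
      ≤ (|d k| ^ m) ^ 2 * ((C ^ 2 * (2 * (1 + (|d k| ^ n) ^ 2))) * ‖⟪e k, x⟫_ℂ‖ ^ 2) := by
        have : ‖f (d k)‖ ^ 2 ≤ C ^ 2 * (2 * (1 + (|d k| ^ n) ^ 2)) :=
          h1.trans (mul_le_mul_of_nonneg_left h2 (sq_nonneg C))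
        gcongr
    _ = _ := by rw [pow_add]; ring

theorem Diagonalizes.summable_of_polyBounded {f : ℝ → ℂ} (hf : PolyBounded d f) {x : H}
    (hx : x ∈ smoothVectors D) : Summable fun k => ‖f (d k) * ⟪e k, x⟫_ℂ‖ ^ 2 := by
  rw [hD.mem_smoothVectors] at hx
  obtain ⟨C, n, hC⟩ := hf
  refine Summable.of_nonneg_of_le (fun k => by positivity) (fun k => ?_)
    (((hx 0).add (hx n)).mul_left (2 * C ^ 2))
  simp only [norm_mul, norm_pow, Complex.norm_real, Real.norm_eq_abs, mul_pow, pow_zero, one_mul]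
  have h0 : 0 ≤ ‖⟪e k, x⟫_ℂ‖ ^ 2 := by positivity
  have h1 : ‖f (d k)‖ ^ 2 ≤ C ^ 2 * (1 + |d k| ^ n) ^ 2 := by
    rw [← mul_pow]; exact pow_le_pow_left₀ (norm_nonneg _) (hC k) 2
  have h2 : (1 + |d k| ^ n) ^ 2 ≤ 2 * (1 + (|d k| ^ n) ^ 2) := by
    nlinarith [sq_nonneg (1 - |d k| ^ n)]
  have : ‖f (d k)‖ ^ 2 ≤ C ^ 2 * (2 * (1 + (|d k| ^ n) ^ 2)) :=
    h1.trans (mul_le_mul_of_nonneg_left h2 (sq_nonneg C))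
  nlinarith

omit hD in
/-- `T` is diagonal with respect to `e`, with eigenvalues `c k`. -/
def IsDiag (e : HilbertBasis ι ℂ H) (T : SmoothOp D) (c : ι → ℂ) : Prop :=
  ∀ (x : smoothVectors D) (k : ι), ⟪e k, (T x : H)⟫_ℂ = c k * ⟪e k, (x : H)⟫_ℂ

omit hD in
/-- `restr` does not return its default value if `T` is given by an operator on smooth vectors. -/
theorem restr_eq {T : H → H} (S : SmoothOp D) (h : ∀ x : smoothVectors D, (S x : H) = T x) :
    restr D T = S := by
  have hex : ∃ S : SmoothOp D, ∀ x : smoothVectors D, (S x : H) = T x := ⟨S, h⟩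
  rw [restr, dif_pos hex]
  refine LinearMap.ext fun x => Subtype.ext ?_
  rw [hex.choose_spec x, h x]

omit hD in
theorem restr_apply {T : H →ₗ[ℂ] H} (h : ∀ x ∈ smoothVectors D, T x ∈ smoothVectors D)
    (x : smoothVectors D) : (restr D T x : H) = T x := by
  have : restr D (T : H → H) = T.restrict h := restr_eq _ fun x => rfl
  rw [this]
  rfl

omit hD in
theorem restr_clm_apply {T : H →L[ℂ] H} (h : ∀ x ∈ smoothVectors D, T x ∈ smoothVectors D)
    (x : smoothVectors D) : (restr D T x : H) = T x :=
  restr_apply (T := (T : H →ₗ[ℂ] H)) h x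

/-- The functional calculus on smooth vectors. -/
theorem Diagonalizes.restr_funCalc {f : ℝ → ℂ} (hf : PolyBounded d f) :
    (∀ x : smoothVectors D, (restr D (funCalc D f) x : H) = funCalc D f x) ∧
    IsDiag e (restr D (funCalc D f)) fun k => f (d k) := by
  have h1 : ∀ x ∈ smoothVectors D, ∀ k, ⟪e k, funCalc D f x⟫_ℂ = f (d k) * ⟪e k, x⟫_ℂ :=
    fun x hx k => hD.inner_funCalc (hD.summable_of_polyBounded hf hx) k
  set S : SmoothOp D :=
    { toFun := fun x => ⟨funCalc D f x, hD.mem_smoothVectors_of_inner hf x.2 (h1 x x.2)⟩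
      map_add' := fun x y => by
        refine Subtype.ext (ext_inner_basis e fun k => ?_)
        change ⟪e k, funCalc D f ((x + y : smoothVectors D) : H)⟫_ℂ =
          ⟪e k, funCalc D f x + funCalc D f y⟫_ℂ
        rw [h1 _ (x + y).2, inner_add_right, h1 _ x.2, h1 _ y.2, Submodule.coe_add,
          inner_add_right, mul_add]
      map_smul' := fun c x => by
        refine Subtype.ext (ext_inner_basis e fun k => ?_)
        change ⟪e k, funCalc D f ((c • x : smoothVectors D) : H)⟫_ℂ = ⟪e k, c • funCalc D f x⟫_ℂ
        rw [h1 _ (c • x).2, inner_smul_right, h1 _ x.2, Submodule.coe_smul, inner_smul_right]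
        ring } with hS
  have h2 : restr D (funCalc D f) = S := restr_eq S fun x => rfl
  rw [h2]
  exact ⟨fun x => rfl, fun x k => h1 x x.2 k⟩

omit hD in
theorem IsDiag.ext {T S : SmoothOp D} {c : ι → ℂ} (hT : IsDiag e T c) (hS : IsDiag e S c) :
    T = S :=
  LinearMap.ext fun x => Subtype.ext (ext_inner_basis e fun k => by rw [hT, hS])

omit hD in
theorem IsDiag.mul {T S : SmoothOp D} {c c' : ι → ℂ} (hT : IsDiag e T c) (hS : IsDiag e S c') :
    IsDiag e (T * S) fun k => c k * c' k := fun x k => by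
  rw [Module.End.mul_apply, hT, hS, mul_assoc]

omit hD in
theorem IsDiag.sub {T S : SmoothOp D} {c c' : ι → ℂ} (hT : IsDiag e T c) (hS : IsDiag e S c') :
    IsDiag e (T - S) fun k => c k - c' k := fun x k => by
  rw [LinearMap.sub_apply, Submodule.coe_sub, inner_sub_right, hT, hS, sub_mul]

omit hD in
theorem IsDiag.one : IsDiag e (1 : SmoothOp D) fun _ => 1 := fun x k => by
  rw [Module.End.one_apply, one_mul]

omit hD in
theorem IsDiag.pow {T : SmoothOp D} {c : ι → ℂ} (hT : IsDiag e T c) (n : ℕ) :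
    IsDiag e (T ^ n) fun k => c k ^ n := by
  induction n with
  | zero => simpa using IsDiag.one
  | succ n ih => simpa only [pow_succ] using ih.mul hT

omit hD in
theorem IsDiag.congr {T : SmoothOp D} {c c' : ι → ℂ} (hT : IsDiag e T c) (h : ∀ k, c k = c' k) :
    IsDiag e T c' := fun x k => by rw [hT, h]

theorem Diagonalizes.isDiag_selfOp : IsDiag e (selfOp D) fun k => (d k : ℂ) := fun x k =>
  (hD _ _).1 (mem_graph_iff'.2 ⟨smoothVectors_le_domain D x.2, rfl⟩) k

omit hD in
theorem polyBounded_of_abs {c : ℝ} (hc : 0 < c) (hcd : ∀ k, c ≤ |invertedEigenvalue (d k)|)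
    {f : ℝ → ℂ} (σ : ℝ) (h : ∀ l, ‖f l‖ ≤ |invertedEigenvalue l| ^ σ) : PolyBounded d f := by
  obtain ⟨C, hC, m, hb⟩ := exists_rpow_bound (B := 1) hc |σ|
  refine ⟨C * 2 ^ m, m, fun k => ?_⟩
  have h1 : |invertedEigenvalue (d k)| ≤ 1 * (1 + |d k|) := by
    unfold invertedEigenvalue
    split_ifs with h0
    · simp [h0]
    · linarith
  have h2 := hb _ |d k| σ (abs_nonneg _) (hcd k) h1 le_rfl
  refine (h (d k)).trans (h2.trans ?_)
  rw [mul_assoc]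
  gcongr
  calc (1 + |d k|) ^ m ≤ (2 * max 1 |d k|) ^ m := by
        gcongr
        linarith [le_max_left 1 |d k|, le_max_right 1 |d k|]
    _ = 2 ^ m * (max 1 |d k|) ^ m := mul_pow _ _ _
    _ ≤ 2 ^ m * (1 + |d k| ^ m) := by
        gcongr
        rcases le_total 1 |d k| with h | h
        · rw [max_eq_right h]; linarith
        · rw [max_eq_left h, one_pow]
          have : 0 ≤ |d k| ^ m := by positivity
          linarith

variable (hg : HasGap d)
include hg

theorem Diagonalizes.absPow_spec (z : ℂ) :
    (∀ x : smoothVectors D, (absPow D z x : H) = absPowFun D z x) ∧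
      IsDiag e (absPow D z) fun k => absCpow (d k) z := by
  obtain ⟨c, hc, hcd⟩ := hg
  exact hD.restr_funCalc (polyBounded_of_abs hc hcd z.re fun l => (norm_absCpow l z).le)

theorem Diagonalizes.isDiag_absPow (z : ℂ) :
    IsDiag e (absPow D z) fun k => absCpow (d k) z :=
  (hD.absPow_spec hg z).2

theorem Diagonalizes.isDiag_intPow (n : ℤ) :
    IsDiag e (intPow D n) fun k => (invertedEigenvalue (d k) : ℂ) ^ n := by
  obtain ⟨c, hc, hcd⟩ := hg
  refine (hD.restr_funCalc (polyBounded_of_abs hc hcd n fun l => ?_)).2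
  rw [norm_zpow, Complex.norm_real, Real.norm_eq_abs, Real.rpow_intCast]

theorem Diagonalizes.isDiag_signOp :
    IsDiag e (signOp D) fun k => (eigenSign (d k) : ℂ) := by
  obtain ⟨c, hc, hcd⟩ := hg
  refine (hD.restr_funCalc (f := fun l => ((Real.sign (invertedEigenvalue l) : ℝ) : ℂ))
    (polyBounded_of_abs hc hcd 0 fun l => ?_)).2
  rw [Complex.norm_real, Real.norm_eq_abs, Real.rpow_zero]
  exact (abs_eigenSign l).le

theorem Diagonalizes.absPow_add (z z' : ℂ) : absPow D (z + z') = absPow D z * absPow D z' :=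
  (hD.isDiag_absPow hg _).ext
    (((hD.isDiag_absPow hg z).mul (hD.isDiag_absPow hg z')).congr fun _ => (absCpow_add _ _ _).symm)

theorem Diagonalizes.absPow_zero : absPow D 0 = 1 :=
  (hD.isDiag_absPow hg 0).ext (IsDiag.one.congr fun _ => (absCpow_zero _).symm)

theorem Diagonalizes.absPow_natCast (n : ℕ) : absPow D n = absPow D 1 ^ n := by
  induction n with
  | zero => rw [Nat.cast_zero, hD.absPow_zero hg, pow_zero]
  | succ n ih => rw [Nat.cast_succ, hD.absPow_add hg, ih, pow_succ]

end FunctionalCalculus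

/-! ### Bounded operators on smooth vectors -/

section Bounded

variable {H : Type u} [NormedAddCommGroup H] [InnerProductSpace ℂ H] [CompleteSpace H]
  {ι : Type*} {D : H →ₗ.[ℂ] H} {e : HilbertBasis ι ℂ H} {d : ι → ℝ}

/-- `T` extends to a bounded operator. -/
def IsBdd (T : SmoothOp D) : Prop := ∃ B : H →L[ℂ] H, Extends B T

theorem IsBdd.add {T S : SmoothOp D} (hT : IsBdd T) (hS : IsBdd S) : IsBdd (T + S) := by
  obtain ⟨B, hB⟩ := hT
  obtain ⟨B', hB'⟩ := hS
  exact ⟨B + B', fun x => by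
    rw [add_apply, hB, hB', LinearMap.add_apply, Submodule.coe_add]⟩

theorem IsBdd.sub {T S : SmoothOp D} (hT : IsBdd T) (hS : IsBdd S) : IsBdd (T - S) := by
  obtain ⟨B, hB⟩ := hT
  obtain ⟨B', hB'⟩ := hS
  exact ⟨B - B', fun x => by
    rw [sub_apply, hB, hB', LinearMap.sub_apply, Submodule.coe_sub]⟩

theorem IsBdd.mul {T S : SmoothOp D} (hT : IsBdd T) (hS : IsBdd S) : IsBdd (T * S) := by
  obtain ⟨B, hB⟩ := hT
  obtain ⟨B', hB'⟩ := hS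
  exact ⟨B.comp B', fun x => by
    rw [ContinuousLinearMap.comp_apply, hB', hB, Module.End.mul_apply]⟩

theorem IsBdd.zero : IsBdd (0 : SmoothOp D) := ⟨0, fun _ => rfl⟩

theorem IsBdd.one : IsBdd (1 : SmoothOp D) := ⟨1, fun _ => rfl⟩

/-- The bounded diagonal operator with eigenvalues `c k` on the Hilbert basis `e`. -/
theorem exists_diagonal_clm (e : HilbertBasis ι ℂ H) {c : ι → ℂ} {C : ℝ} (hc : ∀ k, ‖c k‖ ≤ C) :
    ∃ G : H →L[ℂ] H, ∀ x k, ⟪e k, G x⟫_ℂ = c k * ⟪e k, x⟫_ℂ := by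
  have hle : ∀ (x : H) k, ‖c k * ⟪e k, x⟫_ℂ‖ ^ 2 ≤ C ^ 2 * ‖⟪e k, x⟫_ℂ‖ ^ 2 := by
    intro x k
    rw [norm_mul, mul_pow]
    have := hc k
    gcongr
  have hs : ∀ x : H, Summable fun k => ‖c k * ⟪e k, x⟫_ℂ‖ ^ 2 := fun x =>
    Summable.of_nonneg_of_le (fun k => by positivity) (hle x)
      ((summable_norm_inner_sq e x).mul_left _)
  choose g hg using fun x => exists_inner_eq e (hs x)
  set G : H →ₗ[ℂ] H :=
    { toFun := g
      map_add' := fun x y => ext_inner_basis e fun k => by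
        rw [hg, inner_add_right, inner_add_right, hg, hg, mul_add]
      map_smul' := fun a x => ext_inner_basis e fun k => by
        rw [hg, inner_smul_right, RingHom.id_apply, inner_smul_right, hg]; ring } with hG
  refine ⟨G.mkContinuous |C| fun x => ?_, fun x k => hg x k⟩
  refine abs_le_of_sq_le_sq' ?_ (by positivity) |>.2
  rw [← tsum_norm_inner_sq e (G x), mul_pow, sq_abs, ← tsum_norm_inner_sq e x, ← tsum_mul_left]
  have h1 : ∀ k, ‖⟪e k, G x⟫_ℂ‖ ^ 2 = ‖c k * ⟪e k, x⟫_ℂ‖ ^ 2 := fun k => by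
    rw [show G x = g x from rfl, hg]
  simp_rw [h1]
  exact (hs x).tsum_le_tsum (hle x) ((summable_norm_inner_sq e x).mul_left _)

theorem IsDiag.isBdd {T : SmoothOp D} {c : ι → ℂ} (hT : IsDiag e T c) {C : ℝ}
    (hc : ∀ k, ‖c k‖ ≤ C) : IsBdd T := by
  obtain ⟨G, hG⟩ := exists_diagonal_clm e hc
  exact ⟨G, fun x => ext_inner_basis e fun k => by rw [hG, hT]⟩

end Bounded

/-! ### Operators of order zero and smoothing operators -/

section Orders

set_option linter.unusedSimpArgs false

variable {H : Type u} [NormedAddCommGroup H] [InnerProductSpace ℂ H] [CompleteSpace H]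
  {ι : Type*} {D : H →ₗ.[ℂ] H} {e : HilbertBasis ι ℂ H} {d : ι → ℝ}

/-- `T` is in the domain of all powers of `δ`, that is, `T ∈ OP^0`. -/
def IsOPZero (T : SmoothOp D) : Prop := ∀ k : ℕ, IsBdd ((delta D)^[k] T)

/-- `T` is smoothing, in the form that all `|D|^m T |D|^n` are bounded. -/
def IsSm (T : SmoothOp D) : Prop := ∀ m n : ℕ, IsBdd (absPow D 1 ^ m * T * absPow D 1 ^ n)

theorem delta_add (T S : SmoothOp D) : delta D (T + S) = delta D T + delta D S := by
  simp only [delta]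
  simp only [mul_sub, sub_mul, mul_add, add_mul, mul_assoc]
  abel

theorem delta_sub (T S : SmoothOp D) : delta D (T - S) = delta D T - delta D S := by
  simp only [delta]
  simp only [mul_sub, sub_mul, mul_add, add_mul, mul_assoc]
  abel

theorem delta_mul (T S : SmoothOp D) : delta D (T * S) = delta D T * S + T * delta D S := by
  simp only [delta]
  simp only [mul_sub, sub_mul, mul_add, add_mul, mul_assoc]
  abel

theorem delta_one : delta D 1 = 0 := by simp [delta]

theorem delta_zero : delta D 0 = 0 := by simp [delta]

theorem iterate_delta_zero (k : ℕ) : (delta D)^[k] 0 = 0 := Function.iterate_fixed delta_zero k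

theorem iterate_delta_add (k : ℕ) (T S : SmoothOp D) :
    (delta D)^[k] (T + S) = (delta D)^[k] T + (delta D)^[k] S := by
  induction k generalizing T S with
  | zero => rfl
  | succ k ih => simp only [Function.iterate_succ_apply, delta_add, ih]

theorem iterate_delta_sub (k : ℕ) (T S : SmoothOp D) :
    (delta D)^[k] (T - S) = (delta D)^[k] T - (delta D)^[k] S := by
  induction k generalizing T S with
  | zero => rfl
  | succ k ih => simp only [Function.iterate_succ_apply, delta_sub, ih]

theorem IsOPZero.isBdd {T : SmoothOp D} (hT : IsOPZero T) : IsBdd T := hT 0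

theorem IsOPZero.delta {T : SmoothOp D} (hT : IsOPZero T) : IsOPZero (delta D T) := fun k => by
  rw [← Function.iterate_succ_apply]
  exact hT (k + 1)

theorem IsOPZero.add {T S : SmoothOp D} (hT : IsOPZero T) (hS : IsOPZero S) :
    IsOPZero (T + S) := fun k => by
  rw [iterate_delta_add]; exact (hT k).add (hS k)

theorem IsOPZero.sub {T S : SmoothOp D} (hT : IsOPZero T) (hS : IsOPZero S) :
    IsOPZero (T - S) := fun k => by
  rw [iterate_delta_sub]; exact (hT k).sub (hS k)

theorem IsOPZero.mul {T S : SmoothOp D} (hT : IsOPZero T) (hS : IsOPZero S) :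
    IsOPZero (T * S) := by
  intro k
  induction k generalizing T S with
  | zero => exact hT.isBdd.mul hS.isBdd
  | succ k ih =>
    rw [Function.iterate_succ_apply, delta_mul, iterate_delta_add]
    exact (ih hT.delta hS).add (ih hT hS.delta)

theorem isOPZero_of_delta_eq_zero {T : SmoothOp D} (hT : IsBdd T) (h : delta D T = 0) :
    IsOPZero T := by
  intro k
  cases k with
  | zero => exact hT
  | succ k =>
    rw [Function.iterate_succ_apply, h, iterate_delta_zero]
    exact IsBdd.zero

theorem IsOPZero.one : IsOPZero (1 : SmoothOp D) := isOPZero_of_delta_eq_zero IsBdd.one delta_one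

theorem IsSm.isBdd {T : SmoothOp D} (hT : IsSm T) : IsBdd T := by simpa using hT 0 0

theorem IsSm.absPow_mul {T : SmoothOp D} (hT : IsSm T) : IsSm (absPow D 1 * T) := fun m n => by
  have := hT (m + 1) n
  rwa [pow_succ, mul_assoc (absPow D 1 ^ m)] at this

theorem IsSm.mul_absPow {T : SmoothOp D} (hT : IsSm T) : IsSm (T * absPow D 1) := fun m n => by
  have := hT m (n + 1)
  rwa [pow_succ', ← mul_assoc, mul_assoc (absPow D 1 ^ m)] at this

theorem IsSm.mul_absPow_pow {T : SmoothOp D} (hT : IsSm T) (N : ℕ) :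
    IsSm (T * absPow D 1 ^ N) := by
  induction N with
  | zero => simpa using hT
  | succ N ih => rw [pow_succ, ← mul_assoc]; exact ih.mul_absPow

theorem IsSm.add {T S : SmoothOp D} (hT : IsSm T) (hS : IsSm S) : IsSm (T + S) := fun m n => by
  rw [mul_add, add_mul]; exact (hT m n).add (hS m n)

theorem IsSm.sub {T S : SmoothOp D} (hT : IsSm T) (hS : IsSm S) : IsSm (T - S) := fun m n => by
  rw [mul_sub, sub_mul]; exact (hT m n).sub (hS m n)

theorem IsSm.delta {T : SmoothOp D} (hT : IsSm T) : IsSm (delta D T) :=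
  hT.absPow_mul.sub hT.mul_absPow

theorem IsSm.isOPZero {T : SmoothOp D} (hT : IsSm T) : IsOPZero T := by
  intro k
  induction k generalizing T with
  | zero => exact hT.isBdd
  | succ k ih => rw [Function.iterate_succ_apply]; exact ih hT.delta

/-- Powers of `|D|` are moved through `S` at the cost of the commutators `δ(S)`. -/
theorem IsSm.mul_left {T S : SmoothOp D} (hT : IsSm T) (hS : IsOPZero S) : IsSm (S * T) := by
  intro m
  induction m generalizing T S with
  | zero =>
    intro n
    rw [pow_zero, one_mul, mul_assoc]
    have := hT 0 n
    rw [pow_zero, one_mul] at this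
    exact hS.isBdd.mul this
  | succ m ih =>
    intro n
    have e : absPow D 1 ^ (m + 1) * (S * T) * absPow D 1 ^ n =
        absPow D 1 ^ m * (S * (absPow D 1 * T)) * absPow D 1 ^ n +
          absPow D 1 ^ m * (SpectralGeometry.delta D S * T) * absPow D 1 ^ n := by
      simp only [SpectralGeometry.delta, pow_succ]
      simp only [mul_sub, sub_mul, mul_add, add_mul, mul_assoc]
      abel
    rw [e]
    exact (ih hT.absPow_mul hS n).add (ih hT hS.delta n)

theorem IsSm.mul_right {T S : SmoothOp D} (hT : IsSm T) (hS : IsOPZero S) : IsSm (T * S) := by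
  intro m n
  induction n generalizing T S with
  | zero =>
    rw [pow_zero, mul_one, ← mul_assoc]
    have := hT m 0
    rw [pow_zero, mul_one] at this
    exact this.mul hS.isBdd
  | succ n ih =>
    have e : absPow D 1 ^ m * (T * S) * absPow D 1 ^ (n + 1) =
        absPow D 1 ^ m * ((T * absPow D 1) * S) * absPow D 1 ^ n -
          absPow D 1 ^ m * (T * SpectralGeometry.delta D S) * absPow D 1 ^ n := by
      simp only [SpectralGeometry.delta, pow_succ']
      simp only [mul_sub, sub_mul, mul_add, add_mul, mul_assoc]
      abel
    rw [e]
    exact (ih hT.mul_absPow hS).sub (ih hT hS.delta)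

variable (hD : Diagonalizes D e d) (hg : HasGap d)
include hD hg

theorem Diagonalizes.isOP_zero_iff {T : SmoothOp D} : IsOP D 0 T ↔ IsOPZero T := by
  unfold IsOP IsOPZero
  rw [Int.cast_zero, neg_zero, hD.absPow_zero hg, mul_one]
  rfl

theorem Diagonalizes.isOP_neg_iff {T : SmoothOp D} (N : ℕ) :
    IsOP D (-(N : ℤ)) T ↔ IsOPZero (T * absPow D 1 ^ N) := by
  unfold IsOP IsOPZero
  rw [Int.cast_neg, neg_neg, Int.cast_natCast, hD.absPow_natCast hg]
  rfl

/-- An operator in all classes `OP^r` remains bounded after multiplication with powers of `|D|`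
on both sides. -/
theorem Diagonalizes.isSm_of_isSmoothing {T : SmoothOp D} (hT : IsSmoothing D T) : IsSm T := by
  have h1 : ∀ n : ℕ, IsOPZero (T * absPow D 1 ^ n) := fun n => (hD.isOP_neg_iff hg n).1 (hT _)
  clear hT
  have hP : ∀ n : ℕ, delta D (absPow D 1 ^ n) = 0 := fun n => by
    simp only [delta]
    rw [← pow_succ, ← pow_succ', sub_self]
  intro m
  induction m generalizing T with
  | zero =>
    intro n
    rw [pow_zero, one_mul]
    exact (h1 n).isBdd
  | succ m ih =>
    intro n
    have e : absPow D 1 ^ (m + 1) * T * absPow D 1 ^ n =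
        absPow D 1 ^ m * T * absPow D 1 ^ (n + 1) +
          absPow D 1 ^ m * delta D T * absPow D 1 ^ n := by
      simp only [delta, pow_succ (absPow D 1) m, pow_succ' (absPow D 1) n]
      simp only [mul_sub, sub_mul, mul_add, add_mul, mul_assoc]
      abel
    rw [e]
    refine (ih h1 (n + 1)).add (ih (T := delta D T) (fun k => ?_) n)
    have := (h1 k).delta
    rwa [delta_mul, hP, mul_zero, add_zero] at this

theorem Diagonalizes.delta_signOp : delta D (signOp D) = 0 := by
  have h1 := hD.isDiag_absPow hg 1
  have h2 := hD.isDiag_signOp hg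
  exact sub_eq_zero.2 ((h1.mul h2).ext ((h2.mul h1).congr fun k => mul_comm _ _))

theorem Diagonalizes.isOPZero_signOp : IsOPZero (signOp D) := by
  refine isOPZero_of_delta_eq_zero ((hD.isDiag_signOp hg).isBdd (C := 1) fun k => ?_)
    (hD.delta_signOp hg)
  rw [Complex.norm_real, Real.norm_eq_abs, abs_eigenSign]

omit hD hg in
theorem absCpow_one (l : ℝ) : absCpow l 1 = ((|invertedEigenvalue l| : ℝ) : ℂ) :=
  Complex.cpow_one _

omit hD hg in
/-- The projection onto the kernel of `D`, as the defect of the polar decomposition of `D`. -/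
def kerProj (D : H →ₗ.[ℂ] H) : SmoothOp D := signOp D * absPow D 1 - selfOp D

theorem Diagonalizes.isDiag_kerProj : IsDiag e (kerProj D) fun k => if d k = 0 then 1 else 0 := by
  refine (((hD.isDiag_signOp hg).mul (hD.isDiag_absPow hg 1)).sub hD.isDiag_selfOp).congr
    fun k => ?_
  rw [absCpow_one, ← Complex.ofReal_mul, eigenSign_mul_abs, invertedEigenvalue]
  split_ifs with h <;> simp [h]

theorem Diagonalizes.isSm_kerProj : IsSm (kerProj D) := by
  intro m n
  refine ((((hD.isDiag_absPow hg 1).pow m).mul (hD.isDiag_kerProj hg)).mul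
    ((hD.isDiag_absPow hg 1).pow n)).isBdd (C := 1) fun k => ?_
  rw [absCpow_one, invertedEigenvalue]
  split_ifs with h <;> simp

omit hD hg in
/-- The class of operators of order zero which commute with the sign of `D` modulo smoothing
operators. -/
structure IsTame (T : SmoothOp D) : Prop where
  op : IsOPZero T
  comm : IsSm (signOp D * T - T * signOp D)

omit hD hg in
theorem IsTame.add {T S : SmoothOp D} (hT : IsTame T) (hS : IsTame S) : IsTame (T + S) := by
  refine ⟨hT.op.add hS.op, ?_⟩
  have e : signOp D * (T + S) - (T + S) * signOp D =
      (signOp D * T - T * signOp D) + (signOp D * S - S * signOp D) := by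
    simp only [mul_sub, sub_mul, mul_add, add_mul, mul_assoc]
    abel
  rw [e]; exact hT.comm.add hS.comm

omit hD hg in
theorem IsTame.sub {T S : SmoothOp D} (hT : IsTame T) (hS : IsTame S) : IsTame (T - S) := by
  refine ⟨hT.op.sub hS.op, ?_⟩
  have e : signOp D * (T - S) - (T - S) * signOp D =
      (signOp D * T - T * signOp D) - (signOp D * S - S * signOp D) := by
    simp only [mul_sub, sub_mul, mul_add, add_mul, mul_assoc]
    abel
  rw [e]; exact hT.comm.sub hS.comm

omit hD hg in
theorem IsTame.mul {T S : SmoothOp D} (hT : IsTame T) (hS : IsTame S) : IsTame (T * S) := by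
  refine ⟨hT.op.mul hS.op, ?_⟩
  have e : signOp D * (T * S) - (T * S) * signOp D =
      (signOp D * T - T * signOp D) * S + T * (signOp D * S - S * signOp D) := by
    simp only [mul_sub, sub_mul, mul_add, add_mul, mul_assoc]
    abel
  rw [e]; exact (hT.comm.mul_right hS.op).add (hS.comm.mul_left hT.op)

omit hD hg in
theorem IsTame.one : IsTame (1 : SmoothOp D) := by
  refine ⟨IsOPZero.one, ?_⟩
  rw [mul_one, one_mul, sub_self]
  intro m n
  rw [mul_zero, zero_mul]
  exact IsBdd.zero

omit hD hg in
theorem IsTame.pow {T : SmoothOp D} (hT : IsTame T) (n : ℕ) : IsTame (T ^ n) := by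
  induction n with
  | zero => rw [pow_zero]; exact IsTame.one
  | succ n ih => rw [pow_succ]; exact ih.mul hT

theorem Diagonalizes.isTame_signOp : IsTame (signOp D) := by
  refine ⟨hD.isOPZero_signOp hg, ?_⟩
  rw [sub_self]
  intro m n
  rw [mul_zero, zero_mul]
  exact IsBdd.zero

theorem Diagonalizes.isTame_of_isSm {T : SmoothOp D} (hT : IsSm T) : IsTame T :=
  ⟨hT.isOPZero, (hT.mul_left (hD.isOPZero_signOp hg)).sub (hT.mul_right (hD.isOPZero_signOp hg))⟩

theorem Diagonalizes.isTame_delta {T : SmoothOp D} (hT : IsTame T) : IsTame (delta D T) := by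
  refine ⟨hT.op.delta, ?_⟩
  have h := hD.delta_signOp hg
  have e : signOp D * delta D T - delta D T * signOp D =
      delta D (signOp D * T - T * signOp D) := by
    rw [delta_sub, delta_mul, delta_mul, h, zero_mul, zero_add, mul_zero, add_zero]
  rw [e]; exact hT.comm.delta

/-- Since `D = F |D|` up to the kernel projection, `[D, T]` equals `F δ(T)` up to a smoothing
operator; so it is again of order zero. -/
theorem Diagonalizes.isTame_commutator {T : SmoothOp D} (hT : IsTame T) :
    IsTame (selfOp D * T - T * selfOp D) := by
  have e : selfOp D * T - T * selfOp D = signOp D * delta D T +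
      ((signOp D * T - T * signOp D) * absPow D 1 - (kerProj D * T - T * kerProj D)) := by
    simp only [kerProj, delta]
    simp only [mul_sub, sub_mul, mul_add, add_mul, mul_assoc]
    abel
  rw [e]
  have hK := hD.isSm_kerProj hg
  exact ((hD.isTame_signOp hg).mul (hD.isTame_delta hg hT)).add
    (hD.isTame_of_isSm hg (hT.comm.mul_absPow.sub ((hK.mul_right hT.op).sub (hK.mul_left hT.op))))

end Orders

/-! ### Traces in an eigenbasis -/

section Traces

variable {H : Type u} [NormedAddCommGroup H] [InnerProductSpace ℂ H] [CompleteSpace H]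
  {ι : Type*} {D : H →ₗ.[ℂ] H} {e : HilbertBasis ι ℂ H} {d : ι → ℝ}

theorem sqrt_sum_norm_inner_sq_le (e : HilbertBasis ι ℂ H) (x : H) (s : Finset ι) :
    √(∑ k ∈ s, ‖⟪e k, x⟫_ℂ‖ ^ 2) ≤ ‖x‖ := by
  rw [Real.sqrt_le_iff]
  refine ⟨norm_nonneg _, ?_⟩
  rw [← tsum_norm_inner_sq e x]
  exact (summable_norm_inner_sq e x).sum_le_tsum s fun k _ => by positivity

theorem sum_norm_inner_mul_le (e : HilbertBasis ι ℂ H) (x y : H) (s : Finset ι) :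
    ∑ k ∈ s, ‖⟪e k, x⟫_ℂ‖ * ‖⟪e k, y⟫_ℂ‖ ≤ ‖x‖ * ‖y‖ := by
  refine (Real.sum_mul_le_sqrt_mul_sqrt s _ _).trans ?_
  exact mul_le_mul (sqrt_sum_norm_inner_sq_le e x s) (sqrt_sum_norm_inner_sq_le e y s)
    (Real.sqrt_nonneg _) (norm_nonneg _)

theorem summable_norm_inner_mul (e : HilbertBasis ι ℂ H) (x y : H) :
    Summable fun k => ‖⟪e k, x⟫_ℂ‖ * ‖⟪e k, y⟫_ℂ‖ :=
  summable_of_sum_le (fun k => by positivity) (sum_norm_inner_mul_le e x y)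

theorem tsum_norm_inner_mul_le (e : HilbertBasis ι ℂ H) (x y : H) :
    ∑' k, ‖⟪e k, x⟫_ℂ‖ * ‖⟪e k, y⟫_ℂ‖ ≤ ‖x‖ * ‖y‖ :=
  (summable_norm_inner_mul e x y).tsum_le_of_sum_le (sum_norm_inner_mul_le e x y)

/-- In every Hilbert basis, the diagonal of `∑ₙ ⟨xₙ, ·⟩ yₙ` sums to `∑ₙ ⟨xₙ, yₙ⟩`. -/
theorem hasSum_inner_apply (e : HilbertBasis ι ℂ H) {B : H →L[ℂ] H} {x y : ℕ → H}
    (hs : Summable fun n => ‖x n‖ * ‖y n‖)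
    (hB : ∀ v : H, HasSum (fun n => ⟪x n, v⟫_ℂ • y n) (B v)) :
    HasSum (fun k => ⟪e k, B (e k)⟫_ℂ) (∑' n, ⟪x n, y n⟫_ℂ) := by
  set f : ℕ × ι → ℂ := fun p => ⟪x p.1, e p.2⟫_ℂ * ⟪e p.2, y p.1⟫_ℂ with hf
  have hn : ∀ n k, ‖f (n, k)‖ = ‖⟪e k, x n⟫_ℂ‖ * ‖⟪e k, y n⟫_ℂ‖ := fun n k => by
    rw [hf, norm_mul, norm_inner_symm]
  have hfs : Summable f := by
    refine Summable.of_norm ?_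
    rw [summable_prod_of_nonneg fun p => norm_nonneg _]
    simp only [hn]
    exact ⟨fun n => summable_norm_inner_mul e _ _, Summable.of_nonneg_of_le
      (fun n => tsum_nonneg fun k => by positivity)
      (fun n => tsum_norm_inner_mul_le e (x n) (y n)) hs⟩
  have h1 : ∀ n, HasSum (fun k => f (n, k)) ⟪x n, y n⟫_ℂ := fun n =>
    e.hasSum_inner_mul_inner (x n) (y n)
  have h2 : ∀ k, HasSum (fun n => f (n, k)) ⟪e k, B (e k)⟫_ℂ := fun k => by
    have h := (hB (e k)).mapL (innerSL ℂ (e k))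
    simp only [innerSL_apply_apply, inner_smul_right] at h
    exact h
  have h3 := hfs.hasSum.prod_fiberwise h1
  have h4 : HasSum (fun p : ι × ℕ => f p.swap) (∑' p, f p) :=
    (Equiv.prodComm ι ℕ).hasSum_iff.2 hfs.hasSum
  rw [h3.tsum_eq]
  exact h4.prod_fiberwise h2

/-- The trace of a trace class operator can be computed in every Hilbert basis. -/
theorem IsTraceClass.hasSum {B : H →L[ℂ] H} (hB : IsTraceClass B) (e : HilbertBasis ι ℂ H) :
    HasSum (fun k => ⟪e k, B (e k)⟫_ℂ) (opTrace B) := by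
  obtain ⟨x, y, hs, hxy⟩ := hB
  obtain ⟨b, hb⟩ := (exists_hilbertBasis ℂ H).choose_spec
  have h := (hasSum_inner_apply b hs hxy).tsum_eq
  simp only [hb] at h
  have h' : opTrace B = ∑' n, ⟪x n, y n⟫_ℂ := h
  rw [h']
  exact hasSum_inner_apply e hs hxy

theorem isTraceClass_of_countable [Countable ι] {B : H →L[ℂ] H} {x y : ι → H}
    (hs : Summable fun k => ‖x k‖ * ‖y k‖)
    (hB : ∀ v : H, HasSum (fun k => ⟪x k, v⟫_ℂ • y k) (B v)) :
    IsTraceClass B := by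
  obtain ⟨f, hf⟩ := exists_injective_nat ι
  have hx : ∀ n ∉ Set.range f, Function.extend f x 0 n = 0 := fun n hn =>
    Function.extend_apply' _ _ _ hn
  refine ⟨Function.extend f x 0, Function.extend f y 0, ?_, fun v => ?_⟩
  · rw [← hf.summable_iff fun n hn => by rw [hx n hn, norm_zero, zero_mul]]
    refine hs.congr fun k => ?_
    simp [hf.extend_apply]
  · rw [← hf.hasSum_iff fun n hn => by rw [hx n hn, inner_zero_left, zero_smul]]
    refine (hB v).congr_fun fun k => ?_
    simp [hf.extend_apply]

variable (hD : Diagonalizes D e d)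

/-- The diagonal matrix entries of `T` in the eigenbasis. -/
def diagEntry (hD : Diagonalizes D e d) (T : SmoothOp D) (k : ι) : ℂ :=
  ⟪e k, (T ⟨e k, hD.basis_mem k⟩ : H)⟫_ℂ

theorem diagEntry_add (T S : SmoothOp D) (k : ι) :
    diagEntry hD (T + S) k = diagEntry hD T k + diagEntry hD S k := by
  simp only [diagEntry, LinearMap.add_apply, Submodule.coe_add, inner_add_right]

theorem diagEntry_sub (T S : SmoothOp D) (k : ι) :
    diagEntry hD (T - S) k = diagEntry hD T k - diagEntry hD S k := by
  simp only [diagEntry, LinearMap.sub_apply, Submodule.coe_sub, inner_sub_right]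

theorem diagEntry_one (k : ι) : diagEntry hD 1 k = 1 := by
  rw [diagEntry, Module.End.one_apply, inner_self_eq_norm_sq_to_K, e.orthonormal.1]
  simp

include hD in
theorem IsDiag.apply_basis {S : SmoothOp D} {c : ι → ℂ} (hS : IsDiag e S c) (k : ι) :
    S ⟨e k, hD.basis_mem k⟩ = c k • ⟨e k, hD.basis_mem k⟩ := by
  classical
  refine Subtype.ext (ext_inner_basis e fun j => ?_)
  rw [hS, Submodule.coe_smul, inner_smul_right]
  by_cases h : j = k
  · rw [h]
  · rw [e.orthonormal.2 h, mul_zero, mul_zero]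

theorem IsDiag.diagEntry_mul {S : SmoothOp D} {c : ι → ℂ} (hS : IsDiag e S c) (T : SmoothOp D)
    (k : ι) : diagEntry hD (T * S) k = diagEntry hD T k * c k := by
  rw [diagEntry, Module.End.mul_apply, hS.apply_basis hD, map_smul, Submodule.coe_smul,
    inner_smul_right, mul_comm]
  rfl

theorem IsDiag.mul_diagEntry {S : SmoothOp D} {c : ι → ℂ} (hS : IsDiag e S c) (T : SmoothOp D)
    (k : ι) : diagEntry hD (S * T) k = c k * diagEntry hD T k := by
  rw [diagEntry, Module.End.mul_apply, hS]
  rfl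

theorem IsBdd.exists_norm_diagEntry_le {T : SmoothOp D} (hT : IsBdd T) :
    ∃ C : ℝ, ∀ k, ‖diagEntry hD T k‖ ≤ C := by
  obtain ⟨B, hB⟩ := hT
  refine ⟨‖B‖, fun k => ?_⟩
  rw [diagEntry, ← hB]
  refine (norm_inner_le_norm _ _).trans ?_
  rw [e.orthonormal.1, one_mul]
  refine (B.le_opNorm _).trans ?_
  simp [e.orthonormal.1]

theorem HasTrace.hasSum {T : SmoothOp D} {z : ℂ} (h : HasTrace T z) :
    HasSum (diagEntry hD T) z := by
  obtain ⟨B, hB, htr, rfl⟩ := h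
  refine (htr.hasSum e).congr_fun fun k => ?_
  rw [diagEntry, ← hB]

include hD in
theorem HasTrace.unique {T : SmoothOp D} {z z' : ℂ} (h : HasTrace T z) (h' : HasTrace T z') :
    z = z' :=
  (h.hasSum hD).unique (h'.hasSum hD)

theorem Diagonalizes.hasTrace_mul [Countable ι] {X S : SmoothOp D} (hX : IsBdd X) {c : ι → ℂ}
    (hS : IsDiag e S c) (hc : Summable fun k => ‖c k‖) :
    HasTrace (X * S) (∑' k, diagEntry hD X k * c k) := by
  obtain ⟨B, hB⟩ := hX
  obtain ⟨G, hG⟩ := exists_diagonal_clm e fun k =>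
    hc.le_tsum k fun j _ => norm_nonneg (c j)
  have hBG : Extends (B.comp G) (X * S) := fun x => by
    have : G x = S x := ext_inner_basis e fun k => by rw [hG, hS]
    rw [ContinuousLinearMap.comp_apply, this, hB, Module.End.mul_apply]
  have htr : IsTraceClass (B.comp G) := by
    refine isTraceClass_of_countable (x := fun k => conj (c k) • e k) (y := fun k => B (e k))
      ?_ fun v => ?_
    · refine Summable.of_nonneg_of_le (fun k => by positivity) (fun k => ?_) (hc.mul_right ‖B‖)
      rw [norm_smul, RCLike.norm_conj, e.orthonormal.1, mul_one]
      have := B.le_opNorm (e k)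
      rw [e.orthonormal.1, mul_one] at this
      gcongr
    · refine ((hasSum_inner_smul e (G v)).mapL B).congr_fun fun k => ?_
      rw [map_smul, hG, inner_smul_left, Complex.conj_conj]
  have h : HasTrace (X * S) (opTrace (B.comp G)) := ⟨_, hBG, htr, rfl⟩
  have h1 := (h.hasSum hD).tsum_eq
  simp only [hS.diagEntry_mul hD] at h1
  rwa [← h1] at h

include hD in
/-- Summability of the eigenvalues of `|D| ^ (-s)` from the existence of its trace. -/
theorem Diagonalizes.isThreeSummable (hg : HasGap d)
    (h : ∀ s : ℝ, 3 < s → ∃ z, HasTrace (absPow D (-(s : ℂ))) z) : IsThreeSummable d := by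
  refine ⟨hg, fun σ hσ => ?_⟩
  obtain ⟨z, hz⟩ := h σ hσ
  have h1 := (hz.hasSum hD).summable.norm
  refine h1.congr fun k => ?_
  have h2 := (hD.isDiag_absPow hg (-(σ : ℂ))).diagEntry_mul hD 1 k
  rw [one_mul, diagEntry_one, one_mul] at h2
  rw [h2, norm_absCpow, Complex.neg_re, Complex.ofReal_re]

theorem IsThreeSummable.countable (hd : IsThreeSummable d) : Countable ι := by
  have h := (hd.summable 4 (by norm_num)).countable_support
  have h1 : Function.support (fun k => |invertedEigenvalue (d k)| ^ (-(4 : ℝ))) = Set.univ := by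
    refine Set.eq_univ_of_forall fun k => ?_
    exact (Real.rpow_pos_of_pos (abs_invertedEigenvalue_pos _) _).ne'
  rw [h1] at h
  exact Set.countable_univ_iff.1 h

theorem Diagonalizes.hasTrace_absPow (hd : IsThreeSummable d) {X : SmoothOp D} (hX : IsBdd X)
    {s : ℂ} (hs : 3 < s.re) :
    HasTrace (X * absPow D (-s)) (dirichlet d (diagEntry hD X) s) := by
  have := hd.countable
  refine hD.hasTrace_mul hX (hD.isDiag_absPow hd.gap (-s)) ?_
  refine (hd.summable _ hs).congr fun k => ?_
  rw [norm_absCpow, Complex.neg_re]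

/-- A zeta function of simple dimension spectrum continues the Dirichlet series of the diagonal
entries. -/
theorem Diagonalizes.isContinuation_of_isZeta (hd : IsThreeSummable d) {X : SmoothOp D}
    (hX : IsBdd X) {Z : ℂ → ℂ} (hZ : IsZeta D X Z)
    (ho : ∀ s : ℂ, ((-1 : ℤ) : WithTop ℤ) ≤ meromorphicOrderAt Z s) :
    IsContinuation d (diagEntry hD X) Z := by
  obtain ⟨hNF, r, hr⟩ := hZ
  obtain ⟨C, hC⟩ := hX.exists_norm_diagEntry_le hD
  refine ⟨hNF.meromorphicOn, ho, fun s hs => ?_⟩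
  have ha : ∀ z : ℂ, 3 < z.re → AnalyticAt ℂ (dirichlet d (diagEntry hD X)) z := fun z hz =>
    hd.analyticAt_dirichlet hC hz
  have h1 : Z =ᶠ[𝓝[≠] s] dirichlet d (diagEntry hD X) :=
    eventuallyEq_of_eq_of_lt_re (a := 3) (b := max r 3) (fun z _ => hNF.meromorphicOn z trivial)
      (fun z hz => (ha z hz).meromorphicAt)
      (fun z hz => (hr z ((le_max_left _ _).trans_lt hz)).unique hD
        (hD.hasTrace_absPow hd hX ((le_max_right _ _).trans_lt hz))) hs
  exact ((MeromorphicNFAt.eventuallyEq_nhdsNE_iff_eventuallyEq_nhds (hNF (Set.mem_univ s))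
    (ha s hs).meromorphicNFAt).1 h1).eq_of_nhds

theorem HasRes.hasNCInt (hd : IsThreeSummable d) {X : SmoothOp D} (hX : IsBdd X) {m r : ℂ}
    (h : HasRes d (diagEntry hD X) m r) : HasNCInt D (X * absPow D (-m)) r := by
  obtain ⟨Z, hZ, hr⟩ := h
  obtain ⟨C, hC⟩ := hX.exists_norm_diagEntry_le hD
  obtain ⟨Z', hNF, hval, heq⟩ := exists_meromorphicNFOn (Z := fun s => Z (s + m)) fun s _ =>
    meromorphicAt_comp_add (hZ.1 _ trivial)
  refine ⟨Z', ⟨hNF, 3 - m.re, fun s hs => ?_⟩, ?_⟩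
  · have hs' : 3 < (s + m).re := by rw [Complex.add_re]; linarith
    have ha : AnalyticAt ℂ (fun s => Z (s + m)) s :=
      AnalyticAt.comp_of_eq (g := Z) (f := fun s => s + m)
        (hZ.analyticAt_dirichlet hd hC hs') (by fun_prop) rfl
    rw [hval s ha, hZ.3 _ hs', mul_assoc, ← hD.absPow_add hd.gap,
      show -m + -s = -(s + m) by ring]
    exact hD.hasTrace_absPow hd hX hs'
  · refine HasSimpleResidue.congr ?_ (heq 0).symm
    exact HasSimpleResidue.comp_add (by rwa [zero_add])

include hD in
theorem HasNCInt.unique {T : SmoothOp D} {r r' : ℂ} (h : HasNCInt D T r) (h' : HasNCInt D T r') :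
    r = r' := by
  obtain ⟨Z, ⟨hNF, a, ha⟩, hr⟩ := h
  obtain ⟨Z', ⟨hNF', a', ha'⟩, hr'⟩ := h'
  have h1 : Z =ᶠ[𝓝[≠] 0] Z' :=
    eventuallyEq_of_eq_of_lt_re (a := -1) (b := max a a')
      (fun z _ => hNF.meromorphicOn z trivial) (fun z _ => hNF'.meromorphicOn z trivial)
      (fun z hz => (ha z ((le_max_left _ _).trans_lt hz)).unique hD
        (ha' z ((le_max_right _ _).trans_lt hz))) (by simp)
  exact (hr.congr h1).unique hr'

include hD in
theorem HasNCInt.ncInt_eq {T : SmoothOp D} {r : ℂ} (h : HasNCInt D T r) : ncInt D T = r := by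
  have hex : ∃ r, HasNCInt D T r := ⟨r, h⟩
  rw [ncInt, dif_pos hex]
  exact hex.choose_spec.unique hD h

end Traces

/-! ### Perturbation by an operator of order zero -/

section Perturbation

variable {H : Type u} [NormedAddCommGroup H] [InnerProductSpace ℂ H] [CompleteSpace H]
  {ι ι' : Type*} {D D' : H →ₗ.[ℂ] H} {e : HilbertBasis ι ℂ H} {d : ι → ℝ}
  {f : HilbertBasis ι' ℂ H} {l : ι' → ℝ}

/-- Only finitely many eigenvalues are near `0`, and `invertedEigenvalue` never vanishes. -/
theorem hasGap_of_finite (h : ∀ M : ℝ, {k | |d k| ≤ M}.Finite) : HasGap d := by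
  obtain ⟨c, hc, hcd⟩ : ∃ c : ℝ, 0 < c ∧ ∀ k, |d k| ≤ 1 → c ≤ |invertedEigenvalue (d k)| := by
    by_cases hne : {k | |d k| ≤ 1}.Nonempty
    · obtain ⟨k₀, _, hk⟩ := Set.exists_min_image _ (fun k => |invertedEigenvalue (d k)|) (h 1) hne
      exact ⟨_, abs_invertedEigenvalue_pos (d k₀), fun k hk1 => hk k hk1⟩
    · exact ⟨1, one_pos, fun k hk => (hne ⟨k, hk⟩).elim⟩
  refine ⟨min c 1, lt_min hc one_pos, fun k => ?_⟩
  by_cases hk : |d k| ≤ 1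
  · exact (min_le_left _ _).trans (hcd k hk)
  · have h0 : d k ≠ 0 := fun h0 => hk (by simp [h0])
    rw [invertedEigenvalue, if_neg h0]
    exact (min_le_right _ _).trans (not_le.1 hk).le

theorem domPow_succ_le (D : H →ₗ.[ℂ] H) (n : ℕ) : domPow D (n + 1) ≤ domPow D n := by
  induction n with
  | zero => exact le_top
  | succ n ih =>
    intro x hx
    obtain ⟨h, hx'⟩ := mem_domPow_succ.1 hx
    exact mem_domPow_succ.2 ⟨h, ih hx'⟩

theorem mem_domPow_succ_graph {n : ℕ} {x : H} :
    x ∈ domPow D (n + 1) ↔ ∃ y, (x, y) ∈ D.graph ∧ y ∈ domPow D n := by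
  rw [mem_domPow_succ]
  constructor
  · rintro ⟨h, hx⟩
    exact ⟨_, mem_graph_iff'.2 ⟨h, rfl⟩, hx⟩
  · rintro ⟨y, hy, hx⟩
    obtain ⟨h, rfl⟩ := mem_graph_iff'.1 hy
    exact ⟨h, hx⟩

theorem selfOp_mem_graph (x : smoothVectors D) : ((x : H), (selfOp D x : H)) ∈ D.graph :=
  mem_graph_iff'.2 ⟨smoothVectors_le_domain D x.2, rfl⟩

/-- If `T` and `[D, T]` are bounded, the bounded extension of `T` preserves the domain of `D`, and
the commutator formula persists there. -/
theorem Diagonalizes.mem_graph_apply (hD : Diagonalizes D e d) {T : SmoothOp D} {B B' : H →L[ℂ] H}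
    (hB : Extends B T) (hB' : Extends B' (selfOp D * T - T * selfOp D)) {x y : H}
    (h : (x, y) ∈ D.graph) : (B x, B y + B' x) ∈ D.graph := by
  refine (hD _ _).2 fun k => ?_
  have hx := hasSum_inner_smul e x
  have hy := hasSum_inner_smul e y
  have h1 := (hx.mapL B).mapL (innerSL ℂ (e k))
  have h2 := ((hy.mapL B).mapL (innerSL ℂ (e k))).add ((hx.mapL B').mapL (innerSL ℂ (e k)))
  simp only [map_smul, innerSL_apply_apply, smul_eq_mul] at h1 h2
  rw [inner_add_right]
  refine h2.unique ((h1.mul_left (d k : ℂ)).congr_fun fun j => ?_)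
  set v : smoothVectors D := ⟨e j, hD.basis_mem j⟩ with hv
  have e1 : B (e j) = T v := hB v
  have e2 : B' (e j) = selfOp D (T v) - T (selfOp D v) := hB' v
  have e3 : selfOp D v = (d j : ℂ) • v := hD.isDiag_selfOp.apply_basis hD j
  rw [(hD _ _).1 h, e2, e1, e3, inner_sub_right, map_smul, Submodule.coe_smul, inner_smul_right,
    hD.isDiag_selfOp (T v) k]
  ring

/-- Operators of order zero preserve the domains of all powers of `D`. The induction runs over all
tame operators at once, as the commutator with `D` enters. -/
theorem Diagonalizes.apply_mem_domPow (hD : Diagonalizes D e d) (hg : HasGap d) (n : ℕ) :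
    ∀ {T : SmoothOp D} {B : H →L[ℂ] H}, IsTame T → Extends B T →
      ∀ x ∈ domPow D n, B x ∈ domPow D n := by
  induction n with
  | zero => exact fun _ _ _ _ => Submodule.mem_top
  | succ n ih =>
    intro T B hT hB x hx
    obtain ⟨y, hxy, hy⟩ := mem_domPow_succ_graph.1 hx
    have hT' := hD.isTame_commutator hg hT
    obtain ⟨B', hB'⟩ := hT'.op.isBdd
    exact mem_domPow_succ_graph.2 ⟨_, hD.mem_graph_apply hB hB' hxy,
      add_mem (ih hT hB y hy) (ih hT' hB' x (domPow_succ_le D n hx))⟩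

/-- A perturbation of `D` by an operator of order zero has the same smooth vectors. -/
theorem Diagonalizes.smoothVectors_vadd (hD : Diagonalizes D e d) (hg : HasGap d)
    {T : SmoothOp D} {B : H →L[ℂ] H} (hT : IsTame T) (hB : Extends B T) :
    smoothVectors ((B : H →ₗ[ℂ] H) +ᵥ D) = smoothVectors D := by
  have h : ∀ n, domPow ((B : H →ₗ[ℂ] H) +ᵥ D) n = domPow D n := by
    intro n
    induction n with
    | zero => rfl
    | succ n ih =>
      ext x
      rw [mem_domPow_succ_graph, mem_domPow_succ_graph, ih]
      constructor
      · rintro ⟨y, hxy, hy⟩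
        have hx : x ∈ domPow D n := by
          rw [← ih]
          refine domPow_succ_le _ n (mem_domPow_succ_graph.2 ⟨y, hxy, ?_⟩)
          rwa [ih]
        exact ⟨_, mem_graph_vadd.1 hxy, sub_mem hy (hD.apply_mem_domPow hg n hT hB x hx)⟩
      · rintro ⟨y, hxy, hy⟩
        have hx : x ∈ domPow D n := domPow_succ_le _ n (mem_domPow_succ_graph.2 ⟨y, hxy, hy⟩)
        refine ⟨y + B x, mem_graph_vadd.2 ?_, add_mem hy (hD.apply_mem_domPow hg n hT hB x hx)⟩
        rwa [add_sub_cancel_right]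
  unfold smoothVectors
  simp_rw [h]

/-- The map `T ↦ T D - (D + A) T`, which multiplies the matrix entries of `T` between eigenvectors
of `D + A` and of `D` by the differences of the eigenvalues. -/
def intertwine (A T : SmoothOp D) : SmoothOp D := T * selfOp D - selfOp D * T - A * T

theorem Diagonalizes.isTame_intertwine_iterate (hD : Diagonalizes D e d) (hg : HasGap d)
    {A T : SmoothOp D} (hA : IsTame A) (hT : IsTame T) (n : ℕ) :
    IsTame ((intertwine A)^[n] T) := by
  induction n with
  | zero => exact hT
  | succ n ih =>
    rw [Function.iterate_succ_apply']
    have h : intertwine A ((intertwine A)^[n] T) =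
        (0 - (selfOp D * ((intertwine A)^[n] T) - ((intertwine A)^[n] T) * selfOp D)) -
          A * ((intertwine A)^[n] T) := by
      rw [zero_sub, neg_sub, intertwine]
    have h0 : IsTame (0 : SmoothOp D) := by
      have := (IsTame.one (D := D)).sub IsTame.one
      rwa [sub_self] at this
    rw [h]
    exact (h0.sub (hD.isTame_commutator hg ih)).sub (hA.mul ih)

variable (hD : Diagonalizes D e d) {B : H →L[ℂ] H}
  (hB : Diagonalizes ((B : H →ₗ[ℂ] H) +ᵥ D) f l) {A : SmoothOp D} (hA : Extends B A)
include hB hA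

/-- The eigenvalue equations of `D` and of `D + A` turn `intertwine A` into multiplication of the
matrix entries by `d k - l i`. -/
theorem inner_intertwine (T : SmoothOp D) (n : ℕ) (i : ι') (k : ι) :
    ⟪f i, ((intertwine A)^[n] T ⟨e k, hD.basis_mem k⟩ : H)⟫_ℂ =
      ((d k - l i : ℝ) : ℂ) ^ n * ⟪f i, (T ⟨e k, hD.basis_mem k⟩ : H)⟫_ℂ := by
  induction n with
  | zero => simp
  | succ n ih =>
    rw [Function.iterate_succ_apply', pow_succ, mul_right_comm, ← ih]
    generalize (intertwine A)^[n] T = S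
    set v : smoothVectors D := ⟨e k, hD.basis_mem k⟩ with hv
    have e3 : selfOp D v = (d k : ℂ) • v := hD.isDiag_selfOp.apply_basis hD k
    have e1 : ((S v : H), (selfOp D (S v) : H) + B (S v)) ∈ ((B : H →ₗ[ℂ] H) +ᵥ D).graph := by
      rw [mem_graph_vadd, add_sub_cancel_right]
      exact selfOp_mem_graph _
    have e2 := (hB _ _).1 e1 i
    rw [hA, inner_add_right] at e2
    simp only [intertwine, LinearMap.sub_apply, Module.End.mul_apply, e3, map_smul,
      Submodule.coe_sub, Submodule.coe_smul, inner_sub_right, inner_smul_right]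
    push_cast
    linear_combination -e2

/-- The weights `⟨X eₖ, fᵢ⟩ ⟨fᵢ, Y eₖ⟩` that connect the eigenbasis `e` of `D` with the eigenbasis
`f` of the perturbation. -/
def pairWeight (hD : Diagonalizes D e d) (f : HilbertBasis ι' ℂ H) (X Y : SmoothOp D)
    (i : ι') (k : ι) : ℂ :=
  ⟪(X ⟨e k, hD.basis_mem k⟩ : H), f i⟫_ℂ * ⟪f i, (Y ⟨e k, hD.basis_mem k⟩ : H)⟫_ℂ

/-- Bessel's inequality for the bounded operator `(intertwine A)^[n] T`. -/
theorem sum_norm_inner_mul_pow_le (hg : HasGap d) (hA' : IsTame A) {T : SmoothOp D}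
    (hT : IsTame T) (n : ℕ) : ∃ C : ℝ, ∀ (k : ι) (s : Finset ι'),
      ∑ i ∈ s, ‖⟪f i, (T ⟨e k, hD.basis_mem k⟩ : H)⟫_ℂ‖ ^ 2 * |l i - d k| ^ (2 * n) ≤ C := by
  obtain ⟨B', hB'⟩ := (hD.isTame_intertwine_iterate hg hA' hT n).op.isBdd
  refine ⟨‖B'‖ ^ 2, fun k s => ?_⟩
  have h1 : ∀ i, ‖⟪f i, (T ⟨e k, hD.basis_mem k⟩ : H)⟫_ℂ‖ ^ 2 * |l i - d k| ^ (2 * n) =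
      ‖⟪f i, B' (e k)⟫_ℂ‖ ^ 2 := fun i => by
    have h2 := inner_intertwine hD hB hA T n i k
    have h3 := hB' ⟨e k, hD.basis_mem k⟩
    rw [← h3] at h2
    change ⟪f i, B' (e k)⟫_ℂ = _ at h2
    rw [h2, norm_mul, norm_pow, Complex.norm_real, Real.norm_eq_abs, abs_sub_comm]
    ring
  simp_rw [h1]
  calc ∑ i ∈ s, ‖⟪f i, B' (e k)⟫_ℂ‖ ^ 2 ≤ ∑' i, ‖⟪f i, B' (e k)⟫_ℂ‖ ^ 2 :=
        (summable_norm_inner_sq f _).sum_le_tsum s fun i _ => by positivity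
    _ = ‖B' (e k)‖ ^ 2 := tsum_norm_inner_sq f _
    _ ≤ ‖B'‖ ^ 2 := by
        have := B'.le_opNorm (e k)
        rw [e.orthonormal.1, mul_one] at this
        gcongr

/-- The weights decay faster than any power of `|l i - d k|`, uniformly in `k`. -/
theorem hasMoments_pairWeight (hg : HasGap d) (hA' : IsTame A) {X Y : SmoothOp D} (hX : IsTame X)
    (hY : IsTame Y) : HasMoments (pairWeight hD f X Y) l d := by
  intro m
  obtain ⟨C₁, h₁⟩ := sum_norm_inner_mul_pow_le hD hB hA hg hA' hX 0
  obtain ⟨C₂, h₂⟩ := sum_norm_inner_mul_pow_le hD hB hA hg hA' hX m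
  obtain ⟨C₃, h₃⟩ := sum_norm_inner_mul_pow_le hD hB hA hg hA' hY 0
  obtain ⟨C₄, h₄⟩ := sum_norm_inner_mul_pow_le hD hB hA hg hA' hY m
  refine ⟨2 ^ m * (C₁ + C₂ + (C₃ + C₄)), fun k s => ?_⟩
  refine le_trans ?_ (mul_le_mul_of_nonneg_left
    (add_le_add (add_le_add (h₁ k s) (h₂ k s)) (add_le_add (h₃ k s) (h₄ k s))) (by positivity))
  simp only [← Finset.sum_add_distrib, Finset.mul_sum]
  refine Finset.sum_le_sum fun i _ => ?_
  rw [pairWeight, norm_mul, norm_inner_symm]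
  set a := ‖⟪f i, (X ⟨e k, hD.basis_mem k⟩ : H)⟫_ℂ‖
  set b := ‖⟪f i, (Y ⟨e k, hD.basis_mem k⟩ : H)⟫_ℂ‖
  set t := |l i - d k| with ht
  have ht0 : 0 ≤ t := abs_nonneg _
  have hp : (1 + t) ^ m ≤ 2 ^ m * (1 + t ^ (2 * m)) := by
    rcases le_total t 1 with h | h
    · calc (1 + t) ^ m ≤ 2 ^ m := pow_le_pow_left₀ (by linarith) (by linarith) m
        _ ≤ _ := le_mul_of_one_le_right (by positivity) (by simp; positivity)
    · calc (1 + t) ^ m ≤ (2 * t) ^ m := pow_le_pow_left₀ (by linarith) (by linarith) m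
        _ = 2 ^ m * t ^ m := mul_pow _ _ _
        _ ≤ 2 ^ m * (1 + t ^ (2 * m)) := by
            gcongr
            have : t ^ m ≤ t ^ (2 * m) := pow_le_pow_right₀ h (by omega)
            linarith
  have hab : a * b ≤ a ^ 2 + b ^ 2 := by nlinarith [sq_nonneg (a - b), sq_nonneg a, sq_nonneg b]
  calc a * b * (1 + t) ^ m ≤ (a ^ 2 + b ^ 2) * (2 ^ m * (1 + t ^ (2 * m))) := by gcongr
    _ = _ := by ring

/-- The moments of the weights are matrix entries of the iterates of `intertwine`. -/
theorem signedMoment_pairWeight (X Y : SmoothOp D) (j : ℕ) (k : ι) :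
    signedMoment (pairWeight hD f X Y) l d j k = (eigenSign (d k) : ℂ) ^ j *
      ⟪(X ⟨e k, hD.basis_mem k⟩ : H), ((intertwine A)^[j] Y ⟨e k, hD.basis_mem k⟩ : H)⟫_ℂ := by
  rw [signedMoment, ← (f.hasSum_inner_mul_inner _ _).tsum_eq, ← tsum_mul_left]
  refine tsum_congr fun i => ?_
  rw [inner_intertwine hD hB hA, pairWeight, Complex.ofReal_mul, mul_pow]
  ring

end Perturbation

/-! ### Zeta functions of the perturbation -/

section PerturbedZeta

variable {H : Type u} [NormedAddCommGroup H] [InnerProductSpace ℂ H] [CompleteSpace H]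
  {ι ι' : Type*} {D D' : H →ₗ.[ℂ] H} {e : HilbertBasis ι ℂ H} {d : ι → ℝ}
  {f : HilbertBasis ι' ℂ H} {l : ι' → ℝ}

theorem hasSum_swap {α β : Type*} {F : α × β → ℂ} {a : ℂ} (h : HasSum F a) :
    HasSum (fun q : β × α => F (q.2, q.1)) a :=
  (Equiv.prodComm β α).hasSum_iff.2 h

theorem Diagonalizes.zero_vadd (hD : Diagonalizes D e d) :
    Diagonalizes (((0 : H →L[ℂ] H) : H →ₗ[ℂ] H) +ᵥ D) e d := fun x y => by
  rw [mem_graph_vadd, ← hD x y, zero_apply, sub_zero]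

/-- `T` is symmetric on smooth vectors. -/
def IsSymm (T : SmoothOp D) : Prop :=
  ∀ x y : smoothVectors D, ⟪(T x : H), (y : H)⟫_ℂ = ⟪(x : H), (T y : H)⟫_ℂ

theorem IsSymm.add {T S : SmoothOp D} (hT : IsSymm T) (hS : IsSymm S) : IsSymm (T + S) :=
  fun x y => by
    simp only [LinearMap.add_apply, Submodule.coe_add, inner_add_left, inner_add_right, hT x y,
      hS x y]

theorem diagEntry_commutator (hD : Diagonalizes D e d) (T : SmoothOp D) (k : ι) :
    diagEntry hD (selfOp D * T - T * selfOp D) k = 0 := by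
  rw [diagEntry_sub, hD.isDiag_selfOp.mul_diagEntry hD, hD.isDiag_selfOp.diagEntry_mul hD]
  ring

/-- The trace property makes the noncommutative integral of `[D, X] Y F |D| ^ (-3)` vanish if `X`
and `Y` commute: the double series with weights `⟨X eₖ, eᵢ⟩ ⟨eᵢ, Y eₖ⟩` has the same sum with
`|dₖ| ^ (-s)` in place of `|dᵢ| ^ (-s)`, and its first moments belong to this operator. -/
theorem Diagonalizes.hasRes_commutator_mul (hD : Diagonalizes D e d) (hd : IsThreeSummable d)
    {X Y : SmoothOp D} (hX : IsTame X) (hY : IsTame Y) (hXs : IsSymm X) (hYs : IsSymm Y)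
    (hXY : Commute X Y) {Z : ℂ → ℂ}
    (hZ : IsContinuation d (diagEntry hD ((selfOp D * X - X * selfOp D) * Y * signOp D)) Z) :
    HasRes d (diagEntry hD ((selfOp D * X - X * selfOp D) * Y * signOp D)) 3 0 := by
  have hE : Extends (0 : H →L[ℂ] H) (0 : SmoothOp D) := fun x => rfl
  have h0 : IsTame (0 : SmoothOp D) := by
    have := (IsTame.one (D := D)).sub IsTame.one
    rwa [sub_self] at this
  set w := pairWeight hD e X Y with hwdef
  have hw : HasMoments w d d := hasMoments_pairWeight hD hD.zero_vadd hE hd.gap h0 hX hY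
  have hm := signedMoment_pairWeight hD hD.zero_vadd hE X Y
  have hm0 : ∀ k, signedMoment w d d 0 k = diagEntry hD (X * Y) k := fun k => by
    rw [hm, pow_zero, one_mul, diagEntry, Function.iterate_zero_apply, Module.End.mul_apply, hXs]
  have hm1 : ∀ k, signedMoment w d d 1 k =
      diagEntry hD ((selfOp D * X - X * selfOp D) * Y * signOp D) k := fun k => by
    rw [hm, pow_one, Function.iterate_one, (hD.isDiag_signOp hd.gap).diagEntry_mul hD, mul_comm,
      hXs]
    congr 1
    change diagEntry hD (X * intertwine 0 Y) k = _
    have h1 : (selfOp D * X - X * selfOp D) * Y = X * intertwine 0 Y +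
        (selfOp D * (X * Y) - (X * Y) * selfOp D) := by
      rw [intertwine, zero_mul, sub_zero]
      simp only [mul_sub, sub_mul, mul_assoc]; abel
    rw [h1, diagEntry_add, diagEntry_commutator, add_zero]
  have hf1 : signedMoment w d d 1 =
      diagEntry hD ((selfOp D * X - X * selfOp D) * Y * signOp D) := funext hm1
  rw [← hf1] at hZ ⊢
  refine hasRes_signedMoment_one_eq_zero hw hd hd.gap hZ fun s hs => ?_
  have hs' := summable_remSeries hw hd hd.gap 0 s s 0 (by simpa using hs)
  have h2 := hasSum_swap hs'.hasSum
  have h3 : ∀ i, HasSum (fun k => w i k * taylorRem 0 s (d k) (d i) *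
      absCpow (d k) (s - s - (0 : ℝ))) (diagEntry hD (X * Y) i * absCpow (d i) (-s)) := by
    intro i
    have h4 := e.hasSum_inner_mul_inner (Y ⟨e i, hD.basis_mem i⟩ : H) (X ⟨e i, hD.basis_mem i⟩ : H)
    have h5 : ⟪(Y ⟨e i, hD.basis_mem i⟩ : H), (X ⟨e i, hD.basis_mem i⟩ : H)⟫_ℂ =
        diagEntry hD (X * Y) i := by
      rw [hXY.eq, hYs]
      rfl
    rw [h5] at h4
    have h5 := h4.mul_right (absCpow (d i) (-s))
    refine HasSum.congr_fun h5 ?_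
    intro k
    have h6 := hYs ⟨e i, hD.basis_mem i⟩ ⟨e k, hD.basis_mem k⟩
    have h7 := hXs ⟨e k, hD.basis_mem k⟩ ⟨e i, hD.basis_mem i⟩
    simp only at h6 h7
    rw [h6, ← h7, hwdef, pairWeight]
    simp only [taylorRem, Finset.range_zero, Finset.sum_empty, sub_zero, sub_self,
      Complex.ofReal_zero, absCpow_zero]
    ring
  have h4 := (h2.prod_fiberwise h3).tsum_eq
  refine h4.symm.trans (tsum_congr fun k => ?_)
  rw [hm0]

theorem exists_end_of_eq {V V' : Submodule ℂ H} (h : V' = V) (S : Module.End ℂ V') :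
    ∃ S' : Module.End ℂ V, ∀ x : V, (S' x : H) = S ⟨x, h.ge x.2⟩ := by
  subst h
  exact ⟨S, fun x => rfl⟩

/-- An operator on the smooth vectors of `D'` is also one on those of `D` if the spaces agree. -/
theorem restr_of_smoothVectors_eq (h : smoothVectors D' = smoothVectors D) {T : H → H}
    {S : SmoothOp D'} (hS : ∀ x : smoothVectors D', (S x : H) = T x) (x : smoothVectors D) :
    (restr D T x : H) = S ⟨x, h.ge x.2⟩ := by
  obtain ⟨S', hS'⟩ := exists_end_of_eq h S
  have h2 : restr D T = S' := restr_eq S' fun x => by rw [hS', hS]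
  rw [h2, hS']

variable (hD : Diagonalizes D e d) {B : H →L[ℂ] H}
  (hB : Diagonalizes ((B : H →ₗ[ℂ] H) +ᵥ D) f l) {A : SmoothOp D} (hA : Extends B A)
  (hA' : IsTame A) (hd : IsThreeSummable d) (hl : HasGap l)

theorem pairWeight_one (i : ι') (k : ι) :
    pairWeight hD f 1 1 i k = ⟪e k, f i⟫_ℂ * ⟪f i, e k⟫_ℂ := rfl

include hD hB hA hA' hd hl

/-- Summation over `k` first: `∑ₖ |⟨fᵢ, eₖ⟩|² = 1`. -/
theorem hasSum_remSeries_perturbed {s : ℂ} (hs : 3 < s.re) :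
    HasSum (fun i => absCpow (l i) (-s)) (remSeries (pairWeight hD f 1 1) l d id 0 0 s) := by
  have hw := hasMoments_pairWeight hD hB hA hd.gap hA' IsTame.one IsTame.one
  have hs' := summable_remSeries hw hd hl 0 s s 0 (by simpa using hs)
  have h2 := hasSum_swap hs'.hasSum
  refine HasSum.prod_fiberwise h2 ?_
  intro i
  have h4 := e.hasSum_inner_mul_inner (f i) (f i)
  rw [inner_self_eq_norm_sq_to_K, f.orthonormal.1] at h4
  have h5 := h4.mul_right (absCpow (l i) (-s))
  simp only [RCLike.ofReal_one, one_pow, one_mul] at h5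
  refine HasSum.congr_fun h5 ?_
  intro k
  rw [pairWeight_one]
  simp only [taylorRem, Finset.range_zero, Finset.sum_empty, sub_zero, sub_self,
    Complex.ofReal_zero, absCpow_zero]
  ring

/-- The eigenvalues of the perturbation satisfy the same summability condition. -/
theorem isThreeSummable_perturbed : IsThreeSummable l := by
  refine ⟨hl, fun σ hσ => ?_⟩
  have h := (hasSum_remSeries_perturbed hD hB hA hA' hd hl (s := σ) (by simpa using hσ)).summable
  refine h.norm.congr fun i => ?_
  rw [norm_absCpow, Complex.neg_re, Complex.ofReal_re]

theorem hasTrace_perturbed {s : ℂ} (hs : 3 < s.re) :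
    HasTrace (1 * absPow ((B : H →ₗ[ℂ] H) +ᵥ D) (-s))
      (remSeries (pairWeight hD f 1 1) l d id 0 0 s) := by
  have hl' := isThreeSummable_perturbed hD hB hA hA' hd hl
  have h := hB.hasTrace_absPow hl' IsBdd.one hs
  have h2 := hasSum_remSeries_perturbed hD hB hA hA' hd hl hs
  have e1 : dirichlet l (diagEntry hB 1) s =
      remSeries (pairWeight hD f 1 1) l d id 0 0 s := by
    rw [dirichlet, ← h2.tsum_eq]
    exact tsum_congr fun i => by rw [diagEntry_one, one_mul]
  rwa [e1] at h

/-- The complex powers of the modulus of the perturbation, on the smooth vectors of `D`. -/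
theorem inner_perturbed_absPow (z : ℂ) (x : smoothVectors D) (i : ι') :
    ⟪f i, (restr D (absPowFun ((B : H →ₗ[ℂ] H) +ᵥ D) z) x : H)⟫_ℂ =
      absCpow (l i) z * ⟪f i, (x : H)⟫_ℂ := by
  have h1 := hB.absPow_spec hl z
  rw [restr_of_smoothVectors_eq (hD.smoothVectors_vadd hd.gap hA' hA) h1.1]
  exact h1.2 _ i

theorem isBdd_perturbed_absPow {m : ℝ} (hm : 0 ≤ m) :
    IsBdd (restr D (absPowFun ((B : H →ₗ[ℂ] H) +ᵥ D) (-(m : ℂ)))) := by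
  obtain ⟨c, hc, hcl⟩ := hl
  obtain ⟨G, hG⟩ := exists_diagonal_clm f (c := fun i => absCpow (l i) (-(m : ℂ))) (C := c ^ (-m))
    fun i => by
      rw [norm_absCpow, Complex.neg_re, Complex.ofReal_re]
      exact Real.rpow_le_rpow_of_nonpos hc (hcl i) (by linarith)
  exact ⟨G, fun x => ext_inner_basis f fun i => by
    rw [hG, inner_perturbed_absPow hD hB hA hA' hd ⟨c, hc, hcl⟩]⟩

/-- The trace of `|D_Φ| ^ (-m) |D| ^ (-s)`, as a double series over the eigenbases. -/
theorem hasTrace_perturbed_absPow {m : ℝ} (hm : 0 ≤ m) {s : ℂ} (hs : 3 < s.re) :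
    HasTrace (restr D (absPowFun ((B : H →ₗ[ℂ] H) +ᵥ D) (-(m : ℂ))) * absPow D (-s))
      (remSeries (pairWeight hD f 1 1) l d (fun _ => (m : ℂ)) m 0 s) := by
  have hw := hasMoments_pairWeight hD hB hA hd.gap hA' IsTame.one IsTame.one
  have hs' := summable_remSeries hw hd hl 0 m s m (by simp; linarith)
  have h := hD.hasTrace_absPow hd (isBdd_perturbed_absPow hD hB hA hA' hd hl hm) hs
  have e1 : remSeries (pairWeight hD f 1 1) l d (fun _ => (m : ℂ)) m 0 s = dirichlet d
      (diagEntry hD (restr D (absPowFun ((B : H →ₗ[ℂ] H) +ᵥ D) (-(m : ℂ))))) s := by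
    rw [remSeries, hs'.tsum_prod, dirichlet]
    refine tsum_congr fun k => ?_
    rw [diagEntry, ← (f.hasSum_inner_mul_inner _ _).tsum_eq, ← tsum_mul_right]
    refine tsum_congr fun i => ?_
    rw [inner_perturbed_absPow hD hB hA hA' hd hl, pairWeight_one]
    simp only [taylorRem, Finset.range_zero, Finset.sum_empty, sub_zero]
    rw [show (m : ℂ) - s - m = -s by ring]
    ring
  rwa [e1]

variable {Zj : ℕ → ℂ → ℂ}
  (hZ : ∀ j, IsContinuation d (signedMoment (pairWeight hD f 1 1) l d j) (Zj j))
include hZ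

/-- The noncommutative integrals of the powers of the perturbation. -/
theorem hasNCInt_perturbed {m : ℝ} (hm : 0 ≤ m) {r : ℕ → ℂ}
    (hr : ∀ j < 4, HasRes d (signedMoment (pairWeight hD f 1 1) l d j) ((m : ℂ) + j) (r j)) :
    HasNCInt D (restr D (absPowFun ((B : H →ₗ[ℂ] H) +ᵥ D) (-(m : ℂ))))
      (∑ j ∈ Finset.range 4, negBinom j m * r j) := by
  have hw := hasMoments_pairWeight hD hB hA hd.gap hA' IsTame.one IsTame.one
  have hu : Differentiable ℂ fun _ : ℂ => (m : ℂ) := differentiable_const _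
  obtain ⟨Z, hNF, h1, h2⟩ := exists_continuation_remSeries hw hd hl m hZ hu
  refine ⟨Z, ⟨hNF, 3, fun s hs => ?_⟩, ?_⟩
  · rw [h1 s (by linarith)]
    exact hasTrace_perturbed_absPow hD hB hA hA' hd hl hm hs
  · refine hasSimpleResidue_of_partialExpansion hw hd hl m hZ hu (s := 0)
      (by simp; linarith) (h2 4 0 (by simp; linarith)) fun j hj => ?_
    rw [zero_add]
    exact hr j hj

/-- The zeta function of the perturbation, its residues, and its difference from the zeta function
of `D` at `0`. -/
theorem exists_isZeta_perturbed : ∃ ZΦ : ℂ → ℂ, IsZeta ((B : H →ₗ[ℂ] H) +ᵥ D) 1 ZΦ ∧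
    (∀ (m : ℝ) (r : ℕ → ℂ), 0 ≤ m →
      (∀ j < 4, HasRes d (signedMoment (pairWeight hD f 1 1) l d j) ((m : ℂ) + j) (r j)) →
      HasSimpleResidue ZΦ m (∑ j ∈ Finset.range 4, negBinom j m * r j)) ∧
    ∀ r : ℕ → ℂ,
      (∀ j < 3, HasRes d (signedMoment (pairWeight hD f 1 1) l d (j + 1)) ((j + 1 : ℕ) : ℂ) (r j)) →
      Tendsto (fun s => ZΦ s - Zj 0 s) (𝓝[≠] 0) (𝓝 (r 0 + r 1 / 2 + r 2 / 3)) := by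
  have hw := hasMoments_pairWeight hD hB hA hd.gap hA' IsTame.one IsTame.one
  obtain ⟨Z, hNF, h1, h2⟩ := exists_continuation_remSeries hw hd hl 0 hZ differentiable_id
  refine ⟨Z, ⟨hNF, 3, fun s hs => ?_⟩, fun m r hm hr => ?_, fun r hr => ?_⟩
  · rw [h1 s (by linarith)]
    exact hasTrace_perturbed hD hB hA hA' hd hl hs
  · refine hasSimpleResidue_of_partialExpansion hw hd hl 0 hZ differentiable_id (s := m)
      (by simp; linarith) (h2 4 m (by simp; linarith)) fun j hj => ?_
    rw [Complex.ofReal_zero, zero_add]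
    exact hr j hj
  · have h3 : Z =ᶠ[𝓝[≠] 0] _ := h2 4 0 (by norm_num)
    -- the remainder vanishes at `0`, where `|l| ^ (-s)` is constant in `l`
    have hR : remSeries (pairWeight hD f 1 1) l d id 0 4 0 = 0 := by
      rw [remSeries]
      refine (tsum_congr fun q => ?_).trans tsum_zero
      have : taylorRem 4 (id (0 : ℂ)) (d q.1) (l q.2) = 0 := by
        simp [taylorRem, Finset.sum_range_succ, negBinom, Finset.prod_range_succ, absCpow_zero]
      rw [this, mul_zero, zero_mul]
    have h4 : Tendsto (remSeries (pairWeight hD f 1 1) l d id 0 4) (𝓝[≠] 0) (𝓝 0) := by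
      have := (analyticAt_remSeries hw hd hl differentiable_id 0 4 (s₀ := 0)
        (by norm_num)).continuousAt.tendsto
      rw [hR] at this
      exact this.mono_left nhdsWithin_le_nhds
    -- the coefficient is `z` times `negBinom j (z + 1) / (j + 1)`, and `z` cancels the simple pole
    have h5 : ∀ j < 3, Tendsto (fun z : ℂ => negBinom (j + 1) z * Zj (j + 1) (z + (j + 1 : ℕ)))
        (𝓝[≠] 0) (𝓝 (negBinom j 1 / (j + 1) * r j)) := by
      intro j hj
      have e1 : Tendsto (fun z : ℂ => negBinom j (z + 1) / (j + 1)) (𝓝[≠] 0)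
          (𝓝 (negBinom j 1 / (j + 1))) := by
        have hc : Continuous fun z : ℂ => negBinom j (z + 1) / (j + 1) :=
          ((differentiable_negBinom j).continuous.comp
            (continuous_id.add continuous_const)).div_const _
        have := hc.tendsto 0
        rw [zero_add] at this
        exact this.mono_left nhdsWithin_le_nhds
      have e2 : HasSimpleResidue (fun z => Zj (j + 1) (z + ((j + 1 : ℕ) : ℂ))) 0 (r j) :=
        HasSimpleResidue.comp_add (by rw [zero_add]; exact (hr j hj).residue (hZ (j + 1)))
      refine (e1.mul e2).congr fun z => ?_
      have e3 := negBinom_succ_mul j z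
      have e4 : (j + 1 : ℂ) ≠ 0 := by exact_mod_cast j.succ_ne_zero
      rw [sub_zero, ← mul_assoc]
      congr 1
      rw [div_mul_eq_mul_div, div_eq_iff e4, e3]
      ring
    have h6 := ((((h5 0 (by norm_num)).add (h5 1 (by norm_num))).add (h5 2 (by norm_num))).add h4)
    have e0 : negBinom 0 1 / (((0 : ℕ) : ℂ) + 1) * r 0 + negBinom 1 1 / (((1 : ℕ) : ℂ) + 1) * r 1 +
        negBinom 2 1 / (((2 : ℕ) : ℂ) + 1) * r 2 + 0 = r 0 + r 1 / 2 + r 2 / 3 := by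
      simp [negBinom, Finset.prod_range_succ]
      ring
    rw [e0] at h6
    refine Tendsto.congr' ?_ h6
    filter_upwards [h3] with z hz
    rw [hz, partialExpansion]
    simp only [Finset.sum_range_succ, Finset.sum_range_zero, negBinom_zero, id_eq]
    push_cast
    simp only [zero_add, add_zero]
    ring

end PerturbedZeta

/-! ### Conjugation with the real structure -/

section RealStructure

variable {H : Type u} [NormedAddCommGroup H] [InnerProductSpace ℂ H] [CompleteSpace H]
  {ι : Type*} {D : H →ₗ.[ℂ] H} {e e' : HilbertBasis ι ℂ H} {d : ι → ℝ} {J : H ≃ₗᵢ⋆[ℂ] H}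

/-- A conjugate linear isometry conjugates inner products, by polarization. -/
theorem antiunitary_inner (J : H ≃ₗᵢ⋆[ℂ] H) (x y : H) : ⟪J x, J y⟫_ℂ = conj ⟪x, y⟫_ℂ := by
  have hre : ∀ x y : H, (⟪J x, J y⟫_ℂ).re = (⟪x, y⟫_ℂ).re := by
    intro x y
    have h1 := norm_add_sq (𝕜 := ℂ) x y
    have h2 := norm_add_sq (𝕜 := ℂ) (J x) (J y)
    rw [← map_add, J.norm_map, J.norm_map, J.norm_map, h1] at h2
    simp only [RCLike.re_to_complex] at h2
    linarith
  have h3 := hre (Complex.I • x) y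
  have h4 : J (Complex.I • x) = (-Complex.I) • J x := by
    rw [map_smulₛₗ, Complex.conj_I]
  rw [h4, inner_smul_left, inner_smul_left] at h3
  refine Complex.ext ?_ ?_
  · rw [Complex.conj_re, hre]
  · rw [Complex.conj_im]
    simp at h3
    linarith

theorem antiunitary_inner_left (J : H ≃ₗᵢ⋆[ℂ] H) (x y : H) :
    ⟪J x, y⟫_ℂ = conj ⟪x, J.symm y⟫_ℂ := by
  rw [← antiunitary_inner J, J.apply_symm_apply]

theorem conjBy_apply (J : H ≃ₗᵢ⋆[ℂ] H) (T : H →L[ℂ] H) (x : H) :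
    conjBy J T x = J (T (J.symm x)) := rfl

/-- The image of a Hilbert basis under an antiunitary operator. -/
theorem exists_antiunitary_basis (J : H ≃ₗᵢ⋆[ℂ] H) (e : HilbertBasis ι ℂ H) :
    ∃ e' : HilbertBasis ι ℂ H, ∀ k, e' k = J (e k) := by
  classical
  have ho : Orthonormal ℂ fun k => J (e k) := by
    rw [orthonormal_iff_ite]
    intro i j
    rw [antiunitary_inner, orthonormal_iff_ite.1 e.orthonormal]
    split_ifs <;> simp
  have hb : (Submodule.span ℂ (Set.range fun k => J (e k)))ᗮ = ⊥ := by
    refine (Submodule.eq_bot_iff _).2 fun x hx => ?_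
    have h1 : J.symm x = 0 := ext_inner_basis e fun k => by
      have h2 := hx _ (Submodule.subset_span ⟨k, rfl⟩)
      simp only at h2
      rw [antiunitary_inner_left] at h2
      rw [inner_zero_right]
      exact (map_eq_zero _).1 h2
    have h3 := congrArg J h1
    rwa [J.apply_symm_apply, map_zero] at h3
  exact ⟨HilbertBasis.mkOfOrthogonalEqBot ho hb, fun k => by
    rw [HilbertBasis.coe_mkOfOrthogonalEqBot]⟩

theorem IsSymm.of_clm {B : H →L[ℂ] H} {T : SmoothOp D} (hB : Extends B T)
    (h : ∀ x y, ⟪B x, y⟫_ℂ = ⟪x, B y⟫_ℂ) : IsSymm T := fun x y => by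
  rw [← hB, ← hB, h]

theorem IsSymm.mul {T S : SmoothOp D} (hT : IsSymm T) (hS : IsSymm S) (h : Commute T S) :
    IsSymm (T * S) := fun x y => by
  rw [Module.End.mul_apply, hT, hS, ← Module.End.mul_apply, h.eq]

theorem IsSymm.one : IsSymm (1 : SmoothOp D) := fun _ _ => rfl

theorem IsSymm.pow {T : SmoothOp D} (hT : IsSymm T) (n : ℕ) : IsSymm (T ^ n) := by
  induction n with
  | zero => rw [pow_zero]; exact IsSymm.one
  | succ n ih => rw [pow_succ]; exact ih.mul hT (Commute.pow_self T n)

variable (hD : Diagonalizes D e d) (he' : ∀ k, e' k = J (e k))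
  (hJ : ∀ x, J (J x) = -x) (hJD : ∀ x y, (x, y) ∈ D.graph → (J x, J y) ∈ D.graph)

include he' in
theorem inner_antiunitary_basis (k : ι) (x : H) : ⟪e' k, x⟫_ℂ = conj ⟪e k, J.symm x⟫_ℂ := by
  rw [he', antiunitary_inner_left]

include hJ in
theorem antiunitary_symm_apply (x : H) : J.symm x = -J x := by
  rw [LinearIsometryEquiv.symm_apply_eq, map_neg, hJ, neg_neg]

include hD he' hJ hJD in
/-- The antiunitary `J` commutes with `D`; so it maps the eigenbasis to an eigenbasis with the same
eigenvalues. -/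
theorem Diagonalizes.antiunitary : Diagonalizes D e' d := by
  have h1 : ∀ x y, (x, y) ∈ D.graph ↔ (J.symm x, J.symm y) ∈ D.graph := by
    intro x y
    constructor
    · intro h
      rw [antiunitary_symm_apply hJ, antiunitary_symm_apply hJ]
      exact D.graph.neg_mem (hJD _ _ h)
    · intro h
      have := hJD _ _ h
      rwa [J.apply_symm_apply, J.apply_symm_apply] at this
  intro x y
  rw [h1, hD]
  refine forall_congr' fun k => ?_
  rw [inner_antiunitary_basis he', inner_antiunitary_basis he', ← Complex.conj_ofReal, ← map_mul,
    Complex.conj_ofReal, (starRingEnd ℂ).injective.eq_iff]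

include hD he' hJ hJD in
theorem antiunitary_mem_smoothVectors {x : H} (hx : x ∈ smoothVectors D) :
    J x ∈ smoothVectors D := by
  rw [(hD.antiunitary he' hJ hJD).mem_smoothVectors]
  rw [hD.mem_smoothVectors] at hx
  intro n
  refine (hx n).congr fun k => ?_
  rw [inner_antiunitary_basis he', J.symm_apply_apply]
  simp only [norm_mul, RCLike.norm_conj]

/-- `J T J⁻¹` for an operator `T` on smooth vectors. -/
def conjOp (J : H ≃ₗᵢ⋆[ℂ] H) (hm : ∀ x ∈ smoothVectors D, J x ∈ smoothVectors D)
    (hm' : ∀ x ∈ smoothVectors D, J.symm x ∈ smoothVectors D) (T : SmoothOp D) : SmoothOp D where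
  toFun x := ⟨J (T ⟨J.symm x, hm' x x.2⟩), hm _ (T ⟨J.symm x, hm' x x.2⟩).2⟩
  map_add' x y := by
    refine Subtype.ext ?_
    have h : (⟨J.symm ((x + y : smoothVectors D) : H), hm' _ (x + y).2⟩ : smoothVectors D) =
        ⟨J.symm x, hm' x x.2⟩ + ⟨J.symm y, hm' y y.2⟩ := Subtype.ext (map_add J.symm _ _)
    change J (T ⟨J.symm ((x + y : smoothVectors D) : H), _⟩ : H) =
      J (T ⟨J.symm x, hm' x x.2⟩ : H) + J (T ⟨J.symm y, hm' y y.2⟩ : H)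
    rw [h, map_add, Submodule.coe_add, map_add]
  map_smul' c x := by
    refine Subtype.ext ?_
    have h : (⟨J.symm ((c • x : smoothVectors D) : H), hm' _ (c • x).2⟩ : smoothVectors D) =
        conj c • ⟨J.symm x, hm' x x.2⟩ := Subtype.ext (map_smulₛₗ J.symm c (x : H))
    change J (T ⟨J.symm ((c • x : smoothVectors D) : H), _⟩ : H) =
      c • J (T ⟨J.symm x, hm' x x.2⟩ : H)
    rw [h, map_smul, Submodule.coe_smul, map_smulₛₗ, Complex.conj_conj]

variable {hm : ∀ x ∈ smoothVectors D, J x ∈ smoothVectors D}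
  {hm' : ∀ x ∈ smoothVectors D, J.symm x ∈ smoothVectors D}

theorem conjOp_apply (T : SmoothOp D) (x : smoothVectors D) :
    (conjOp J hm hm' T x : H) = J (T ⟨J.symm x, hm' x x.2⟩) := rfl

theorem conjOp_sub (T S : SmoothOp D) :
    conjOp J hm hm' (T - S) = conjOp J hm hm' T - conjOp J hm hm' S := by
  refine LinearMap.ext fun x => Subtype.ext ?_
  simp only [conjOp_apply, LinearMap.sub_apply, Submodule.coe_sub, map_sub]

theorem conjOp_mul (T S : SmoothOp D) :
    conjOp J hm hm' (T * S) = conjOp J hm hm' T * conjOp J hm hm' S := by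
  refine LinearMap.ext fun x => Subtype.ext ?_
  simp only [conjOp_apply, Module.End.mul_apply, J.symm_apply_apply]

theorem conjOp_one : conjOp J hm hm' 1 = 1 := by
  refine LinearMap.ext fun x => Subtype.ext ?_
  simp only [conjOp_apply, Module.End.one_apply, J.apply_symm_apply]

theorem conjOp_pow (T : SmoothOp D) (n : ℕ) :
    conjOp J hm hm' (T ^ n) = conjOp J hm hm' T ^ n := by
  induction n with
  | zero => rw [pow_zero, pow_zero, conjOp_one]
  | succ n ih => rw [pow_succ, pow_succ, conjOp_mul, ih]

include hJ in
theorem conjOp_conjOp (T : SmoothOp D) : conjOp J hm hm' (conjOp J hm hm' T) = T := by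
  refine LinearMap.ext fun x => Subtype.ext ?_
  have h : (⟨J.symm (J.symm (x : H)), hm' _ (hm' x x.2)⟩ : smoothVectors D) = -x := by
    refine Subtype.ext ?_
    change J.symm (J.symm (x : H)) = -(x : H)
    rw [antiunitary_symm_apply hJ, antiunitary_symm_apply hJ, map_neg, hJ, neg_neg]
  rw [conjOp_apply, conjOp_apply]
  simp only
  rw [h, hJ, map_neg, Submodule.coe_neg, neg_neg]

theorem Extends.conjOp {B : H →L[ℂ] H} {T : SmoothOp D} (h : Extends B T) :
    Extends (conjBy J B) (conjOp J hm hm' T) := fun x => by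
  rw [conjBy_apply, conjOp_apply, ← h]

theorem IsBdd.conjOp {T : SmoothOp D} (h : IsBdd T) : IsBdd (conjOp J hm hm' T) := by
  obtain ⟨B, hB⟩ := h
  exact ⟨_, hB.conjOp⟩

include he' in
theorem IsDiag.conjOp {T : SmoothOp D} {c : ι → ℝ} (h : IsDiag e T fun k => c k) :
    IsDiag e' (conjOp J hm hm' T) fun k => c k := fun x k => by
  rw [inner_antiunitary_basis he', inner_antiunitary_basis he', conjOp_apply, J.symm_apply_apply, h,
    map_mul, Complex.conj_ofReal]

include hD he' hJ hJD

theorem conjOp_absPow_one (hg : HasGap d) : conjOp J hm hm' (absPow D 1) = absPow D 1 := by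
  have h1 := (hD.isDiag_absPow hg 1).congr fun k => absCpow_one (d k)
  have h2 := ((hD.antiunitary he' hJ hJD).isDiag_absPow hg 1).congr fun k => absCpow_one (d k)
  exact (h1.conjOp he').ext h2

theorem conjOp_signOp (hg : HasGap d) : conjOp J hm hm' (signOp D) = signOp D :=
  ((hD.isDiag_signOp hg).conjOp he').ext ((hD.antiunitary he' hJ hJD).isDiag_signOp hg)

theorem conjOp_delta (hg : HasGap d) (T : SmoothOp D) :
    conjOp J hm hm' (delta D T) = delta D (conjOp J hm hm' T) := by
  rw [delta, delta, conjOp_sub, conjOp_mul, conjOp_mul, conjOp_absPow_one hD he' hJ hJD hg]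

theorem IsTame.conjOp (hg : HasGap d) {T : SmoothOp D} (hT : IsTame T) :
    IsTame (conjOp J hm hm' T) := by
  refine ⟨fun k => ?_, fun m n => ?_⟩
  · have h : ∀ S : SmoothOp D, (delta D)^[k] (SpectralGeometry.conjOp J hm hm' S) =
        SpectralGeometry.conjOp J hm hm' ((delta D)^[k] S) := by
      intro S
      induction k generalizing S with
      | zero => rfl
      | succ k ih =>
        rw [Function.iterate_succ_apply, Function.iterate_succ_apply,
          ← conjOp_delta hD he' hJ hJD hg, ih]
    rw [h]
    exact (hT.op k).conjOp
  · have h := (hT.comm m n).conjOp (J := J) (hm := hm) (hm' := hm')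
    simpa only [conjOp_mul, conjOp_sub, conjOp_pow, conjOp_absPow_one hD he' hJ hJD hg,
      conjOp_signOp hD he' hJ hJD hg] using h

/-- For a symmetric operator `T`, the operators `T` and `J T J⁻¹` have the same traces against
functions of `D`. -/
theorem dirichlet_conjOp (hd : IsThreeSummable d) {T G : SmoothOp D} (hT : IsBdd T) (hG : IsBdd G)
    (hTs : IsSymm T) {c : ι → ℂ} (hGe : IsDiag e G c) (hGe' : IsDiag e' G c) {s : ℂ}
    (hs : 3 < s.re) : dirichlet d (diagEntry hD (conjOp J hm hm' T * G)) s =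
      dirichlet d (diagEntry hD (T * G)) s := by
  have hD' := hD.antiunitary he' hJ hJD
  have h1 := hD.hasTrace_absPow hd (hT.conjOp (J := J) (hm := hm) (hm' := hm') |>.mul hG) hs
  have h2 := hD'.hasTrace_absPow hd (hT.conjOp (J := J) (hm := hm) (hm' := hm') |>.mul hG) hs
  rw [h1.unique hD h2]
  congr 1
  funext k
  rw [hGe'.diagEntry_mul hD', hGe.diagEntry_mul hD]
  congr 1
  have h3 : (⟨J.symm (e' k), hm' _ (hD'.basis_mem k)⟩ : smoothVectors D) =
      ⟨e k, hD.basis_mem k⟩ := Subtype.ext (by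
    change J.symm (e' k) = e k
    rw [he', J.symm_apply_apply])
  rw [diagEntry, inner_antiunitary_basis he', conjOp_apply, J.symm_apply_apply, h3, inner_conj_symm]
  exact hTs ⟨e k, hD.basis_mem k⟩ ⟨e k, hD.basis_mem k⟩

end RealStructure

/-! ### Real spectral triples -/

section Triple

variable {A : Type*} {H : Type u} [Ring A] [StarRing A] [Algebra ℂ A] [StarModule ℂ A]
  [NormedAddCommGroup H] [InnerProductSpace ℂ H] [CompleteSpace H]
  {S : RealSpectralTriple A H} {ι : Type*} {e e' : HilbertBasis ι ℂ H} {d : ι → ℝ}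

/-- The adjoint of a compact resolvent is compact. -/
theorem isCompactOperator_resolvent_neg {D : H →ₗ.[ℂ] H} {R R' : H →L[ℂ] H}
    (hc : IsCompactOperator R) (hR : IsResolvent D Complex.I R)
    (hR' : IsResolvent D (-Complex.I) R') : IsCompactOperator R' := by
  have h : R' = R.comp (ContinuousLinearMap.id ℂ H - (2 * Complex.I) • R') := by
    ext v
    have h1 := (hR _ _).1 (hR'.mem_graph v)
    rw [ContinuousLinearMap.comp_apply]
    refine h1.symm.trans (congrArg R ?_)
    rw [sub_apply, ContinuousLinearMap.id_apply, smul_apply]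
    module
  rw [h]
  exact hc.comp_clm _

theorem RealSpectralTriple.exists_resolvents (S : RealSpectralTriple A H) :
    ∃ R R' : H →L[ℂ] H, IsCompactOperator R ∧ IsCompactOperator R' ∧
      IsResolvent S.D Complex.I R ∧ IsResolvent S.D (-Complex.I) R' := by
  obtain ⟨R, hc, hR⟩ := isResolvent_of_hasCompactResolvent S.compactResolvent
  have hR' := IsSelfAdjoint.isResolvent_adjoint S.isSelfAdjoint_D hR
  exact ⟨R, _, hc, isCompactOperator_resolvent_neg hc hR hR', hR, hR'⟩

theorem RealSpectralTriple.exists_eigenbasis (S : RealSpectralTriple A H) :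
    ∃ (ι : Type u) (e : HilbertBasis ι ℂ H) (d : ι → ℝ), Diagonalizes S.D e d ∧ HasGap d := by
  obtain ⟨R, R', hc, -, hR, hR'⟩ := S.exists_resolvents
  obtain ⟨ι, e, d, h, hfin⟩ :=
    exists_diagonalization (IsSelfAdjoint.isSymmetricOp S.isSelfAdjoint_D) hc hR hR'
  exact ⟨ι, e, d, h, hasGap_of_finite hfin⟩

/-- Bounded symmetric perturbations of `D` are diagonal in a Hilbert basis as well. -/
theorem RealSpectralTriple.exists_eigenbasis_vadd (S : RealSpectralTriple A H) {B : H →L[ℂ] H}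
    (hB : ∀ x y, ⟪B x, y⟫_ℂ = ⟪x, B y⟫_ℂ) :
    ∃ (ι : Type u) (e : HilbertBasis ι ℂ H) (d : ι → ℝ),
      Diagonalizes ((B : H →ₗ[ℂ] H) +ᵥ S.D) e d ∧ HasGap d := by
  obtain ⟨R, R', hc, hc', hR, hR'⟩ := S.exists_resolvents
  have hs := IsSelfAdjoint.isSymmetricOp S.isSelfAdjoint_D
  obtain ⟨Q, hQc, hQ⟩ := exists_isResolvent_vadd hs hB (c := Complex.I) (by simp) hc hR
  obtain ⟨Q', -, hQ'⟩ := exists_isResolvent_vadd hs hB (c := -Complex.I) (by simp) hc' hR'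
  obtain ⟨ι, e, d, h, hfin⟩ := exists_diagonalization (hs.vadd hB) hQc hQ hQ'
  exact ⟨ι, e, d, h, hasGap_of_finite hfin⟩

theorem RealSpectralTriple.inner_π (S : RealSpectralTriple A H) {φ : A} (hφ : IsSelfAdjoint φ)
    (x y : H) : ⟪S.π φ x, y⟫_ℂ = ⟪x, S.π φ y⟫_ℂ := by
  have h : ContinuousLinearMap.adjoint (S.π φ) = S.π φ := by
    rw [← ContinuousLinearMap.star_eq_adjoint, ← map_star, hφ.star_eq]
  rw [← ContinuousLinearMap.adjoint_inner_right, h]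

theorem inner_conjBy (J : H ≃ₗᵢ⋆[ℂ] H) {B : H →L[ℂ] H} (hB : ∀ x y, ⟪B x, y⟫_ℂ = ⟪x, B y⟫_ℂ)
    (x y : H) : ⟪conjBy J B x, y⟫_ℂ = ⟪x, conjBy J B y⟫_ℂ := by
  rw [conjBy_apply, antiunitary_inner_left, hB, ← antiunitary_inner J, J.apply_symm_apply]
  rfl

theorem RealSpectralTriple.J_mem_graph (S : RealSpectralTriple A H) (x y : H)
    (h : (x, y) ∈ S.D.graph) : (S.J x, S.J y) ∈ S.D.graph := by
  obtain ⟨hx, rfl⟩ := mem_graph_iff'.1 h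
  obtain ⟨hJ, he⟩ := S.J_comm_D ⟨x, hx⟩
  exact mem_graph_iff'.2 ⟨hJ, he⟩

theorem RealSpectralTriple.J_mem_smoothVectors (S : RealSpectralTriple A H)
    {x : H} (hx : x ∈ smoothVectors S.D) : S.J x ∈ smoothVectors S.D := by
  obtain ⟨ι, e, d, hD, -⟩ := S.exists_eigenbasis
  obtain ⟨e', he'⟩ := exists_antiunitary_basis S.J e
  exact antiunitary_mem_smoothVectors hD he' S.J_sq S.J_mem_graph hx

theorem RealSpectralTriple.J_symm_mem_smoothVectors (S : RealSpectralTriple A H)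
    {x : H} (hx : x ∈ smoothVectors S.D) : S.J.symm x ∈ smoothVectors S.D := by
  rw [antiunitary_symm_apply S.J_sq]
  exact neg_mem (S.J_mem_smoothVectors hx)

/-- `J T J⁻¹` on smooth vectors. -/
def RealSpectralTriple.conj (S : RealSpectralTriple A H) (T : SmoothOp S.D) : SmoothOp S.D :=
  conjOp S.J (fun _ => S.J_mem_smoothVectors) (fun _ => S.J_symm_mem_smoothVectors) T

variable (hreg : S.Regular)
include hreg

theorem extends_left (a : A) : Extends (S.π a) (S.left a) := fun x =>
  (restr_clm_apply (hreg a).1 x).symm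

theorem right_eq_conj (a : A) : S.right a = S.conj (S.left a) :=
  restr_eq _ fun x => ((extends_left hreg a).conjOp x).symm

theorem extends_right (a : A) : Extends (conjBy S.J (S.π a)) (S.right a) := by
  rw [right_eq_conj hreg]
  exact (extends_left hreg a).conjOp

theorem commute_left_right (a b : A) : Commute (S.left a) (S.right b) := by
  refine LinearMap.ext fun x => Subtype.ext ?_
  have h := congrArg (fun T : H →L[ℂ] H => T x) (S.order_zero b a).eq
  rw [Module.End.mul_apply, Module.End.mul_apply, ← extends_left hreg, ← extends_right hreg,
    ← extends_right hreg, ← extends_left hreg]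
  exact h.symm

variable (hF : S.SignCommutesModSmoothing) (hD : Diagonalizes S.D e d) (hg : HasGap d)
include hF hD hg

theorem isTame_left (a : A) : IsTame (S.left a) :=
  ⟨(hD.isOP_zero_iff hg).1 (hreg a).2.1, hD.isSm_of_isSmoothing hg (hF a)⟩

theorem isTame_right (a : A) : IsTame (S.right a) := by
  obtain ⟨e', he'⟩ := exists_antiunitary_basis S.J e
  rw [right_eq_conj hreg]
  exact (isTame_left hreg hF hD hg a).conjOp hD he' S.J_sq S.J_mem_graph hg

omit hreg hF hD hg

/-- The tame operators in the algebra generated by `A`, `J A J⁻¹`, `D` and `|D|`. -/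
structure IsDiffTame (S : RealSpectralTriple A H) (T : SmoothOp S.D) : Prop where
  mem : T ∈ S.diffOps
  tame : IsTame T

theorem IsDiffTame.add {T R : SmoothOp S.D} (hT : IsDiffTame S T) (hR : IsDiffTame S R) :
    IsDiffTame S (T + R) := ⟨add_mem hT.1 hR.1, hT.2.add hR.2⟩

theorem IsDiffTame.mul {T R : SmoothOp S.D} (hT : IsDiffTame S T) (hR : IsDiffTame S R) :
    IsDiffTame S (T * R) := ⟨mul_mem hT.1 hR.1, hT.2.mul hR.2⟩

theorem IsDiffTame.pow {T : SmoothOp S.D} (hT : IsDiffTame S T) (n : ℕ) :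
    IsDiffTame S (T ^ n) := ⟨pow_mem hT.1 n, hT.2.pow n⟩

theorem IsDiffTame.one : IsDiffTame S 1 := ⟨one_mem _, IsTame.one⟩

theorem selfOp_mem_diffOps : selfOp S.D ∈ S.diffOps :=
  Algebra.subset_adjoin (Or.inr (Or.inl rfl))

theorem absPow_mem_diffOps : absPow S.D 1 ∈ S.diffOps :=
  Algebra.subset_adjoin (Or.inr (Or.inr rfl))

include hD hg in
theorem IsDiffTame.commutator {T : SmoothOp S.D} (hT : IsDiffTame S T) :
    IsDiffTame S (selfOp S.D * T - T * selfOp S.D) :=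
  ⟨sub_mem (mul_mem selfOp_mem_diffOps hT.1) (mul_mem hT.1 selfOp_mem_diffOps),
    hD.isTame_commutator hg hT.2⟩

include hD hg in
theorem IsDiffTame.intertwine_iterate {P T : SmoothOp S.D} (hP : IsDiffTame S P)
    (hT : IsDiffTame S T) (n : ℕ) : IsDiffTame S ((intertwine P)^[n] T) := by
  refine ⟨?_, hD.isTame_intertwine_iterate hg hP.2 hT.2 n⟩
  induction n with
  | zero => exact hT.1
  | succ n ih =>
    rw [Function.iterate_succ_apply']
    exact sub_mem (sub_mem (mul_mem ih selfOp_mem_diffOps) (mul_mem selfOp_mem_diffOps ih))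
      (mul_mem hP.1 ih)

include hreg hF hD hg in
theorem isDiffTame_left (a : A) : IsDiffTame S (S.left a) :=
  ⟨Algebra.subset_adjoin (Or.inl (Or.inl ⟨a, rfl⟩)), isTame_left hreg hF hD hg a⟩

include hreg hF hD hg in
theorem isDiffTame_right (a : A) : IsDiffTame S (S.right a) :=
  ⟨Algebra.subset_adjoin (Or.inl (Or.inr ⟨a, rfl⟩)), isTame_right hreg hF hD hg a⟩

include hD hg

theorem IsDiffTame.isPseudodifferential {T : SmoothOp S.D} (hT : IsDiffTame S T) :
    S.IsPseudodifferential T := by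
  have h0 : intPow S.D (-2 * ((0 : ℕ) : ℤ)) = 1 :=
    (hD.isDiag_intPow hg _).ext (IsDiag.one.congr fun k => by simp)
  refine ⟨0, fun N => ⟨0, T, hT.1, 0, ?_, ?_, ?_⟩⟩
  · rw [hD.isOP_neg_iff hg, zero_mul]
    exact isOPZero_of_delta_eq_zero IsBdd.zero delta_zero
  · rw [h0, mul_one, hD.isOP_zero_iff hg]
    exact hT.2.op
  · rw [h0, mul_one, add_zero]

/-- `F = D |D| D⁻² + P` with the projection `P` onto the kernel of `D`. -/
theorem Diagonalizes.signOp_eq : signOp S.D =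
    selfOp S.D * absPow S.D 1 * intPow S.D (-2 * ((1 : ℕ) : ℤ)) + kerProj S.D := by
  refine sub_eq_iff_eq_add.1 (((hD.isDiag_signOp hg).sub (hD.isDiag_kerProj hg)).ext
    (((hD.isDiag_selfOp.mul (hD.isDiag_absPow hg 1)).mul (hD.isDiag_intPow hg _)).congr
      fun k => ?_))
  rw [absCpow_one]
  by_cases h : d k = 0
  · have h1 : eigenSign (d k) = 1 := by simp [eigenSign, invertedEigenvalue, h, Real.sign_one]
    rw [h1]
    simp [h]
  · have h1 : invertedEigenvalue (d k) = d k := if_neg h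
    have h2 := eigenSign_mul_abs (d k)
    have h3 := eigenSign_mul_self (d k)
    rw [h1] at h2 ⊢
    have h4 : (d k : ℂ) ≠ 0 := by exact_mod_cast h
    have h5 : ((|d k| : ℝ) : ℂ) = eigenSign (d k) * d k := by
      rw [← Complex.ofReal_mul]
      congr 1
      calc |d k| = eigenSign (d k) * eigenSign (d k) * |d k| := by rw [h3, one_mul]
        _ = _ := by rw [mul_assoc, h2]
    rw [h5, if_neg h, sub_zero, show -2 * ((1 : ℕ) : ℤ) = -2 by norm_num, zpow_neg]
    field_simp

/-- The sign of `D` need not be in the algebra of differential operators, but it is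
pseudodifferential, as it equals `D |D| D⁻²` up to a smoothing operator. -/
theorem IsDiffTame.isPseudodifferential_mul_signOp {T : SmoothOp S.D} (hT : IsDiffTame S T) :
    S.IsPseudodifferential (T * signOp S.D) := by
  have hK := hD.isSm_kerProj hg
  refine ⟨0, fun N => ⟨1, T * (selfOp S.D * absPow S.D 1),
    mul_mem hT.1 (mul_mem selfOp_mem_diffOps absPow_mem_diffOps), T * kerProj S.D, ?_, ?_, ?_⟩⟩
  · rw [hD.isOP_neg_iff hg]
    exact ((hK.mul_left hT.2.op).mul_absPow_pow N).isOPZero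
  · rw [hD.isOP_zero_iff hg, mul_assoc, ← sub_eq_iff_eq_add.2 (hD.signOp_eq hg)]
    exact hT.2.op.mul ((hD.isOPZero_signOp hg).sub hK.isOPZero)
  · rw [mul_assoc T, ← mul_add, ← hD.signOp_eq hg]

end Triple

/-! ### Residues -/

section Residues

variable {A : Type*} {H : Type u} [Ring A] [StarRing A] [Algebra ℂ A] [StarModule ℂ A]
  [NormedAddCommGroup H] [InnerProductSpace ℂ H] [CompleteSpace H]
  {S : RealSpectralTriple A H} {ι ι' : Type*} {e : HilbertBasis ι ℂ H} {d : ι → ℝ}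
  {f : HilbertBasis ι' ℂ H} {l : ι' → ℝ}

theorem IsContinuation.hasRes_ncInt {D : H →ₗ.[ℂ] H} {hD : Diagonalizes D e d}
    (hd : IsThreeSummable d) {X : SmoothOp D} (hX : IsBdd X) {Z : ℂ → ℂ}
    (hZ : IsContinuation d (diagEntry hD X) Z) (m : ℂ) :
    HasRes d (diagEntry hD X) m (ncInt D (X * absPow D (-m))) := by
  obtain ⟨r, hr⟩ := hZ.exists_residue m
  have h : HasRes d (diagEntry hD X) m r := ⟨Z, hZ, hr⟩
  rwa [(h.hasNCInt hD hd hX).ncInt_eq hD]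

theorem HasRes.diagEntry_add {D : H →ₗ.[ℂ] H} {hD : Diagonalizes D e d}
    (hd : IsThreeSummable d) {X Y : SmoothOp D} (hX : IsBdd X) (hY : IsBdd Y) {m r r' : ℂ}
    (h : HasRes d (diagEntry hD X) m r) (h' : HasRes d (diagEntry hD Y) m r') :
    HasRes d (diagEntry hD (X + Y)) m (r + r') := by
  obtain ⟨C, hC⟩ := hX.exists_norm_diagEntry_le hD
  obtain ⟨C', hC'⟩ := hY.exists_norm_diagEntry_le hD
  have h1 := h.add hd hC hC' h'
  rwa [show diagEntry hD (X + Y) = fun k => diagEntry hD X k + diagEntry hD Y k from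
    funext fun k => SpectralGeometry.diagEntry_add hD X Y k]

variable (hsimple : S.SimpleDimensionSpectrum) (hD : Diagonalizes S.D e d)
  (hd : IsThreeSummable d)
include hsimple hd

theorem exists_isZeta_of_isPseudodifferential {X : SmoothOp S.D} (hX : S.IsPseudodifferential X)
    (hX0 : IsOPZero X) : ∃ Z, IsZeta S.D X Z ∧ IsContinuation d (diagEntry hD X) Z := by
  obtain ⟨Z, hZ, ho⟩ := hsimple X hX ((hD.isOP_zero_iff hd.gap).2 hX0)
  exact ⟨Z, hZ, hD.isContinuation_of_isZeta hd hX0.isBdd hZ ho⟩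

theorem IsDiffTame.exists_isContinuation {T : SmoothOp S.D} (hT : IsDiffTame S T) :
    ∃ Z, IsContinuation d (diagEntry hD T) Z := by
  obtain ⟨Z, -, hZ⟩ := exists_isZeta_of_isPseudodifferential hsimple hD hd
    (hT.isPseudodifferential hD hd.gap) hT.2.op
  exact ⟨Z, hZ⟩

theorem IsDiffTame.exists_isContinuation_mul_signOp {T : SmoothOp S.D} (hT : IsDiffTame S T) :
    ∃ Z, IsContinuation d (diagEntry hD (T * signOp S.D)) Z := by
  obtain ⟨Z, -, hZ⟩ := exists_isZeta_of_isPseudodifferential hsimple hD hd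
    (hT.isPseudodifferential_mul_signOp hD hd.gap) (hT.2.op.mul (hD.isOPZero_signOp hd.gap))
  exact ⟨Z, hZ⟩

theorem IsDiffTame.hasRes {T : SmoothOp S.D} (hT : IsDiffTame S T) (m : ℂ) :
    HasRes d (diagEntry hD T) m (ncInt S.D (T * absPow S.D (-m))) := by
  obtain ⟨Z, hZ⟩ := hT.exists_isContinuation hsimple hD hd
  exact hZ.hasRes_ncInt hd hT.2.op.isBdd m

theorem IsDiffTame.hasRes_mul_signOp {T : SmoothOp S.D} (hT : IsDiffTame S T) (m : ℂ) :
    HasRes d (diagEntry hD (T * signOp S.D)) m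
      (ncInt S.D (T * signOp S.D * absPow S.D (-m))) := by
  obtain ⟨Z, hZ⟩ := hT.exists_isContinuation_mul_signOp hsimple hD hd
  exact hZ.hasRes_ncInt hd (hT.2.op.mul (hD.isOPZero_signOp hd.gap)).isBdd m

omit hsimple in
/-- Conjugation with `J` does not change the residues of symmetric operators. -/
theorem HasRes.conj {T : SmoothOp S.D} (hT : IsTame T) (hTs : IsSymm T) {m r : ℂ}
    (h : HasRes d (diagEntry hD T) m r) : HasRes d (diagEntry hD (S.conj T)) m r := by
  obtain ⟨e', he'⟩ := exists_antiunitary_basis S.J e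
  refine h.congr fun s hs => ?_
  have h1 := dirichlet_conjOp (hm := fun _ => S.J_mem_smoothVectors)
    (hm' := fun _ => S.J_symm_mem_smoothVectors) hD he' S.J_sq S.J_mem_graph hd hT.op.isBdd
    IsBdd.one hTs IsDiag.one IsDiag.one hs
  rw [mul_one, mul_one] at h1
  exact h1.symm

omit hsimple in
theorem HasRes.conj_mul_signOp {T : SmoothOp S.D} (hT : IsTame T) (hTs : IsSymm T) {m r : ℂ}
    (h : HasRes d (diagEntry hD (T * signOp S.D)) m r) :
    HasRes d (diagEntry hD (S.conj T * signOp S.D)) m r := by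
  obtain ⟨e', he'⟩ := exists_antiunitary_basis S.J e
  refine h.congr fun s hs => ?_
  exact (dirichlet_conjOp (hm := fun _ => S.J_mem_smoothVectors)
    (hm' := fun _ => S.J_symm_mem_smoothVectors) hD he' S.J_sq S.J_mem_graph hd hT.op.isBdd
    (hD.isOPZero_signOp hd.gap).isBdd hTs (hD.isDiag_signOp hd.gap)
    ((hD.antiunitary he' S.J_sq S.J_mem_graph).isDiag_signOp hd.gap) hs).symm

variable (hreg : S.Regular) (hF : S.SignCommutesModSmoothing) {φ : A} (hφ : IsSelfAdjoint φ)
include hreg hF hφ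

omit hsimple hd hF in
theorem isSymm_left : IsSymm (S.left φ) :=
  IsSymm.of_clm (extends_left hreg φ) (S.inner_π hφ)

omit hsimple hd hF in
theorem isSymm_right : IsSymm (S.right φ) :=
  IsSymm.of_clm (extends_right hreg φ) (inner_conjBy S.J (S.inner_π hφ))

/-- The residues of `(Φ + JΦJ⁻¹) F`. -/
theorem hasRes_potential (m : ℂ) : HasRes d
    (diagEntry hD ((S.left φ + S.right φ) * signOp S.D)) m
    (2 * ncInt S.D (S.left φ * signOp S.D * absPow S.D (-m))) := by
  have hΦ := isDiffTame_left hreg hF hD hd.gap φ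
  have hΦ' := isDiffTame_right hreg hF hD hd.gap φ
  have hs := isSymm_left hreg hφ
  have hFb := (hD.isOPZero_signOp hd.gap).isBdd
  have h1 := hΦ.hasRes_mul_signOp hsimple hD hd m
  have h2 := h1.conj_mul_signOp hD hd hΦ.2 hs
  rw [← right_eq_conj hreg] at h2
  rw [add_mul, two_mul]
  exact h1.diagEntry_add hd (hΦ.2.op.isBdd.mul hFb) (hΦ'.2.op.isBdd.mul hFb) h2

/-- The residues of `(Φ + JΦJ⁻¹)²`. -/
theorem hasRes_potential_sq (m : ℂ) : HasRes d
    (diagEntry hD ((S.left φ + S.right φ) ^ 2)) m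
    (2 * ncInt S.D (S.left φ ^ 2 * absPow S.D (-m)) +
      2 * ncInt S.D (S.left φ * S.right φ * absPow S.D (-m))) := by
  have hΦ := isDiffTame_left hreg hF hD hd.gap φ
  have hΦ' := isDiffTame_right hreg hF hD hd.gap φ
  have hs := isSymm_left hreg hφ
  have hc := commute_left_right hreg φ φ
  have h1 := (hΦ.pow 2).hasRes hsimple hD hd m
  have h2 := h1.conj hD hd (hΦ.2.pow 2) (hs.pow 2)
  have h3 := (hΦ.mul hΦ').hasRes hsimple hD hd m
  have e2 : S.conj (S.left φ ^ 2) = S.right φ ^ 2 := by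
    rw [right_eq_conj hreg]
    exact conjOp_pow _ _
  rw [e2] at h2
  have e1 : (S.left φ + S.right φ) ^ 2 = S.left φ ^ 2 + S.right φ ^ 2 +
      (S.left φ * S.right φ + S.left φ * S.right φ) := by
    simp only [pow_two, mul_add, add_mul, ← hc.eq]
    abel
  rw [e1, two_mul, two_mul]
  have b1 := (hΦ.pow 2).2.op
  have b2 := (hΦ'.pow 2).2.op
  have b3 := (hΦ.mul hΦ').2.op
  exact (h1.diagEntry_add hd b1.isBdd b2.isBdd h2).diagEntry_add hd (b1.add b2).isBdd
    (b3.add b3).isBdd (h3.diagEntry_add hd b3.isBdd b3.isBdd h3)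

/-- The residues of `(Φ + JΦJ⁻¹)³ F`. -/
theorem hasRes_potential_cube (m : ℂ) : HasRes d
    (diagEntry hD ((S.left φ + S.right φ) ^ 3 * signOp S.D)) m
    (2 * ncInt S.D (S.left φ ^ 3 * signOp S.D * absPow S.D (-m)) +
      6 * ncInt S.D (S.left φ ^ 2 * S.right φ * signOp S.D * absPow S.D (-m))) := by
  have hΦ := isDiffTame_left hreg hF hD hd.gap φ
  have hΦ' := isDiffTame_right hreg hF hD hd.gap φ
  have hs := isSymm_left hreg hφ
  have hs' := isSymm_right hreg hφ
  have hc := commute_left_right hreg φ φ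
  have hFb := hD.isOPZero_signOp hd.gap
  have h1 := (hΦ.pow 3).hasRes_mul_signOp hsimple hD hd m
  have h2 := h1.conj_mul_signOp hD hd (hΦ.2.pow 3) (hs.pow 3)
  have h3 := ((hΦ.pow 2).mul hΦ').hasRes_mul_signOp hsimple hD hd m
  have h4 := h3.conj_mul_signOp hD hd ((hΦ.pow 2).mul hΦ').2
    ((hs.pow 2).mul hs' (hc.pow_left 2))
  have e2 : S.conj (S.left φ ^ 3) = S.right φ ^ 3 := by
    rw [right_eq_conj hreg]
    exact conjOp_pow _ _
  have e4 : S.conj (S.left φ ^ 2 * S.right φ) = S.right φ ^ 2 * S.left φ := by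
    rw [right_eq_conj hreg]
    refine (conjOp_mul _ _).trans ?_
    congr 1
    · exact conjOp_pow _ _
    · exact conjOp_conjOp S.J_sq _
  rw [e2] at h2
  rw [e4] at h4
  set Φ := S.left φ with hΦdef
  set Φ' := S.right φ with hΦdef'
  have e1 : (Φ + Φ') ^ 3 * signOp S.D = Φ ^ 3 * signOp S.D + Φ' ^ 3 * signOp S.D +
      (Φ ^ 2 * Φ' * signOp S.D + Φ' ^ 2 * Φ * signOp S.D +
        (Φ ^ 2 * Φ' * signOp S.D + Φ' ^ 2 * Φ * signOp S.D +
          (Φ ^ 2 * Φ' * signOp S.D + Φ' ^ 2 * Φ * signOp S.D))) := by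
    have c1 : Φ' * Φ = Φ * Φ' := hc.eq.symm
    have c2 : ∀ x, Φ' * (Φ * x) = Φ * (Φ' * x) := fun x => by
      rw [← mul_assoc, c1, mul_assoc]
    simp only [pow_succ, pow_zero, one_mul, mul_add, add_mul, mul_assoc, c1, c2]
    abel
  have b1 := (hΦ.pow 3).2.op.mul hFb
  have b2 := (hΦ'.pow 3).2.op.mul hFb
  have b3 := ((hΦ.pow 2).mul hΦ').2.op.mul hFb
  have b4 := ((hΦ'.pow 2).mul hΦ).2.op.mul hFb
  have b5 := b3.add b4
  have h5 := h3.diagEntry_add hd b3.isBdd b4.isBdd h4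
  have h6 := (h1.diagEntry_add hd b1.isBdd b2.isBdd h2).diagEntry_add hd (b1.add b2).isBdd
    (b5.add (b5.add b5)).isBdd (h5.diagEntry_add hd b5.isBdd (b5.add b5).isBdd
      (h5.diagEntry_add hd b5.isBdd b5.isBdd h5))
  rw [← e1] at h6
  convert h6 using 1
  ring

/-- The residue of `[D, Φ] (Φ + JΦJ⁻¹) F` at `3` vanishes. -/
theorem hasRes_commutator_left : HasRes d (diagEntry hD
    ((selfOp S.D * S.left φ - S.left φ * selfOp S.D) * (S.left φ + S.right φ) *
      signOp S.D)) 3 0 := by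
  have hΦ := isDiffTame_left hreg hF hD hd.gap φ
  have hA := hΦ.add (isDiffTame_right hreg hF hD hd.gap φ)
  have hs := isSymm_left hreg hφ
  obtain ⟨Z, hZ⟩ := ((hΦ.commutator hD hd.gap).mul hA).exists_isContinuation_mul_signOp
    hsimple hD hd
  exact hD.hasRes_commutator_mul hd hΦ.2 hA.2 hs (hs.add (isSymm_right hreg hφ))
    ((Commute.refl _).add_right (commute_left_right hreg φ φ)) hZ

/-- The residue of `[D, Φ + JΦJ⁻¹] (Φ + JΦJ⁻¹) F` at `3` vanishes. -/
theorem hasRes_commutator_potential : HasRes d (diagEntry hD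
    ((selfOp S.D * (S.left φ + S.right φ) - (S.left φ + S.right φ) * selfOp S.D) *
      (S.left φ + S.right φ) * signOp S.D)) 3 0 := by
  have hA := (isDiffTame_left hreg hF hD hd.gap φ).add (isDiffTame_right hreg hF hD hd.gap φ)
  have hs := (isSymm_left hreg hφ).add (isSymm_right hreg hφ)
  obtain ⟨Z, hZ⟩ := ((hA.commutator hD hd.gap).mul hA).exists_isContinuation_mul_signOp
    hsimple hD hd
  exact hD.hasRes_commutator_mul hd hA.2 hA.2 hs hs (Commute.refl _) hZ

end Residues

/-! ### The moments of the perturbation -/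

section Moments

variable {H : Type u} [NormedAddCommGroup H] [InnerProductSpace ℂ H] [CompleteSpace H]
  {ι ι' : Type*} {D : H →ₗ.[ℂ] H} {e : HilbertBasis ι ℂ H} {d : ι → ℝ}
  {f : HilbertBasis ι' ℂ H} {l : ι' → ℝ}
  (hD : Diagonalizes D e d) {B : H →L[ℂ] H}
  (hB : Diagonalizes ((B : H →ₗ[ℂ] H) +ᵥ D) f l) {A : SmoothOp D} (hA : Extends B A)
  (hg : HasGap d)
include hB hA hg

theorem signedMoment_even (j : ℕ) : signedMoment (pairWeight hD f 1 1) l d (2 * j) =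
    diagEntry hD ((intertwine A)^[2 * j] 1) := by
  funext k
  rw [signedMoment_pairWeight hD hB hA, pow_mul, ← Complex.ofReal_pow, sq, eigenSign_mul_self,
    Complex.ofReal_one, one_pow, one_mul]
  rfl

theorem signedMoment_odd (j : ℕ) : signedMoment (pairWeight hD f 1 1) l d (2 * j + 1) =
    diagEntry hD ((intertwine A)^[2 * j + 1] 1 * signOp D) := by
  funext k
  rw [signedMoment_pairWeight hD hB hA, pow_succ, pow_mul, ← Complex.ofReal_pow, sq,
    eigenSign_mul_self, Complex.ofReal_one, one_pow, one_mul,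
    (hD.isDiag_signOp hg).diagEntry_mul hD, mul_comm]
  rfl

theorem signedMoment_one (k : ι) : signedMoment (pairWeight hD f 1 1) l d 1 k =
    -1 * diagEntry hD (A * signOp D) k := by
  rw [show 1 = 2 * 0 + 1 from rfl, signedMoment_odd hD hB hA hg,
    (hD.isDiag_signOp hg).diagEntry_mul hD, (hD.isDiag_signOp hg).diagEntry_mul hD]
  have h : (intertwine A)^[2 * 0 + 1] 1 = (0 : SmoothOp D) - A := by
    change intertwine A 1 = _
    rw [intertwine, one_mul, mul_one, mul_one, sub_self]
  rw [h, diagEntry_sub]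
  simp [diagEntry]

theorem signedMoment_two (k : ι) : signedMoment (pairWeight hD f 1 1) l d 2 k =
    diagEntry hD (A ^ 2) k := by
  rw [show 2 = 2 * 1 from rfl, signedMoment_even hD hB hA hg]
  have h : (intertwine A)^[2 * 1] 1 = (selfOp D * A - A * selfOp D) + A ^ 2 := by
    change intertwine A (intertwine A 1) = _
    simp only [intertwine, one_mul, mul_one, sub_self, pow_two, sub_mul, mul_sub, zero_mul,
      mul_zero]
    abel
  rw [h, diagEntry_add, diagEntry_commutator, zero_add]

theorem signedMoment_three (k : ι) : signedMoment (pairWeight hD f 1 1) l d 3 k =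
    diagEntry hD ((selfOp D * A - A * selfOp D) * A * signOp D) k +
      -1 * diagEntry hD (A ^ 3 * signOp D) k := by
  rw [show 3 = 2 * 1 + 1 from rfl, signedMoment_odd hD hB hA hg,
    (hD.isDiag_signOp hg).diagEntry_mul hD, (hD.isDiag_signOp hg).diagEntry_mul hD,
    (hD.isDiag_signOp hg).diagEntry_mul hD]
  -- modulo commutators with `D`, the third iterate is `- A [D, A] - A³`, and
  -- `A [D, A] = - [D, A] A + [D, A²]`
  have h : (intertwine A)^[2 * 1 + 1] 1 = ((selfOp D * A - A * selfOp D) * A - A ^ 3) -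
      ((selfOp D * (selfOp D * A - A * selfOp D) - (selfOp D * A - A * selfOp D) * selfOp D) +
        (selfOp D * A ^ 2 - A ^ 2 * selfOp D) + (selfOp D * A ^ 2 - A ^ 2 * selfOp D)) := by
    change intertwine A (intertwine A (intertwine A 1)) = _
    simp only [intertwine, one_mul, mul_one, sub_self, pow_succ, pow_zero, zero_mul,
      mul_zero, mul_sub, sub_mul, mul_assoc]
    abel
  rw [h, diagEntry_sub, diagEntry_add, diagEntry_add, diagEntry_commutator, diagEntry_commutator,
    diagEntry_sub]
  ring

end Moments

/-! ### Integer powers and removable singularities -/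

section Final

variable {H : Type u} [NormedAddCommGroup H] [InnerProductSpace ℂ H] [CompleteSpace H]
  {ι ι' : Type*} {D : H →ₗ.[ℂ] H} {e : HilbertBasis ι ℂ H} {d : ι → ℝ}
  {f : HilbertBasis ι' ℂ H} {l : ι' → ℝ}

theorem Diagonalizes.signOp_sq (hD : Diagonalizes D e d) (hg : HasGap d) : signOp D ^ 2 = 1 :=
  ((hD.isDiag_signOp hg).pow 2).ext (IsDiag.one.congr fun k => by
    rw [← Complex.ofReal_pow, sq, eigenSign_mul_self, Complex.ofReal_one])

theorem Diagonalizes.intPow_neg_natCast (hD : Diagonalizes D e d) (hg : HasGap d) (n : ℕ) :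
    intPow D (-(n : ℤ)) = signOp D ^ n * absPow D (-(n : ℂ)) := by
  refine (hD.isDiag_intPow hg _).ext
    ((((hD.isDiag_signOp hg).pow n).mul (hD.isDiag_absPow hg _)).congr fun k => ?_)
  have h2 : (invertedEigenvalue (d k) : ℂ) =
      eigenSign (d k) * ((|invertedEigenvalue (d k)| : ℝ) : ℂ) := by
    rw [← Complex.ofReal_mul, eigenSign_mul_abs]
  have h3 : (eigenSign (d k) : ℂ) ^ n * (eigenSign (d k) : ℂ) ^ n = 1 := by
    rw [← mul_pow, ← Complex.ofReal_mul, eigenSign_mul_self, Complex.ofReal_one, one_pow]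
  rw [absCpow, Complex.cpow_neg, Complex.cpow_natCast, zpow_neg, zpow_natCast, h2, mul_pow,
    mul_inv, inv_eq_of_mul_eq_one_left h3]

theorem analyticAt_of_tendsto {g : ℂ → ℂ} {s c : ℂ} (hg : MeromorphicNFAt g s)
    (h : Tendsto g (𝓝[≠] s) (𝓝 c)) : AnalyticAt ℂ g s ∧ g s = c := by
  have h1 : AnalyticAt ℂ g s := by
    rw [← hg.meromorphicOrderAt_nonneg_iff_analyticAt]
    exact (tendsto_nhds_iff_meromorphicOrderAt_nonneg hg.meromorphicAt).1 ⟨c, h⟩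
  exact ⟨h1, tendsto_nhds_unique (h1.continuousAt.tendsto.mono_left nhdsWithin_le_nhds) h⟩

/-- For `m > 0` only the moments of order at most `2` contribute to the residue at `m`. -/
theorem sum_negBinom_mul (m r₀ r₁ r₂ : ℂ) :
    ∑ j ∈ Finset.range 4, negBinom j m *
      (if j = 0 then r₀ else if j = 1 then r₁ else if j = 2 then r₂ else 0) =
      r₀ + m * r₁ + m * (m + 1) / 2 * r₂ := by
  simp [Finset.sum_range_succ, negBinom, Finset.prod_range_succ]

end Final

end SpectralGeometry

end

open SpectralGeometry in
theorem mainTheorem1 {A : Type*} {H : Type*} [Ring A] [StarRing A] [Algebra ℂ A]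
    [StarModule ℂ A] [NormedAddCommGroup H] [InnerProductSpace ℂ H] [CompleteSpace H]
    (S : RealSpectralTriple A H) (hreg : S.Regular) (hdim : S.HasMetricDimension 3)
    (hsimple : S.SimpleDimensionSpectrum) (hF : S.SignCommutesModSmoothing)
    (φ : A) (hφ : IsSelfAdjoint φ) :
    let D := S.D
    let DΦ := S.perturbedD φ
    let Φ := S.left φ
    let Φ' := S.right φ
    let F := signOp D
    let dΦ := S.dirac φ
    -- the values in (a), (b), (c), (d)
    let ra : ℂ := ncInt D (absPow D (-3))
    let rb : ℂ := ncInt D (absPow D (-2)) - 4 * ncInt D (Φ * F * absPow D (-3))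
    let rc : ℂ := ncInt D (absPow D (-1)) - 2 * ncInt D (Φ * F * absPow D (-2))
      + 2 * ncInt D (Φ ^ 2 * absPow D (-3)) + 2 * ncInt D (Φ * Φ' * absPow D (-3))
    let rd : ℂ := -(2 * ncInt D (Φ * intPow D (-1))
      - ncInt D (Φ * (Φ + Φ') * intPow D (-2))
      - ncInt D (dΦ * (Φ + Φ') * intPow D (-3))
      + 2 / 3 * ncInt D (Φ ^ 3 * intPow D (-3))
      + 2 * ncInt D (Φ ^ 2 * Φ' * intPow D (-3)))
    -- all noncommutative integrals that occur in these values exist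
    (∀ T ∈ ({absPow D (-3), absPow D (-2), absPow D (-1), Φ * F * absPow D (-3),
        Φ * F * absPow D (-2), Φ ^ 2 * absPow D (-3), Φ * Φ' * absPow D (-3),
        Φ * intPow D (-1), Φ * (Φ + Φ') * intPow D (-2), dΦ * (Φ + Φ') * intPow D (-3),
        Φ ^ 3 * intPow D (-3), Φ ^ 2 * Φ' * intPow D (-3)} : Set (SmoothOp D)),
      ∃ r, HasNCInt D T r) ∧
    -- (a), (b), (c) for the noncommutative integral
    HasNCInt D (S.perturbedAbsPow φ (-3)) ra ∧
    HasNCInt D (S.perturbedAbsPow φ (-2)) rb ∧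
    HasNCInt D (S.perturbedAbsPow φ (-1)) rc ∧
    -- the zeta functions of `D` and `D_Φ`
    ∃ Z ZΦ : ℂ → ℂ, IsZeta D 1 Z ∧ IsZeta DΦ 1 ZΦ ∧
      -- (a), (b), (c) as residues of the zeta function of `D_Φ`
      HasSimpleResidue ZΦ 3 ra ∧ HasSimpleResidue ZΦ 2 rb ∧ HasSimpleResidue ZΦ 1 rc ∧
      -- (d), also for zeta functions with a (common) pole at `0`
      Tendsto (fun s => ZΦ s - Z s) (𝓝[≠] 0) (𝓝 rd) ∧
      (AnalyticAt ℂ Z 0 → AnalyticAt ℂ ZΦ 0 ∧ ZΦ 0 - Z 0 = rd) := by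
  intro D DΦ Φ Φ' F dΦ ra rb rc rd
  -- eigenbases of `D` and of `D_Φ`
  obtain ⟨ι, e, d, hD, hg⟩ := S.exists_eigenbasis
  have hd : IsThreeSummable d := hD.isThreeSummable hg fun s hs => hdim s (by exact_mod_cast hs)
  have hπ := S.inner_π hφ
  obtain ⟨ι', f, l, hB, hl⟩ := S.exists_eigenbasis_vadd (B := S.π φ + conjBy S.J (S.π φ))
    fun x y => by
      rw [add_apply, add_apply, inner_add_left, inner_add_right, hπ, inner_conjBy S.J hπ]
  have hA : Extends (S.π φ + conjBy S.J (S.π φ)) (S.left φ + S.right φ) := fun x => by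
    rw [add_apply, extends_left hreg, extends_right hreg]
    rfl
  have hΦ : IsDiffTame S Φ := isDiffTame_left hreg hF hD hg φ
  have hΦ' : IsDiffTame S Φ' := isDiffTame_right hreg hF hD hg φ
  have hdΦ : IsDiffTame S dΦ := hΦ.commutator hD hg
  have hAt : IsDiffTame S (Φ + Φ') := hΦ.add hΦ'
  have hFb : IsOPZero F := hD.isOPZero_signOp hg
  have hw := hasMoments_pairWeight hD hB hA hg hAt.2 IsTame.one IsTame.one
  -- the zeta function of `D` and the continuations of the moments
  obtain ⟨Z, hZ, hZc⟩ := exists_isZeta_of_isPseudodifferential hsimple hD hd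
    (IsDiffTame.one.isPseudodifferential hD hg) IsOPZero.one
  have hcont : ∀ j, ∃ Z, IsContinuation d (signedMoment (pairWeight hD f 1 1) l d j) Z := by
    intro j
    rcases Nat.even_or_odd' j with ⟨i, rfl | rfl⟩
    · rw [signedMoment_even hD hB hA hg]
      exact (hAt.intertwine_iterate hD hg IsDiffTame.one _).exists_isContinuation hsimple hD hd
    · rw [signedMoment_odd hD hB hA hg]
      exact (hAt.intertwine_iterate hD hg IsDiffTame.one _).exists_isContinuation_mul_signOp
        hsimple hD hd
  choose Zj hZj using hcont
  have hm0 : signedMoment (pairWeight hD f 1 1) l d 0 = diagEntry hD 1 :=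
    signedMoment_even hD hB hA hg 0
  have hbig : ∀ (j : ℕ) (m : ℂ), 3 < m.re →
      HasRes d (signedMoment (pairWeight hD f 1 1) l d j) m 0 := fun j m hm => by
    obtain ⟨C, hC⟩ := hw.norm_signedMoment_le j
    exact (hZj j).hasRes_of_lt hd (fun k => (hC k).2) hm
  -- the residues of the moments of order 0, 1, 2 and 3
  have hres0 : ∀ m : ℂ, HasRes d (signedMoment (pairWeight hD f 1 1) l d 0) m
      (ncInt D (absPow D (-m))) := fun m => by
    have h := hZc.hasRes_ncInt hd IsBdd.one m
    rwa [one_mul, ← hm0] at h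
  have hres1 : ∀ m : ℂ, HasRes d (signedMoment (pairWeight hD f 1 1) l d 1) m
      (-1 * (2 * ncInt D (Φ * F * absPow D (-m)))) := fun m => by
    rw [show signedMoment (pairWeight hD f 1 1) l d 1 = _ from
      funext (signedMoment_one hD hB hA hg)]
    exact (hasRes_potential hsimple hD hd hreg hF hφ m).const_mul (-1)
  have hres2 : ∀ m : ℂ, HasRes d (signedMoment (pairWeight hD f 1 1) l d 2) m
      (2 * ncInt D (Φ ^ 2 * absPow D (-m)) + 2 * ncInt D (Φ * Φ' * absPow D (-m))) := fun m => by
    rw [show signedMoment (pairWeight hD f 1 1) l d 2 = _ from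
      funext (signedMoment_two hD hB hA hg)]
    exact hasRes_potential_sq hsimple hD hd hreg hF hφ m
  have hres3 : HasRes d (signedMoment (pairWeight hD f 1 1) l d 3) 3
      (0 + -1 * (2 * ncInt D (Φ ^ 3 * F * absPow D (-3)) +
        6 * ncInt D (Φ ^ 2 * Φ' * F * absPow D (-3)))) := by
    rw [show signedMoment (pairWeight hD f 1 1) l d 3 = _ from
      funext (signedMoment_three hD hB hA hg)]
    obtain ⟨C, hC⟩ := (((hAt.commutator hD hg).mul hAt).2.op.mul hFb).isBdd.exists_norm_diagEntry_le
      hD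
    obtain ⟨C', hC'⟩ := ((hAt.pow 3).2.op.mul hFb).isBdd.exists_norm_diagEntry_le hD
    refine (hasRes_commutator_potential hsimple hD hd hreg hF hφ).add hd hC (B' := C')
      (fun k => ?_) ((hasRes_potential_cube hsimple hD hd hreg hF hφ 3).const_mul (-1))
    rw [norm_mul, norm_neg, norm_one, one_mul]
    exact hC' k
  -- the residues of the zeta function of `D_Φ`
  obtain ⟨ZΦ, hZΦ, hresΦ, hlim⟩ := exists_isZeta_perturbed hD hB hA hAt.2 hd hl hZj
  have key : ∀ (m : ℝ) (r₁ r₂ : ℂ), 0 < m →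
      HasRes d (signedMoment (pairWeight hD f 1 1) l d 1) ((m : ℂ) + 1) r₁ →
      HasRes d (signedMoment (pairWeight hD f 1 1) l d 2) ((m : ℂ) + 2) r₂ →
      HasNCInt D (S.perturbedAbsPow φ (-(m : ℂ)))
        (ncInt D (absPow D (-(m : ℂ))) + m * r₁ + m * (m + 1) / 2 * r₂) ∧
      HasSimpleResidue ZΦ m
        (ncInt D (absPow D (-(m : ℂ))) + m * r₁ + m * (m + 1) / 2 * r₂) := by
    intro m r₁ r₂ hm h1 h2
    rw [← sum_negBinom_mul]
    have hr : ∀ j < 4, HasRes d (signedMoment (pairWeight hD f 1 1) l d j) ((m : ℂ) + j)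
        (if j = 0 then ncInt D (absPow D (-(m : ℂ))) else if j = 1 then r₁
          else if j = 2 then r₂ else 0) := by
      intro j hj
      interval_cases j
      · simpa using hres0 m
      · simpa using h1
      · simpa using h2
      · simpa using hbig 3 ((m : ℂ) + 3) (by simp; linarith)
    exact ⟨hasNCInt_perturbed hD hB hA hAt.2 hd hl hZj hm.le hr, hresΦ m _ hm.le hr⟩
  have hra := key 3 0 0 (by norm_num) (hbig 1 _ (by norm_num)) (hbig 2 _ (by norm_num))
  have hrb := key 2 _ 0 (by norm_num) (hres1 _) (hbig 2 _ (by norm_num))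
  have hrc := key 1 _ _ (by norm_num) (hres1 _) (hres2 _)
  norm_num at hra hrb hrc
  -- the integer powers of `D` in terms of `F` and `|D|`
  have hF2 : F ^ 2 = 1 := hD.signOp_sq hg
  have hp1 : intPow D (-1) = F * absPow D (-1) := by
    have := hD.intPow_neg_natCast hg 1
    simpa using this
  have hp2 : intPow D (-2) = absPow D (-2) := by
    have := hD.intPow_neg_natCast hg 2
    rw [hF2, one_mul] at this
    exact_mod_cast this
  have hp3 : intPow D (-3) = F * absPow D (-3) := by
    have := hD.intPow_neg_natCast hg 3
    rw [pow_succ, hF2, one_mul] at this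
    exact_mod_cast this
  have hnc : ∀ {X : SmoothOp D}, IsDiffTame S X → ∀ m : ℂ,
      HasNCInt D (X * absPow D (-m)) (ncInt D (X * absPow D (-m))) := fun hX m =>
    (hX.hasRes hsimple hD hd m).hasNCInt hD hd hX.2.op.isBdd
  have hncF : ∀ {X : SmoothOp D}, IsDiffTame S X → ∀ m : ℂ,
      HasNCInt D (X * F * absPow D (-m)) (ncInt D (X * F * absPow D (-m))) := fun hX m =>
    (hX.hasRes_mul_signOp hsimple hD hd m).hasNCInt hD hd (hX.2.op.mul hFb).isBdd
  have hnc1 : ∀ m : ℂ, ∃ r, HasNCInt D (absPow D (-m)) r := fun m =>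
    ⟨_, by simpa only [one_mul] using hnc IsDiffTame.one m⟩
  have e1 : Φ * intPow D (-1) = Φ * F * absPow D (-1) := by rw [hp1, mul_assoc]
  have e3 : ∀ X : SmoothOp D, X * intPow D (-3) = X * F * absPow D (-3) := fun X => by
    rw [hp3, mul_assoc]
  have hcomm : ncInt D (dΦ * (Φ + Φ') * F * absPow D (-3)) = 0 :=
    ((hasRes_commutator_left hsimple hD hd hreg hF hφ).hasNCInt hD hd
      ((hdΦ.mul hAt).2.op.mul hFb).isBdd).ncInt_eq hD
  have hsq : ncInt D (Φ * (Φ + Φ') * intPow D (-2)) =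
      ncInt D (Φ ^ 2 * absPow D (-2)) + ncInt D (Φ * Φ' * absPow D (-2)) := by
    rw [hp2]
    have h := ((hΦ.pow 2).hasRes hsimple hD hd 2).diagEntry_add hd (hΦ.pow 2).2.op.isBdd
      (hΦ.mul hΦ').2.op.isBdd ((hΦ.mul hΦ').hasRes hsimple hD hd 2)
    rw [pow_two, ← mul_add] at h
    rw [pow_two]
    exact (h.hasNCInt hD hd (hΦ.mul hAt).2.op.isBdd).ncInt_eq hD
  have hlim' : Tendsto (fun s => ZΦ s - Z s) (𝓝[≠] 0) (𝓝 rd) := by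
    have h := hlim (fun j => if j = 0 then -1 * (2 * ncInt D (Φ * F * absPow D (-1)))
      else if j = 1 then
        2 * ncInt D (Φ ^ 2 * absPow D (-2)) + 2 * ncInt D (Φ * Φ' * absPow D (-2))
      else 0 + -1 * (2 * ncInt D (Φ ^ 3 * F * absPow D (-3)) +
        6 * ncInt D (Φ ^ 2 * Φ' * F * absPow D (-3)))) fun j hj => by
      interval_cases j
      · simpa using hres1 1
      · simpa using hres2 2
      · simpa using hres3
    have h2 : Zj 0 =ᶠ[𝓝[≠] 0] Z := (hZj 0).eventuallyEq (hm0 ▸ hZc) 0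
    have h3 := h.congr' (f₂ := fun s => ZΦ s - Z s) (by filter_upwards [h2] with s hs; rw [hs])
    convert h3 using 2
    simp only [rd, hcomm, hsq, e1, e3]
    norm_num
    ring
  have hrb' : ncInt D (absPow D (-2)) + -(2 * (2 * ncInt D (Φ * F * absPow D (-3)))) = rb := by
    simp only [rb]; ring
  have hrc' : ncInt D (absPow D (-1)) + -(2 * ncInt D (Φ * F * absPow D (-2))) +
      (2 * ncInt D (Φ ^ 2 * absPow D (-3)) + 2 * ncInt D (Φ * Φ' * absPow D (-3))) = rc := by
    simp only [rc]; ring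
  rw [hrb'] at hrb
  rw [hrc'] at hrc
  refine ⟨?_, hra.1, hrb.1, hrc.1, Z, ZΦ, hZ, hZΦ, hra.2, hrb.2, hrc.2, hlim', fun hZ0 => ?_⟩
  · intro T hT
    simp only [Set.mem_insert_iff, Set.mem_singleton_iff] at hT
    rcases hT with rfl | rfl | rfl | rfl | rfl | rfl | rfl | rfl | rfl | rfl | rfl | rfl
    · exact hnc1 3
    · exact hnc1 2
    · exact hnc1 1
    · exact ⟨_, hncF hΦ 3⟩
    · exact ⟨_, hncF hΦ 2⟩
    · exact ⟨_, hnc (hΦ.pow 2) 3⟩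
    · exact ⟨_, hnc (hΦ.mul hΦ') 3⟩
    · rw [e1]; exact ⟨_, hncF hΦ 1⟩
    · rw [hp2]; exact ⟨_, hnc (hΦ.mul hAt) 2⟩
    · rw [e3]; exact ⟨_, hncF (hdΦ.mul hAt) 3⟩
    · rw [e3]; exact ⟨_, hncF (hΦ.pow 3) 3⟩
    · rw [e3]; exact ⟨_, hncF ((hΦ.pow 2).mul hΦ') 3⟩
  · have h1 : Tendsto ZΦ (𝓝[≠] 0) (𝓝 (rd + Z 0)) := by
      have h2 := hlim'.add (hZ0.continuousAt.tendsto.mono_left nhdsWithin_le_nhds)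
      simpa only [sub_add_cancel] using h2
    obtain ⟨h2, h3⟩ := analyticAt_of_tendsto (hZΦ.1 (Set.mem_univ 0)) h1
    exact ⟨h2, by rw [h3, add_sub_cancel_right]⟩
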